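/- Let $M,N,P\ge 3$ be integers, at least one of which is even, and suppose that the multiset $\{M,N,P\}$ is not of the form $\{2m+1,4,4\}$ with $m\in\mathbb N$ (that is, $(M,N,P)$ is not a permutation of $(2m+1,4,4)$). Let $$G=G_{MNP}=\langle a,b,c \mid (a,b)_M=(b,a)_M,\ (b,c)_N=(c,b)_N,\ (c,a)_P=(a,c)_P\rangle$$ be the triangle Artin group, where $(s,t)_n=sts\cdots$ denotes the alternating word of length $n$. Put $$A=\langle ab,\ bc,\ ca\rangle,\qquad B=\langle abc,\ a\,(a,b)_M\,a^{-1},\ ab\,(b,c)_N\,b^{-1}a^{-1},\ (c,a)_P\rangle,\qquad C=A\cap B .$$ Then $A$, $B$, $C$ are free of ranks $3$, $4$, $7$ respectively, $[B:C]=2$, $G$ splits as the amalgamated product $G=A*_C B$ (the natural homomorphism from the abstract amalgamated product to $G$ is an isomorphism), and $G$ has finite stature with respect to $\{A\}$. Here, for a group $G$ and a collection $\Omega$ of subgroups, $G$ has finite stature with respect to $\Omega$ if for every $H\in\Omega$ there are only finitely many $H$-conjugacy classes of infinite subgroups of the form $H\cap D$, where $D$ is an intersection of a (possibly infinite) family of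 $G$-conjugates of elements of $\Omega$. -/

import Mathlib

open scoped Pointwise

/-! ### Finite stature -/

section FiniteStature

variable {G : Type*} [Group G]

/-- The infinite subgroups of `G` of the form `H ∩ D`, where `D` is the intersection of a
(possibly infinite) family of `G`-conjugates of members of `Ω`. -/
def statureSubgroups (Ω : Set (Subgroup G)) (H : Subgroup G) : Set (Subgroup G) :=
  {K | Infinite K ∧
    ∃ S : Set (Subgroup G), (∀ D ∈ S, ∃ g : G, ∃ L ∈ Ω, D = MulAut.conj g • L) ∧ K = H ⊓ sInf S}

/-- The `H`-conjugacy class of a subgroup `K` of `G`: all `h K h⁻¹` with `h ∈ H`. -/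
def subgroupConjClass (H K : Subgroup G) : Set (Subgroup G) :=
  {L | ∃ h ∈ H, L = MulAut.conj h • K}

/-- `(G, Ω)` has finite stature: for each `H ∈ Ω` there are only finitely many `H`-conjugacy
classes of infinite subgroups `H ∩ D`, with `D` an intersection of `G`-conjugates of members
of `Ω`. -/
def HasFiniteStature (Ω : Set (Subgroup G)) : Prop :=
  ∀ H ∈ Ω, (subgroupConjClass H '' statureSubgroups Ω H).Finite

end FiniteStature

/-! ### Amalgamated products -/

section Amalgam

variable {G : Type*} [Group G]

/-- The natural homomorphism to `G` from the abstract pushout, over a common subgroup `C`, of a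
family of subgroups `H i` of `G`; it restricts to the inclusion on each `H i`. -/
def amalgamMap {ι : Type*} (H : ι → Subgroup G) (C : Subgroup G) (hC : ∀ i, C ≤ H i) :
    Monoid.PushoutI (fun i => Subgroup.inclusion (hC i)) →* G :=
  Monoid.PushoutI.lift (fun i => (H i).subtype) C.subtype (fun _ => rfl)

/-- `G = A *_C B` for subgroups `A`, `B` and a common subgroup `C` of them: the natural
homomorphism from the abstract amalgamated product to `G` is bijective. -/
def IsAmalgamatedProduct (A B C : Subgroup G) : Prop :=
  ∃ hC : ∀ i : Bool, C ≤ cond i A B,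
    Function.Bijective (amalgamMap (fun i : Bool => cond i A B) C hC)

end Amalgam

/-! ### Triangle Artin groups -/

/-- The alternating product `(s, t)_n = s t s ⋯` with `n` factors. -/
def altProd {G : Type*} [Monoid G] : G → G → ℕ → G
  | _, _, 0 => 1
  | s, t, n + 1 => s * altProd t s n

/-- The relators of the triangle Artin group on the generators `0, 1, 2` (called `a, b, c`):
`(a,b)_M = (b,a)_M`, `(b,c)_N = (c,b)_N`, `(c,a)_P = (a,c)_P`. -/
def triangleArtinRels (M N P : ℕ) : Set (FreeGroup (Fin 3)) :=
  let a := FreeGroup.of (0 : Fin 3)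
  let b := FreeGroup.of (1 : Fin 3)
  let c := FreeGroup.of (2 : Fin 3)
  {altProd a b M * (altProd b a M)⁻¹,
   altProd b c N * (altProd c b N)⁻¹,
   altProd c a P * (altProd a c P)⁻¹}

/-- The triangle Artin group `G_{MNP}` with finite labels `M`, `N`, `P`. -/
abbrev TriangleArtin (M N P : ℕ) : Type :=
  PresentedGroup (triangleArtinRels M N P)

namespace TriangleArtin

variable (M N P : ℕ)

/-- The standard generator `a`. -/
def a : TriangleArtin M N P := PresentedGroup.of 0

/-- The standard generator `b`. -/
def b : TriangleArtin M N P := PresentedGroup.of 1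

/-- The standard generator `c`. -/
def c : TriangleArtin M N P := PresentedGroup.of 2

/-- The vertex group `A = ⟨ab, bc, ca⟩`: the fundamental group of the bouquet `X_A` of three
loops, labelled by `ab`, `bc` and `ca`. -/
def vertexA : Subgroup (TriangleArtin M N P) :=
  Subgroup.closure {a M N P * b M N P, b M N P * c M N P, c M N P * a M N P}

/-- The vertex group `B`, generated by `abc` and by suitable conjugates of the three elements
`(a,b)_M`, `(b,c)_N`, `(c,a)_P`: the fundamental group of the quotient `X_B` of `X_C` by the
`π`-rotation, that is, of a triangle with one loop attached at each of its three vertices. -/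
def vertexB : Subgroup (TriangleArtin M N P) :=
  Subgroup.closure
    {a M N P * b M N P * c M N P,
     a M N P * altProd (a M N P) (b M N P) M * (a M N P)⁻¹,
     a M N P * b M N P * altProd (b M N P) (c M N P) N * (b M N P)⁻¹ * (a M N P)⁻¹,
     altProd (c M N P) (a M N P) P}

/-- The amalgamated subgroup `C = A ∩ B`. -/
def edgeC : Subgroup (TriangleArtin M N P) :=
  vertexA M N P ⊓ vertexB M N P

end TriangleArtin

/-!
Write `x l = g l * g (l + 1)` for the letters `ab`, `bc`, `ca`, where `g` runs through the generators
`a`, `b`, `c`, and `t = abc`; then `t² = x 0 * x 2 * x 1`, and `a`, `b`, `c` can be recovered from the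
letters and `t`.

**The splitting.** In terms of the letters and `t`, each Artin relation says that one word in the
letters is equal to another one multiplied by `t` or `t⁻¹` on both sides
(`artinRel_iff_gluingRel`). This presents the group as an amalgam of the free group on the
letters and a free group of rank `4` that contains `t`, over a free group of rank `7`. The inclusion
`edgeToA` of the latter in the former is injective because reduced words can be read
deterministically: there are three types, and a power `(x l) ^ e` leads from one type to at most one
other (`Rel`), along a circle of types whose length is `period M l`, that is, `M l / 2` or `M l`
(`carries_edgeToA`). The other inclusion `edgeToB` has index two (`edgeToB_index`).

**Finite stature.** The conjugates of `A` are the stabilisers of the vertices `G ⧸ A` of the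
Bass–Serre tree, so the subgroups in question are the pointwise stabilisers of sets `V` of vertices.
A vertex has three types of neighbours; the line of the powers of `x l` through an element meets the
types as above. Let `γ` fix a vertex and its neighbour, and let its axis in the Cayley graph of the
first vertex turn at `h` from one letter to another (`Corner`). Multiplication by a suitable
generator or inverse of one (`port`) transports the axis to the axis in the neighbouring vertex
(`Corner.transport`): lines keep their letter and X
length one may vanish, and a line of length one may be born at a corner whose third letter is the
type of the neighbour.

The labels enter through `exists_noTip`: apart from the labels `3, 3, 3` and `3, 4, 4`, along a path
without backtracking fixed by `γ`, no line is born, or vanishes, far from the ends of the path. Only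
the distinction of labels `3`, `4` and greater ones matters. In each case the segments of axes that
surround a newly born line are followed along all possible paths; after a bounded number of steps
no continuation without backtracking is left. This is a finite check (`dead`), which is made by
evaluation, and `IsSegment.step` shows that it is sound.

In the middle of a long path fixed by `γ` the transport is thus rigid: the path is moved along
itself by one element `U`, which commutes with `γ` (`FixedPath.commute`). Hence, if the stabiliser
`K` of `V` contains an element whose axis turns at the base point, it is the stabiliser of the
vertices that it fixes in a fixed finite set: an element `e` that fixes these commutes with `U`, and
any vertex of `V` that is far away can be moved by a power of `U` into the finite set
(`exists_fixingSubgroup_eq`). Otherwise `K` is, up to conjugation in `A`, a group of powers of one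
letter (`exists_turns_or_le_zpowers`); then it is generated by `(x l) ^ period M l`, which is central
in the dihedral Artin group of `l` (`fixingSubgroup_eq_zpowers`). Up to conjugation in `A` this
leaves finitely many subgroups.
-/

/-! ### First letters in free groups -/

namespace FreeGroup

variable {α : Type*} [DecidableEq α]

/-- The reduced word of `f` begins with the letter `q` or its inverse. -/
def First (f : FreeGroup α) (q : α) : Prop := f.toWord.head?.map Prod.fst = some q

theorem First.unique {f : FreeGroup α} {p q : α} (hp : First f p) (hq : First f q) : p = q := by
  unfold First at hp hq
  exact Option.some_injective _ (hp.symm.trans hq)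

@[simp] theorem not_first_one (q : α) : ¬ First (1 : FreeGroup α) q := by
  simp [First]

theorem First.ne_one {f : FreeGroup α} {q : α} (h : First f q) : f ≠ 1 := by
  rintro rfl; exact not_first_one q h

theorem exists_first {f : FreeGroup α} (h : f ≠ 1) : ∃ q, First f q := by
  unfold First
  rcases hf : f.toWord with _ | ⟨⟨q, b⟩, L⟩
  · exact absurd (toWord_eq_nil_iff.1 hf) h
  · exact ⟨q, rfl⟩

theorem toWord_cons_mul (s : α × Bool) (f : FreeGroup α)
    (h : ∀ b, f.toWord.head? = some (s.1, b) → b = s.2) :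
    (mk [s] * f).toWord = s :: f.toWord := by
  have hred : IsReduced (s :: f.toWord) := by
    rcases hf : f.toWord with _ | ⟨⟨q, b⟩, L⟩
    · exact IsReduced.singleton
    · rw [isReduced_cons_cons]
      refine ⟨fun hq => ?_, hf ▸ isReduced_toWord⟩
      exact (h b (by rw [hf]; simp [show s.1 = q from hq])).symm
  conv_lhs => rw [← mk_toWord (x := f), mul_mk, toWord_mk]
  exact hred.reduce_eq

theorem toWord_cons_mul_cancel (q : α) (b : Bool) (f : FreeGroup α)
    (h : f.toWord.head? = some (q, !b)) :
    f.toWord = (q, !b) :: (mk [(q, b)] * f).toWord := by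
  rcases hf : f.toWord with _ | ⟨⟨q', b'⟩, L⟩
  · simp [hf] at h
  · rw [hf] at h
    simp only [List.head?_cons, Option.some.injEq, Prod.mk.injEq] at h
    obtain ⟨rfl, rfl⟩ := h
    have hL : IsReduced L := by
      have := isReduced_toWord (x := f)
      rw [hf] at this
      exact this.tail
    have : mk [(q', b)] * f = mk L := by
      rw [← mk_toWord (x := f), hf, mul_mk]
      exact Quot.sound Red.Step.cons_not
    rw [this, toWord_mk, hL.reduce_eq]

/-- Either the first letter of `u` is still the first letter of `u * v`, or `u` cancels completely
against `v`. -/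
theorem First.mul_or_norm_le {u : FreeGroup α} {q : α} (hu : First u q) (v : FreeGroup α) :
    First (u * v) q ∨ norm (u * v) + norm u ≤ norm v := by
  -- the exact first signed letter is needed for the induction
  suffices H : ∀ (L : List (α × Bool)), IsReduced L →
      (∀ s ∈ L.head?, (mk L * v).toWord.head? = some s) ∨
        norm (mk L * v) + L.length ≤ norm v by
    rcases H u.toWord isReduced_toWord with h | h
    · left
      rw [mk_toWord] at h
      unfold First at hu ⊢
      rcases hs : u.toWord.head? with _ | s
      · simp [hs] at hu
      · rw [h s hs, ← hs, hu]
    · right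
      rwa [mk_toWord] at h
  intro L
  induction L with
  | nil => intro _; right; simp [show (mk [] : FreeGroup α) = 1 from rfl]
  | cons s L ih =>
    obtain ⟨a, b⟩ := s
    intro hL
    have e : mk ((a, b) :: L) * v = mk [(a, b)] * (mk L * v) := by
      rw [← mul_assoc, mul_mk]; rfl
    rw [e]
    by_cases hc : (mk L * v).toWord.head? = some (a, !b)
    · rcases ih hL.tail with h | h
      · rcases L with _ | ⟨s', L⟩
        · right
          have := congrArg List.length (toWord_cons_mul_cancel a b _ hc)
          rw [show (mk [] : FreeGroup α) = 1 from rfl, one_mul] at this ⊢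
          simp only [List.length_cons, List.length_nil, norm] at this ⊢
          omega
        · exfalso
          rw [h s' rfl] at hc
          have h1 := (isReduced_cons_cons.1 hL).1
          simp only [Option.some.injEq] at hc
          rw [hc] at h1
          simpa using h1 rfl
      · right
        have := congrArg List.length (toWord_cons_mul_cancel a b _ hc)
        simp only [List.length_cons, norm] at this h ⊢
        omega
    · left
      rintro s' ⟨⟩
      rw [toWord_cons_mul]
      · rfl
      · intro b' hb
        by_contra hne
        apply hc
        rw [hb]
        cases b <;> cases b' <;> simp_all

theorem toWord_zpow_mul {q : α} {f : FreeGroup α} (hf : ¬ First f q) (b : Bool) (n : ℕ) :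
    (mk [(q, b)] ^ n * f).toWord = List.replicate n (q, b) ++ f.toWord := by
  induction n with
  | zero => simp
  | succ n ih =>
    rw [pow_succ', mul_assoc, toWord_cons_mul, ih]
    · rfl
    · intro b' hb'
      rw [ih] at hb'
      rcases n with _ | n
      · exact absurd (by simp only [List.replicate_zero, List.nil_append] at hb'
                         simp [First, hb']) hf
      · simp only [List.replicate_succ, List.cons_append, List.head?_cons, Option.some.injEq,
          Prod.mk.injEq, true_and] at hb'
        exact hb'.symm

theorem first_zpow_mul {q : α} {f : FreeGroup α} (hf : ¬ First f q) {e : ℤ} (he : e ≠ 0) :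
    First (of q ^ e * f) q := by
  obtain ⟨n, rfl | rfl⟩ := e.eq_nat_or_neg
  · have hn : n ≠ 0 := by simpa using he
    obtain ⟨m, rfl⟩ := Nat.exists_eq_succ_of_ne_zero hn
    rw [zpow_natCast, First, show (of q : FreeGroup α) = mk [(q, true)] from rfl,
      toWord_zpow_mul hf]
    rfl
  · have hn : n ≠ 0 := by simpa using he
    obtain ⟨m, rfl⟩ := Nat.exists_eq_succ_of_ne_zero hn
    rw [zpow_neg, zpow_natCast, ← inv_pow, First,
      show (of q : FreeGroup α)⁻¹ = mk [(q, false)] from rfl, toWord_zpow_mul hf]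
    rfl

theorem first_zpow {q : α} {e : ℤ} (he : e ≠ 0) : First (of q ^ e) q := by
  simpa using first_zpow_mul (not_first_one q) he

/-- Splitting off the first syllable. -/
theorem First.exists_zpow_mul {f : FreeGroup α} {q : α} (h : First f q) :
    ∃ (e : ℤ) (f' : FreeGroup α), e ≠ 0 ∧ f = of q ^ e * f' ∧ ¬ First f' q ∧ norm f' < norm f := by
  -- remove the letters of the first syllable one by one
  have key : ∀ (b : Bool) (n : ℕ) (f : FreeGroup α), norm f = n → f.toWord.head? = some (q, b) →
      ∃ (k : ℕ) (f' : FreeGroup α), f = mk [(q, b)] ^ (k + 1) * f' ∧ ¬ First f' q ∧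
        norm f' < norm f := by
    intro b n
    induction n with
    | zero =>
      intro f hf hb
      rw [norm_eq_zero] at hf
      subst hf
      simp at hb
    | succ n ih =>
      intro f hf hb
      have hc := toWord_cons_mul_cancel q (!b) f (by simpa using hb)
      set f₁ := mk [(q, !b)] * f with hf₁
      have hinv : f = mk [(q, b)] * f₁ := by
        rw [hf₁, ← mul_assoc]
        have : (mk [(q, b)] : FreeGroup α) * mk [(q, !b)] = 1 := by
          rw [mul_mk]; exact Quot.sound Red.Step.cons_not
        rw [this, one_mul]
      have hlen : norm f = norm f₁ + 1 := by
        have := congrArg List.length hc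
        simpa [norm] using this
      by_cases h1 : First f₁ q
      · obtain ⟨b', hb'⟩ : ∃ b', f₁.toWord.head? = some (q, b') := by
          unfold First at h1
          rcases hh : f₁.toWord.head? with _ | ⟨q', b'⟩
          · simp [hh] at h1
          · simp only [hh, Option.map_some, Option.some.injEq] at h1
            exact ⟨b', by rw [h1]⟩
        have hbb : b' = b := by
          have hr := isReduced_toWord (x := f)
          rw [hc] at hr
          rcases hw : f₁.toWord with _ | ⟨s, L⟩
          · simp [hw] at hb'
          · rw [hw] at hr hb'
            simp only [List.head?_cons, Option.some.injEq] at hb'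
            subst hb'
            have := (isReduced_cons_cons.1 hr).1 rfl
            simpa using this.symm
        subst hbb
        obtain ⟨k, f', hk, hf', hn⟩ := ih f₁ (by omega) hb'
        refine ⟨k + 1, f', ?_, hf', by omega⟩
        rw [pow_succ', mul_assoc, ← hk]
        exact hinv
      · exact ⟨0, f₁, by simpa using hinv, h1, by omega⟩
  obtain ⟨b, hb⟩ : ∃ b, f.toWord.head? = some (q, b) := by
    unfold First at h
    rcases hh : f.toWord.head? with _ | ⟨q', b'⟩
    · simp [hh] at h
    · simp only [hh, Option.map_some, Option.some.injEq] at h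
      exact ⟨b', by rw [h]⟩
  obtain ⟨k, f', hk, hf', hn⟩ := key b _ f rfl hb
  cases b with
  | true => exact ⟨(k + 1 : ℕ), f', by omega, by rw [zpow_natCast]; exact hk, hf', hn⟩
  | false =>
    refine ⟨-(k + 1 : ℕ), f', by omega, ?_, hf', hn⟩
    rw [zpow_neg, zpow_natCast, ← inv_pow]
    exact hk

/-- The first syllable and the rest of the word are determined by the element. -/
theorem zpow_mul_unique {q q' : α} {e e' : ℤ} {f f' : FreeGroup α} (he : e ≠ 0) (he' : e' ≠ 0)
    (hf : ¬ First f q) (hf' : ¬ First f' q') (h : of q ^ e * f = of q' ^ e' * f') :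
    q = q' ∧ e = e' ∧ f = f' := by
  have hq : q = q' := by
    refine (first_zpow_mul hf he).unique ?_
    rw [h]
    exact first_zpow_mul hf' he'
  subst hq
  have hfe : f = of q ^ (e' - e) * f' := by
    rw [sub_eq_neg_add, zpow_add, mul_assoc, ← h, ← mul_assoc, ← zpow_add]
    simp
  by_cases hee : e' - e = 0
  · refine ⟨rfl, by omega, ?_⟩
    rw [hfe, hee]; simp
  · exact absurd (hfe ▸ first_zpow_mul hf' hee) hf

theorem finite_norm_le [Finite α] (n : ℕ) : {f : FreeGroup α | norm f ≤ n}.Finite := by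
  refine Set.Finite.of_finite_image (f := toWord) ?_ toWord_injective.injOn
  refine (List.finite_length_le (α × Bool) n).subset ?_
  rintro _ ⟨f, hf, rfl⟩
  exact hf

end FreeGroup

/-! ### Labelled readings of reduced words -/

namespace TriangleWord

open FreeGroup (of First first_zpow_mul not_first_one)

variable (M : Fin 3 → ℕ)

theorem fin3_cases (l τ : Fin 3) : τ = l - 1 ∨ τ = l + 1 ∨ τ = l := by
  revert l τ; decide

theorem fin3_ne (l : Fin 3) :
    l - 1 ≠ l ∧ l + 1 ≠ l ∧ l + 1 ≠ l - 1 ∧ l ≠ l - 1 ∧ l ≠ l + 1 ∧ l - 1 ≠ l + 1 := by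
  revert l; decide

/-- The length of the circle that carries the types along a line of letter `l`: half of `M l` if
`M l` is even, and `M l` if it is odd. -/
def period (l : Fin 3) : ℤ := if Even (M l) then (M l / 2 : ℕ) else M l

/-- For even `M l` the type `l` lies on a circle of its own (`true`), away from the circle of the
two other types; for odd `M l` all three types lie on one circle. -/
def circle (l τ : Fin 3) : Bool := decide (Even (M l) ∧ τ = l)

/-- The position of the type `τ` on its circle along a line of letter `l`. -/
def position (l τ : Fin 3) : ℤ :=
  if τ = l - 1 then 0 else if τ = l + 1 then 1 else
    if Even (M l) then 0 else ((M l / 2 : ℕ) : ℤ) + 1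

/-- The power `e` of the letter `l` leads from the type `σ` to the type `τ`. -/
def Rel (l : Fin 3) (e : ℤ) (σ τ : Fin 3) : Prop :=
  circle M l σ = circle M l τ ∧ ∃ k : ℤ, e = k * period M l + position M l τ - position M l σ

/-- The free generators of the edge group: `none` stands for `(abc)²`, and two generators
belong to each letter. -/
abbrev EdgeIndex : Type := Option (Fin 3 ⊕ Fin 3)

/-- The label of the arc of length one from the type `l - 1` to the type `l + 1`. -/
def arcLabel (l : Fin 3) : FreeGroup EdgeIndex := if l = 2 then of none else 1

/-- The label of the path from the base point of a circle to the type `τ`. -/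
def potential (l τ : Fin 3) : FreeGroup EdgeIndex :=
  if τ = l - 1 then 1 else if τ = l + 1 then arcLabel l else
    if Even (M l) then 1 else arcLabel l * of (some (.inl l))

/-- The label of a full turn around a circle. -/
def turn (l : Fin 3) (κ : Bool) : FreeGroup EdgeIndex :=
  if Even (M l) then (if κ then of (some (.inr l)) else of (some (.inl l)))
  else arcLabel l * of (some (.inl l)) * of (some (.inr l))

/-- The power `e` of the letter `l` leads from `σ` to `τ` with label `c`. -/
def Arrow (l : Fin 3) (e : ℤ) (σ τ : Fin 3) (c : FreeGroup EdgeIndex) : Prop :=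
  circle M l σ = circle M l τ ∧ ∃ k : ℤ, e = k * period M l + position M l τ - position M l σ ∧
    c = (potential M l σ)⁻¹ * turn M l (circle M l σ) ^ k * potential M l τ

variable {M}

theorem Arrow.rel {l : Fin 3} {e : ℤ} {σ τ : Fin 3} {c} (h : Arrow M l e σ τ c) :
    Rel M l e σ τ := ⟨h.1, h.2.imp fun _ hk => hk.1⟩

theorem Rel.exists_arrow {l : Fin 3} {e : ℤ} {σ τ : Fin 3} (h : Rel M l e σ τ) :
    ∃ c, Arrow M l e σ τ c := by
  obtain ⟨h, k, hk⟩ := h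
  exact ⟨_, h, k, hk, rfl⟩

theorem Arrow.trans {l : Fin 3} {e e' : ℤ} {ρ σ τ : Fin 3} {c c'} (h : Arrow M l e ρ σ c)
    (h' : Arrow M l e' σ τ c') : Arrow M l (e + e') ρ τ (c * c') := by
  obtain ⟨h, k, hk, rfl⟩ := h
  obtain ⟨h', k', hk', rfl⟩ := h'
  refine ⟨h.trans h', k + k', by rw [hk, hk']; ring, ?_⟩
  rw [zpow_add, h]
  group

theorem Arrow.symm {l : Fin 3} {e : ℤ} {σ τ : Fin 3} {c} (h : Arrow M l e σ τ c) :
    Arrow M l (-e) τ σ c⁻¹ := by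
  obtain ⟨h, k, hk, rfl⟩ := h
  refine ⟨h.symm, -k, by rw [hk]; ring, ?_⟩
  rw [zpow_neg, h]
  group

theorem period_ge (hM : ∀ l, 3 ≤ M l) (l : Fin 3) :
    (Even (M l) ∧ 2 ≤ period M l ∧ (M l : ℤ) = 2 * period M l ∧ ((M l / 2 : ℕ) : ℤ) = period M l) ∨
      (¬ Even (M l) ∧ 3 ≤ period M l ∧ period M l = 2 * ((M l / 2 : ℕ) : ℤ) + 1) := by
  have := hM l
  unfold period
  by_cases h : Even (M l)
  · left
    have h' := Nat.even_iff.1 h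
    simp only [h, if_true]
    refine ⟨trivial, ?_, ?_, trivial⟩ <;> omega
  · right
    have h' := Nat.not_even_iff.1 h
    simp only [h, if_false]
    refine ⟨not_false, ?_, ?_⟩ <;> omega

theorem position_bounds (hM : ∀ l, 3 ≤ M l) (l τ : Fin 3) :
    0 ≤ position M l τ ∧ position M l τ < period M l := by
  obtain ⟨h1, h2, h3, h5⟩ | ⟨h1, h2, h3⟩ := period_ge hM l <;>
  · unfold position
    obtain ⟨a1, a2, a3, a4, a5, a6⟩ := fin3_ne l
    rcases fin3_cases l τ with hτ | hτ | hτ <;>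
    · simp only [hτ, h1, a3, a4, a5, if_true, if_false]
      constructor <;> omega

theorem position_injective (hM : ∀ l, 3 ≤ M l) {l σ τ : Fin 3} (h : circle M l σ = circle M l τ)
    (hp : position M l σ = position M l τ) : σ = τ := by
  obtain ⟨a1, a2, a3, a4, a5, a6⟩ := fin3_ne l
  obtain ⟨h1, h2, h3, h5⟩ | ⟨h1, h2, h3⟩ := period_ge hM l <;>
  · unfold position at hp
    unfold circle at h
    rcases fin3_cases l σ with hσ | hσ | hσ <;> rcases fin3_cases l τ with hτ | hτ | hτ <;>
      simp only [hσ, hτ, h1, a1, a2, a3, a4, a5, a6, if_true, if_false, and_true, and_false,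
        decide_true, decide_false, reduceCtorEq] at hp h ⊢ <;> omega

theorem Arrow.of_zero (hM : ∀ l, 3 ≤ M l) {l σ τ : Fin 3} {c} (h : Arrow M l 0 σ τ c) :
    σ = τ ∧ c = 1 := by
  obtain ⟨h, k, hk, rfl⟩ := h
  have h1 := position_bounds hM l σ
  have h2 := position_bounds hM l τ
  have hk0 : k = 0 := by
    by_contra hk0
    rcases lt_or_gt_of_ne hk0 with h0 | h0 <;> nlinarith
  subst hk0
  have := position_injective hM h (by linarith)
  subst this
  simp

theorem Rel.zero (l σ : Fin 3) : Rel M l 0 σ σ := ⟨rfl, 0, by ring⟩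

variable (M)

/-- The reduced word of `f` can be read from the type `σ` to the type `τ`, with label `c`. -/
inductive Reads : FreeGroup (Fin 3) → Fin 3 → Fin 3 → FreeGroup EdgeIndex → Prop
  | one (σ : Fin 3) : Reads 1 σ σ 1
  | cons {l : Fin 3} {e : ℤ} {f : FreeGroup (Fin 3)} {σ ρ τ : Fin 3} {c c' : FreeGroup EdgeIndex}
      (he : e ≠ 0) (hf : ¬ First f l) (ha : Arrow M l e σ ρ c) (hr : Reads f ρ τ c') :
      Reads (of l ^ e * f) σ τ (c * c')

/-- Left multiplication by `u` turns readings from `ρ` into readings from `σ`. -/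
def Carries (u : FreeGroup (Fin 3)) (σ ρ : Fin 3) (c : FreeGroup EdgeIndex) : Prop :=
  ∀ f τ c', Reads M f ρ τ c' → Reads M (u * f) σ τ (c * c')

variable {M}

theorem Carries.mul {u v : FreeGroup (Fin 3)} {σ ρ κ : Fin 3} {c d} (hu : Carries M u σ ρ c)
    (hv : Carries M v ρ κ d) : Carries M (u * v) σ κ (c * d) := by
  intro f τ c' hf
  rw [mul_assoc, mul_assoc]
  exact hu _ _ _ (hv _ _ _ hf)

theorem Carries.one (σ : Fin 3) : Carries M 1 σ σ 1 := by
  intro f τ c' hf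
  simpa using hf

theorem Arrow.carries (hM : ∀ l, 3 ≤ M l) {l : Fin 3} {e : ℤ} {σ ρ : Fin 3} {c}
    (h : Arrow M l e σ ρ c) : Carries M (of l ^ e) σ ρ c := by
  by_cases he : e = 0
  · subst he
    obtain ⟨rfl, rfl⟩ := h.of_zero hM
    simpa using Carries.one σ
  intro f τ c' hf
  cases hf with
  | one => exact Reads.cons he (not_first_one l) h (Reads.one _)
  | @cons l' e' f' _ ρ' _ c₁ c₂ he' hf' ha hr =>
    by_cases hl : l' = l
    · subst hl
      rw [← mul_assoc, ← zpow_add, ← mul_assoc]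
      have ht := h.trans ha
      by_cases h0 : e + e' = 0
      · rw [h0] at ht ⊢
        obtain ⟨rfl, h1⟩ := ht.of_zero hM
        rw [h1]
        simpa using hr
      · exact Reads.cons h0 hf' ht hr
    · refine Reads.cons he (fun hfst => hl ?_) h (Reads.cons he' hf' ha hr)
      exact (first_zpow_mul hf' he').unique hfst

/-- Coset representatives: `f` can be read from `σ` to `τ` if and only if
`(typeRep σ)⁻¹ * f * typeRep τ` lies in the edge group. -/
def typeRep : Fin 3 → FreeGroup (Fin 3) := ![of 1, (of 0)⁻¹, 1]

variable (M)

/-- The inclusion of the edge group into the vertex group `A`, in terms of free generators. -/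
def edgeToA : FreeGroup EdgeIndex →* FreeGroup (Fin 3) :=
  FreeGroup.lift fun
    | none => of 0 * of 2 * of 1
    | some (.inl l) => if Even (M l) then (typeRep (l - 1))⁻¹ * of l ^ (M l / 2) * typeRep (l - 1)
        else (typeRep (l + 1))⁻¹ * of l ^ (M l / 2) * typeRep l
    | some (.inr l) => if Even (M l) then (typeRep l)⁻¹ * of l ^ (M l / 2) * typeRep l
        else (typeRep l)⁻¹ * of l ^ (M l / 2) * typeRep (l - 1)

variable {M}

theorem edgeToA_arcLabel (l : Fin 3) :
    edgeToA M (arcLabel l) = (typeRep (l - 1))⁻¹ * of l * typeRep (l + 1) := by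
  fin_cases l <;> simp [arcLabel, edgeToA, typeRep, mul_assoc]

theorem edgeToA_none : edgeToA M (of none) = of 0 * of 2 * of 1 := by
  simp [edgeToA]

theorem edgeToA_inl (l : Fin 3) : edgeToA M (of (some (.inl l))) =
    if Even (M l) then (typeRep (l - 1))⁻¹ * of l ^ (M l / 2) * typeRep (l - 1)
        else (typeRep (l + 1))⁻¹ * of l ^ (M l / 2) * typeRep l := by
  simp [edgeToA]

theorem edgeToA_inr (l : Fin 3) : edgeToA M (of (some (.inr l))) =
    if Even (M l) then (typeRep l)⁻¹ * of l ^ (M l / 2) * typeRep l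
        else (typeRep l)⁻¹ * of l ^ (M l / 2) * typeRep (l - 1) := by
  simp [edgeToA]

theorem Arrow.edgeToA_eq {l : Fin 3} {e : ℤ} {σ τ : Fin 3} {c} (h : Arrow M l e σ τ c) :
    edgeToA M c = (typeRep σ)⁻¹ * of l ^ e * typeRep τ := by
  obtain ⟨h, k, rfl, rfl⟩ := h
  obtain ⟨a1, a2, a3, a4, a5, a6⟩ := fin3_ne l
  -- conjugate everything to the base point of the circle
  let base : Bool → Fin 3 := fun κ => if κ then l else l - 1
  have hpot : ∀ τ, edgeToA M (potential M l τ) =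
      (typeRep (base (circle M l τ)))⁻¹ * of l ^ (position M l τ) * typeRep τ := by
    intro τ
    rcases fin3_cases l τ with rfl | rfl | hτ
    · simp [potential, position, circle, base, a1]
    · simp [potential, position, circle, base, a2, a3, edgeToA_arcLabel]
    · by_cases he : Even (M l)
      · simp [potential, position, circle, base, he, hτ, a4, a5]
      · simp only [potential, position, circle, base, he, hτ, a4, a5, if_false, map_mul,
          edgeToA_arcLabel, edgeToA_inl, false_and, decide_false, Bool.false_eq_true]
        rw [add_comm ((M l / 2 : ℕ) : ℤ) 1, zpow_add, zpow_one, zpow_natCast]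
        simp only [mul_assoc, mul_inv_cancel_left]
  have hturn : edgeToA M (turn M l (circle M l σ)) =
      (typeRep (base (circle M l σ)))⁻¹ * of l ^ (period M l) * typeRep (base (circle M l σ)) := by
    by_cases he : Even (M l)
    · unfold turn period
      simp only [he, if_true]
      rcases hc : circle M l σ <;>
        simp only [base, edgeToA_inl, edgeToA_inr, he, if_true, if_false, Bool.false_eq_true,
          zpow_natCast]
    · have hodd : (M l : ℤ) = 1 + ((M l / 2 : ℕ) : ℤ) + ((M l / 2 : ℕ) : ℤ) := by
        have := Nat.not_even_iff.1 he
        omega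
      have h1 : edgeToA M (turn M l (circle M l σ)) = (typeRep (l - 1))⁻¹ * of l ^ (period M l) *
          typeRep (l - 1) := by
        unfold turn period
        simp only [he, if_false, map_mul, edgeToA_arcLabel, edgeToA_inl, edgeToA_inr]
        rw [hodd, zpow_add, zpow_add, zpow_one, zpow_natCast]
        simp only [mul_assoc, mul_inv_cancel_left]
      simpa [circle, base, he] using h1
  have hconj : ∀ (x y : FreeGroup (Fin 3)), (x⁻¹ * y * x) ^ k = x⁻¹ * y ^ k * x := by
    intro x y
    simpa using conj_zpow (i := k) (a := x⁻¹) (b := y)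
  rw [map_mul, map_mul, map_inv, map_zpow, hpot, hpot, hturn, ← h, hconj, ← zpow_mul,
    mul_comm (period M l) k, add_sub_assoc, add_comm, sub_eq_neg_add]
  have : (-position M l σ + position M l τ + k * period M l : ℤ) =
    -position M l σ + k * period M l + position M l τ := by ring
  rw [this, zpow_add, zpow_add, zpow_neg]
  group

theorem arrow_arc (l : Fin 3) : Arrow M l 1 (l - 1) (l + 1) (arcLabel l) := by
  obtain ⟨a1, a2, a3, a4, a5, a6⟩ := fin3_ne l
  refine ⟨by simp [circle, a1, a2], 0, by simp [position, a3], ?_⟩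
  simp [potential, a3]

theorem carries_typeRep_inv (hM : ∀ l, 3 ≤ M l) (σ : Fin 3) :
    Carries M (typeRep σ)⁻¹ 2 σ 1 ∧ Carries M (typeRep σ) σ 2 1 := by
  have h0 : Arrow M 0 1 2 1 1 := arrow_arc 0
  have h1 : Arrow M 1 1 0 2 1 := arrow_arc 1
  fin_cases σ
  · exact ⟨by simpa [typeRep] using h1.symm.carries hM, by simpa [typeRep] using h1.carries hM⟩
  · exact ⟨by simpa [typeRep] using h0.carries hM, by simpa [typeRep] using h0.symm.carries hM⟩
  · exact ⟨by simpa [typeRep] using Carries.one (M := M) 2,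
      by simpa [typeRep] using Carries.one (M := M) 2⟩

theorem Arrow.carries_edgeToA (hM : ∀ l, 3 ≤ M l) {l : Fin 3} {e : ℤ} {σ τ : Fin 3} {c}
    (h : Arrow M l e σ τ c) : Carries M (edgeToA M c) 2 2 c := by
  rw [h.edgeToA_eq]
  simpa using ((carries_typeRep_inv hM σ).1.mul (h.carries hM)).mul (carries_typeRep_inv hM τ).2

/-- Every free generator of the edge group is the label of an arrow. -/
theorem exists_arrow_generator (i : EdgeIndex) :
    ∃ l e σ τ, Arrow M l e σ τ (of i) := by
  rcases i with _ | l | l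
  · exact ⟨2, 1, 1, 0, arrow_arc 2⟩
  all_goals
    obtain ⟨a1, a2, a3, a4, a5, a6⟩ := fin3_ne l
    by_cases he : Even (M l)
  · refine ⟨l, period M l, l - 1, l - 1, rfl, 1, by ring, ?_⟩
    simp [potential, turn, he, circle, a1]
  · refine ⟨l, (M l / 2 : ℕ), l + 1, l, by simp [circle, he], 0, ?_, ?_⟩
    · simp [position, he, a3, a4, a5]
    · simp [potential, he, a3, a4, a5]
  · refine ⟨l, period M l, l, l, rfl, 1, by ring, ?_⟩
    simp [potential, turn, he, circle, a4, a5]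
  · refine ⟨l, (M l / 2 : ℕ), l, l - 1, by simp [circle, he], 1, ?_, ?_⟩
    · have := Nat.not_even_iff.1 he
      simp only [position, he, a4, a5, period, if_true, if_false]
      omega
    · simp only [potential, turn, he, a4, a5, if_true, if_false]
      group

theorem carries_edgeToA (hM : ∀ l, 3 ≤ M l) (c : FreeGroup EdgeIndex) :
    Carries M (edgeToA M c) 2 2 c := by
  induction c using FreeGroup.induction_on with
  | C1 => simpa using Carries.one (M := M) 2
  | of i =>
    obtain ⟨l, e, σ, τ, h⟩ := exists_arrow_generator (M := M) i
    exact h.carries_edgeToA hM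
  | inv_of i _ =>
    obtain ⟨l, e, σ, τ, h⟩ := exists_arrow_generator (M := M) i
    exact h.symm.carries_edgeToA hM
  | mul c d hc hd =>
    rw [map_mul]
    exact hc.mul hd

theorem edgeToA_injective (hM : ∀ l, 3 ≤ M l) : Function.Injective (edgeToA M) := by
  rw [injective_iff_map_eq_one]
  intro c hc
  have h := carries_edgeToA hM c 1 2 1 (Reads.one 2)
  rw [hc, mul_one, mul_one] at h
  generalize hf : (1 : FreeGroup (Fin 3)) = f at h
  cases h with
  | one => rfl
  | cons he hfst ha hr => exact absurd hf.symm (first_zpow_mul hfst he).ne_one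

/-- If an element of a double coset of the edge group begins with the syllable `l ^ e`, then that
syllable can be read along the line of `l`. -/
theorem exists_rel_of_mem_edgeToA_range (hM : ∀ l, 3 ≤ M l) {l : Fin 3} {e : ℤ}
    {f : FreeGroup (Fin 3)} (hf : ¬ First f l) {σ τ : Fin 3}
    (h : (typeRep σ)⁻¹ * (of l ^ e * f) * typeRep τ ∈ (edgeToA M).range) :
    ∃ ρ, Rel M l e σ ρ := by
  by_cases he : e = 0
  · subst he; exact ⟨σ, Rel.zero l σ⟩
  obtain ⟨c, hc⟩ := h
  have h := ((carries_typeRep_inv hM σ).2.mul (carries_edgeToA hM c)).mul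
    (carries_typeRep_inv hM τ).1 1 τ 1 (Reads.one τ)
  rw [hc] at h
  have heq : typeRep σ * ((typeRep σ)⁻¹ * (of l ^ e * f) * typeRep τ) * (typeRep τ)⁻¹ * 1 =
      of l ^ e * f := by group
  rw [heq] at h
  generalize hg : of l ^ e * f = g at h
  generalize (1 * c * 1 * 1 : FreeGroup EdgeIndex) = d at h
  cases h with
  | one => exact absurd hg (first_zpow_mul hf he).ne_one
  | cons he' hf' ha hr =>
    obtain ⟨rfl, rfl, rfl⟩ := FreeGroup.zpow_mul_unique he he' hf hf' hg
    exact ⟨_, ha.rel⟩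

/-- The distinct types lie in distinct double cosets of the edge group. -/
theorem eq_of_mem_edgeToA_range (hM : ∀ l, 3 ≤ M l) {σ τ : Fin 3}
    (h : (typeRep σ)⁻¹ * typeRep τ ∈ (edgeToA M).range) : σ = τ := by
  obtain ⟨c, hc⟩ := h
  have h := ((carries_typeRep_inv hM σ).2.mul (carries_edgeToA hM c)).mul
    (carries_typeRep_inv hM τ).1 1 τ 1 (Reads.one τ)
  rw [hc] at h
  have heq : typeRep σ * ((typeRep σ)⁻¹ * typeRep τ) * (typeRep τ)⁻¹ * 1 =
      (1 : FreeGroup (Fin 3)) := by group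
  rw [heq] at h
  generalize hg : (1 : FreeGroup (Fin 3)) = g at h
  generalize (1 * c * 1 * 1 : FreeGroup EdgeIndex) = d at h
  cases h with
  | one => rfl
  | cons he' hf' ha hr => exact absurd hg.symm (first_zpow_mul hf' he').ne_one

theorem Rel.unique (hM : ∀ l, 3 ≤ M l) {l : Fin 3} {e : ℤ} {σ τ τ' : Fin 3} (h : Rel M l e σ τ)
    (h' : Rel M l e σ τ') : τ = τ' := by
  obtain ⟨c, hc⟩ := h.exists_arrow
  obtain ⟨c', hc'⟩ := h'.exists_arrow
  have := hc.symm.trans hc'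
  rw [neg_add_cancel] at this
  exact (this.of_zero hM).1

end TriangleWord

namespace TriangleWord

open FreeGroup (of First first_zpow_mul not_first_one)

/-! ### The edge group as a subgroup of index two -/

/-- The exponents `±1` of `abc` before and after the generator `some l` in the image of the
free generator `some (.inl l)` of the edge group (`true` stands for `1`). -/
def twist (M : Fin 3 → ℕ) (l : Fin 3) : Bool × Bool :=
  ![(true, !decide (Even (M 0))), (false, decide (Even (M 1))),
    (decide (Even (M 2)), !decide (Even (M 2)))] l

/-- The sign `1` or `-1` encoded by a truth value. -/
def unitSign (b : Bool) : ℤ := if b then 1 else -1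

variable (M : Fin 3 → ℕ)

/-- The inclusion of the edge group into the vertex group `B`, in terms of free generators; the
generator `none` of `B` stands for `abc`. -/
def edgeToB : FreeGroup EdgeIndex →* FreeGroup (Option (Fin 3)) :=
  FreeGroup.lift fun
    | none => of none ^ 2
    | some (.inl l) =>
        of none ^ unitSign (twist M l).1 * of (some l) * of none ^ unitSign (twist M l).2
    | some (.inr l) => of (some l)

theorem edgeToB_none : edgeToB M (of none) = of none ^ 2 := by simp [edgeToB]

theorem edgeToB_inl (l : Fin 3) : edgeToB M (of (some (.inl l))) =
    of none ^ unitSign (twist M l).1 * of (some l) * of none ^ unitSign (twist M l).2 := by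
  simp [edgeToB]

theorem edgeToB_inr (l : Fin 3) : edgeToB M (of (some (.inr l))) = of (some l) := by
  simp [edgeToB]

/-- The action of `abc` on two copies of the edge group, induced from left translation. -/
def swapPerm : Equiv.Perm (FreeGroup EdgeIndex × Bool) where
  toFun p := if p.2 then (of none * p.1, false) else (p.1, true)
  invFun p := if p.2 then (p.1, false) else ((of none)⁻¹ * p.1, true)
  left_inv := by rintro ⟨c, _ | _⟩ <;> simp
  right_inv := by rintro ⟨c, _ | _⟩ <;> simp

/-- Left translation by `u` on one copy of the edge group and by `v` on the other. -/
def translatePerm (u v : FreeGroup EdgeIndex) : Equiv.Perm (FreeGroup EdgeIndex × Bool) where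
  toFun p := if p.2 then (v * p.1, true) else (u * p.1, false)
  invFun p := if p.2 then (v⁻¹ * p.1, true) else (u⁻¹ * p.1, false)
  left_inv := by rintro ⟨c, _ | _⟩ <;> simp
  right_inv := by rintro ⟨c, _ | _⟩ <;> simp

/-- The action of the vertex group `B` induced from left translation of the edge group. -/
def inducedAction : FreeGroup (Option (Fin 3)) →* Equiv.Perm (FreeGroup EdgeIndex × Bool) :=
  FreeGroup.lift fun
    | none => swapPerm
    | some l => translatePerm (of (some (.inr l)))
        ((if (twist M l).1 then (of none)⁻¹ else 1) * of (some (.inl l)) *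
          (if (twist M l).2 then 1 else of none))

theorem inducedAction_edgeToB (c d : FreeGroup EdgeIndex) :
    inducedAction M (edgeToB M c) (d, false) = (c * d, false) := by
  induction c using FreeGroup.induction_on generalizing d with
  | C1 => simp
  | of i =>
    rcases i with _ | l | l
    · simp [edgeToB_none, pow_two, inducedAction, swapPerm]
    · rcases h1 : (twist M l).1 <;> rcases h2 : (twist M l).2 <;>
        simp [edgeToB_inl, unitSign, h1, h2, inducedAction, swapPerm, translatePerm,
          Equiv.Perm.inv_def, mul_assoc, Equiv.symm]
    · simp [edgeToB_inr, inducedAction, translatePerm]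
  | inv_of i ih =>
    rw [map_inv, map_inv, Equiv.Perm.inv_def, Equiv.symm_apply_eq, ih]
    simp
  | mul x y hx hy => rw [map_mul, map_mul, Equiv.Perm.mul_apply, hy, hx, mul_assoc]

/-- The edge group can be recovered from its action by left translation on one of the two copies. -/
theorem edgeToB_injective : Function.Injective (edgeToB M) := by
  rw [injective_iff_map_eq_one]
  intro c hc
  have := inducedAction_edgeToB M c 1
  rw [hc, map_one] at this
  simpa using (congrArg Prod.fst this).symm

theorem not_mem_edgeToB_range : (of none : FreeGroup (Option (Fin 3))) ∉ (edgeToB M).range := by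
  rintro ⟨c, hc⟩
  have := inducedAction_edgeToB M c 1
  rw [hc] at this
  simp [inducedAction, swapPerm] at this

theorem even_zpow_mem_range (k : ℤ) : (of none) ^ (2 * k) ∈ (edgeToB M).range := by
  rw [zpow_mul]
  have h : (of none : FreeGroup (Option (Fin 3))) ^ (2 : ℤ) ∈ (edgeToB M).range :=
    ⟨of none, by rw [edgeToB_none]; norm_cast⟩
  exact Subgroup.zpow_mem _ h k

theorem conj_mem_edgeToB_range {f : FreeGroup (Option (Fin 3))} (hf : f ∈ (edgeToB M).range) :
    of none * f * (of none)⁻¹ ∈ (edgeToB M).range := by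
  obtain ⟨c, rfl⟩ := hf
  induction c using FreeGroup.induction_on with
  | C1 => simp
  | of i =>
    rcases i with _ | l | l
    · rw [edgeToB_none]
      convert even_zpow_mem_range M 1 using 1
      group
    · -- both exponents of `abc` become even
      obtain ⟨j, hj⟩ : ∃ j, 1 + unitSign (twist M l).1 = 2 * j := by
        rcases (twist M l).1
        · exact ⟨0, rfl⟩
        · exact ⟨1, rfl⟩
      obtain ⟨k, hk⟩ : ∃ k, unitSign (twist M l).2 - 1 = 2 * k := by
        rcases (twist M l).2
        · exact ⟨-1, rfl⟩
        · exact ⟨0, rfl⟩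
      have : of none * edgeToB M (of (some (.inl l))) * (of none)⁻¹ =
          of none ^ (2 * j) * edgeToB M (of (some (.inr l))) * of none ^ (2 * k) := by
        rw [edgeToB_inl, edgeToB_inr, ← hj, ← hk, zpow_add, zpow_sub]
        group
      rw [this]
      exact mul_mem (mul_mem (even_zpow_mem_range M j) ⟨_, rfl⟩) (even_zpow_mem_range M k)
    · obtain ⟨j, hj⟩ : ∃ j, 1 - unitSign (twist M l).1 = 2 * j := by
        rcases (twist M l).1
        · exact ⟨1, rfl⟩
        · exact ⟨0, rfl⟩
      obtain ⟨k, hk⟩ : ∃ k, -unitSign (twist M l).2 - 1 = 2 * k := by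
        rcases (twist M l).2
        · exact ⟨0, rfl⟩
        · exact ⟨-1, rfl⟩
      have : of none * edgeToB M (of (some (.inr l))) * (of none)⁻¹ =
          of none ^ (2 * j) * edgeToB M (of (some (.inl l))) * of none ^ (2 * k) := by
        rw [edgeToB_inl, edgeToB_inr, ← hj, ← hk, zpow_sub, zpow_sub]
        group
      rw [this]
      exact mul_mem (mul_mem (even_zpow_mem_range M j) ⟨_, rfl⟩) (even_zpow_mem_range M k)
  | inv_of i ih =>
    rw [map_inv]
    have := inv_mem ih
    simpa [mul_assoc] using this
  | mul x y hx hy =>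
    rw [map_mul]
    have := mul_mem hx hy
    simpa [mul_assoc] using this

theorem mem_or_mul_mem_edgeToB_range (f : FreeGroup (Option (Fin 3))) :
    f ∈ (edgeToB M).range ∨ of none * f ∈ (edgeToB M).range := by
  have hsq : (of none : FreeGroup (Option (Fin 3))) * of none ∈ (edgeToB M).range :=
    ⟨of none, by rw [edgeToB_none, pow_two]⟩
  induction f using FreeGroup.induction_on with
  | C1 => exact .inl (one_mem _)
  | of i =>
    rcases i with _ | l
    · exact .inr hsq
    · exact .inl ⟨_, edgeToB_inr M l⟩
  | inv_of i ih =>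
    rcases i with _ | l
    · right; simp
    · exact .inl (inv_mem ⟨_, edgeToB_inr M l⟩)
  | mul x y hx hy =>
    rcases hx with hx | hx <;> rcases hy with hy | hy
    · exact .inl (mul_mem hx hy)
    · right
      have := mul_mem (conj_mem_edgeToB_range M hx) hy
      simpa [mul_assoc] using this
    · right
      simpa [mul_assoc] using mul_mem hx hy
    · left
      have h1 := mul_mem (conj_mem_edgeToB_range M hx) hy
      have h2 := mul_mem (inv_mem hsq) h1
      simpa [mul_assoc] using h2

theorem edgeToB_index : (edgeToB M).range.index = 2 := by
  rw [Subgroup.index_eq_two_iff]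
  refine ⟨of none, fun f => ?_⟩
  have hsq : (of none : FreeGroup (Option (Fin 3))) * of none ∈ (edgeToB M).range :=
    ⟨of none, by rw [edgeToB_none, pow_two]⟩
  have key : f * of none ∈ (edgeToB M).range ↔ of none * f ∈ (edgeToB M).range := by
    constructor <;> intro h
    · have := mul_mem (conj_mem_edgeToB_range M h) (one_mem _)
      simpa [mul_assoc] using this
    · have := mul_mem (mul_mem (inv_mem hsq) (conj_mem_edgeToB_range M h)) hsq
      simpa [mul_assoc] using this
  rw [key]
  rcases mem_or_mul_mem_edgeToB_range M f with h | h
  · refine .inr ⟨h, fun h' => not_mem_edgeToB_range M ?_⟩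
    simpa using mul_mem h' (inv_mem h)
  · refine .inl ⟨h, fun h' => not_mem_edgeToB_range M ?_⟩
    simpa using mul_mem h (inv_mem h')

/-! ### The relations of the triangle Artin group -/

section Relations

variable {M} {Q : Type*} [Group Q]

theorem altProd_two_mul (s u : Q) (m : ℕ) : altProd s u (2 * m) = (s * u) ^ m := by
  induction m with
  | zero => simp [altProd]
  | succ m ih => rw [mul_add, mul_one, altProd, altProd, ih, pow_succ', mul_assoc]

theorem altProd_two_mul_add_one (s u : Q) (m : ℕ) :
    altProd s u (2 * m + 1) = (s * u) ^ m * s := by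
  induction m with
  | zero => simp [altProd]
  | succ m ih =>
    rw [show 2 * (m + 1) + 1 = (2 * m + 1) + 1 + 1 by ring, altProd, altProd, ih, pow_succ']
    simp only [mul_assoc]

theorem map_altProd {Q' : Type*} [Group Q'] (φ : Q →* Q') (s u : Q) (n : ℕ) :
    φ (altProd s u n) = altProd (φ s) (φ u) n := by
  induction n generalizing s u with
  | zero => simp [altProd]
  | succ n ih => simp [altProd, ih]

theorem mul_pow_comm' (s u : Q) (m : ℕ) : s * (u * s) ^ m = (s * u) ^ m * s :=
  ((SemiconjBy.pow_right (a := s) (x := u * s) (y := s * u) (by simp [SemiconjBy, mul_assoc]) m))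

/-- For an even exponent, the dihedral relation says that `(s u) ^ m` commutes with `s`. -/
theorem altProd_even_iff {s u : Q} {n : ℕ} (hn : Even n) :
    altProd s u n = altProd u s n ↔ s * (s * u) ^ (n / 2) = (s * u) ^ (n / 2) * s := by
  obtain ⟨m, rfl⟩ := even_iff_two_dvd.1 hn
  rw [altProd_two_mul, altProd_two_mul, Nat.mul_div_cancel_left _ two_pos, ← mul_pow_comm' s u,
    mul_right_inj]

/-- For an odd exponent, the dihedral relation says that `(s u) ^ m` conjugates `s` to `u`. -/
theorem altProd_odd_iff {s u : Q} {n : ℕ} (hn : ¬ Even n) :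
    altProd s u n = altProd u s n ↔ (s * u) ^ (n / 2) * s = u * (s * u) ^ (n / 2) := by
  obtain ⟨m, rfl⟩ := Nat.not_even_iff_odd.1 hn
  rw [altProd_two_mul_add_one, altProd_two_mul_add_one, ← mul_pow_comm' u s,
    show (2 * m + 1) / 2 = m by omega]

/-- The relations of the triangle Artin group. -/
def ArtinRel (M : Fin 3 → ℕ) (g : Fin 3 → Q) : Prop :=
  ∀ l, altProd (g l) (g (l + 1)) (M l) = altProd (g (l + 1)) (g l) (M l)

/-- The relations that glue the two vertex groups along the edge group. -/
def GluingRel (M : Fin 3 → ℕ) (x : Fin 3 → Q) (t : Q) : Prop :=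
  ∀ l, FreeGroup.lift x (edgeToA M (of (some (.inl l)))) =
    t ^ unitSign (twist M l).1 * FreeGroup.lift x (edgeToA M (of (some (.inr l)))) *
      t ^ unitSign (twist M l).2

set_option linter.unusedSimpArgs false in
/-- In terms of the letters and of `abc`, the Artin relations say that the free generators of the
edge group have the same images under both of its inclusions. -/
theorem artinRel_iff_gluingRel (g : Fin 3 → Q) :
    ArtinRel M g ↔ GluingRel M (fun l => g l * g (l + 1)) (g 0 * g 1 * g 2) := by
  refine forall_congr' fun l => ?_
  have inj : ∀ (u v : Q) {p q : Q}, p = q ↔ u * p * v = u * q * v := fun u v p q => by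
    rw [mul_left_inj, mul_right_inj]
  match l with
  | 0 =>
    by_cases he : Even (M 0)
    · have ht : twist M 0 = (true, false) := by simp [twist, he]
      rw [altProd_even_iff he, edgeToA_inl, edgeToA_inr, ht]
      simp only [he, if_true, if_false, typeRep, unitSign, map_mul, map_inv, map_pow,
        FreeGroup.lift_apply_of, map_one, Bool.false_eq_true, zpow_one, zpow_neg,
        show ((0 : Fin 3) - 1) = 2 from rfl, show ((0 : Fin 3) + 1) = 1 from rfl,
        show ((1 : Fin 3) - 1) = 0 from rfl, show ((1 : Fin 3) + 1) = 2 from rfl,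
        show ((2 : Fin 3) - 1) = 1 from rfl, show ((2 : Fin 3) + 1) = 0 from rfl,
        Matrix.cons_val_zero, Matrix.cons_val_one, Matrix.cons_val]
      generalize hK : (g 0 * g 1) ^ (M 0 / 2) = K
      refine eq_comm.trans (Iff.trans ?_ (inj (1) (g 0)).symm)
      exact iff_of_eq (congrArg₂ Eq (by group) (by group))
    · have ht : twist M 0 = (true, true) := by simp [twist, he]
      rw [altProd_odd_iff he, edgeToA_inl, edgeToA_inr, ht]
      simp only [he, if_true, if_false, typeRep, unitSign, map_mul, map_inv, map_pow,
        FreeGroup.lift_apply_of, map_one, Bool.false_eq_true, zpow_one, zpow_neg,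
        show ((0 : Fin 3) - 1) = 2 from rfl, show ((0 : Fin 3) + 1) = 1 from rfl,
        show ((1 : Fin 3) - 1) = 0 from rfl, show ((1 : Fin 3) + 1) = 2 from rfl,
        show ((2 : Fin 3) - 1) = 1 from rfl, show ((2 : Fin 3) + 1) = 0 from rfl,
        Matrix.cons_val_zero, Matrix.cons_val_one, Matrix.cons_val]
      generalize hK : (g 0 * g 1) ^ (M 0 / 2) = K
      refine eq_comm.trans (Iff.trans ?_ (inj (g 0)⁻¹ (g 1 * g 2)⁻¹).symm)
      exact iff_of_eq (congrArg₂ Eq (by group) (by group))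
  | 1 =>
    by_cases he : Even (M 1)
    · have ht : twist M 1 = (false, true) := by simp [twist, he]
      rw [altProd_even_iff he, edgeToA_inl, edgeToA_inr, ht]
      simp only [he, if_true, if_false, typeRep, unitSign, map_mul, map_inv, map_pow,
        FreeGroup.lift_apply_of, map_one, Bool.false_eq_true, zpow_one, zpow_neg,
        show ((0 : Fin 3) - 1) = 2 from rfl, show ((0 : Fin 3) + 1) = 1 from rfl,
        show ((1 : Fin 3) - 1) = 0 from rfl, show ((1 : Fin 3) + 1) = 2 from rfl,
        show ((2 : Fin 3) - 1) = 1 from rfl, show ((2 : Fin 3) + 1) = 0 from rfl,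
        Matrix.cons_val_zero, Matrix.cons_val_one, Matrix.cons_val]
      generalize hK : (g 1 * g 2) ^ (M 1 / 2) = K
      refine eq_comm.trans (Iff.trans ?_ (inj (g 1 * g 2) (g 2)⁻¹).symm)
      exact iff_of_eq (congrArg₂ Eq (by group) (by group))
    · have ht : twist M 1 = (false, false) := by simp [twist, he]
      rw [altProd_odd_iff he, edgeToA_inl, edgeToA_inr, ht]
      simp only [he, if_true, if_false, typeRep, unitSign, map_mul, map_inv, map_pow,
        FreeGroup.lift_apply_of, map_one, Bool.false_eq_true, zpow_one, zpow_neg,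
        show ((0 : Fin 3) - 1) = 2 from rfl, show ((0 : Fin 3) + 1) = 1 from rfl,
        show ((1 : Fin 3) - 1) = 0 from rfl, show ((1 : Fin 3) + 1) = 2 from rfl,
        show ((2 : Fin 3) - 1) = 1 from rfl, show ((2 : Fin 3) + 1) = 0 from rfl,
        Matrix.cons_val_zero, Matrix.cons_val_one, Matrix.cons_val]
      generalize hK : (g 1 * g 2) ^ (M 1 / 2) = K
      refine eq_comm.trans (Iff.trans ?_ (inj (g 2) (g 0 * g 1)).symm)
      exact iff_of_eq (congrArg₂ Eq (by group) (by group))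
  | 2 =>
    by_cases he : Even (M 2)
    · have ht : twist M 2 = (true, false) := by simp [twist, he]
      rw [altProd_even_iff he, edgeToA_inl, edgeToA_inr, ht]
      simp only [he, if_true, if_false, typeRep, unitSign, map_mul, map_inv, map_pow,
        FreeGroup.lift_apply_of, map_one, Bool.false_eq_true, zpow_one, zpow_neg,
        show ((0 : Fin 3) - 1) = 2 from rfl, show ((0 : Fin 3) + 1) = 1 from rfl,
        show ((1 : Fin 3) - 1) = 0 from rfl, show ((1 : Fin 3) + 1) = 2 from rfl,
        show ((2 : Fin 3) - 1) = 1 from rfl, show ((2 : Fin 3) + 1) = 0 from rfl,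
        Matrix.cons_val_zero, Matrix.cons_val_one, Matrix.cons_val]
      generalize hK : (g 2 * g 0) ^ (M 2 / 2) = K
      refine eq_comm.trans (Iff.trans ?_ (inj (g 0 * g 1)⁻¹ (g 0 * g 1 * g 2)).symm)
      exact iff_of_eq (congrArg₂ Eq (by group) (by group))
    · have ht : twist M 2 = (false, true) := by simp [twist, he]
      rw [altProd_odd_iff he, edgeToA_inl, edgeToA_inr, ht]
      simp only [he, if_true, if_false, typeRep, unitSign, map_mul, map_inv, map_pow,
        FreeGroup.lift_apply_of, map_one, Bool.false_eq_true, zpow_one, zpow_neg,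
        show ((0 : Fin 3) - 1) = 2 from rfl, show ((0 : Fin 3) + 1) = 1 from rfl,
        show ((1 : Fin 3) - 1) = 0 from rfl, show ((1 : Fin 3) + 1) = 2 from rfl,
        show ((2 : Fin 3) - 1) = 1 from rfl, show ((2 : Fin 3) + 1) = 0 from rfl,
        Matrix.cons_val_zero, Matrix.cons_val_one, Matrix.cons_val]
      generalize hK : (g 2 * g 0) ^ (M 2 / 2) = K
      refine eq_comm.trans (Iff.trans ?_ (inj (g 0 * g 1 * g 2) 1).symm)
      exact iff_of_eq (congrArg₂ Eq (by group) (by group))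

end Relations

end TriangleWord

namespace TriangleWord

open FreeGroup (of First first_zpow_mul first_zpow not_first_one exists_first norm)

/-! ### The abstract amalgamated product -/

/-- The free generators of the two vertex groups, `A` (`true`) and `B` (`false`). -/
abbrev VertexIndex (i : Bool) : Type := cond i (Fin 3) (Option (Fin 3))

/-- The two inclusions of the edge group. -/
def edgeTo (M : Fin 3 → ℕ) : ∀ i : Bool, FreeGroup EdgeIndex →* FreeGroup (VertexIndex i)
  | true => edgeToA M
  | false => edgeToB M

theorem edgeTo_injective {M : Fin 3 → ℕ} (hM : ∀ l, 3 ≤ M l) (i : Bool) :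
    Function.Injective (edgeTo M i) := by
  cases i
  · exact edgeToB_injective M
  · exact edgeToA_injective hM

/-- The abstract amalgamated product of free groups. -/
abbrev Amalgam (M : Fin 3 → ℕ) : Type := Monoid.PushoutI (edgeTo M)

section Maps

variable {M : Fin 3 → ℕ} {Q : Type*} [Group Q]

/-- The homomorphism from the free group on the three letters `g l * g (l + 1)`. -/
def letterHom (g : Fin 3 → Q) : FreeGroup (Fin 3) →* Q :=
  FreeGroup.lift fun l => g l * g (l + 1)

/-- The homomorphism from the free group that maps onto the vertex group `B`. -/
def loopHom (M : Fin 3 → ℕ) (g : Fin 3 → Q) : FreeGroup (Option (Fin 3)) →* Q :=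
  FreeGroup.lift fun
    | none => g 0 * g 1 * g 2
    | some l => letterHom g (edgeToA M (of (some (.inr l))))

theorem loopHom_edgeToB {g : Fin 3 → Q} (hg : ArtinRel M g) (c : FreeGroup EdgeIndex) :
    loopHom M g (edgeToB M c) = letterHom g (edgeToA M c) := by
  suffices (loopHom M g).comp (edgeToB M) = (letterHom g).comp (edgeToA M) from
    DFunLike.congr_fun this c
  ext i
  rcases i with _ | l | l
  · simp [edgeToB_none, edgeToA_none, loopHom, letterHom, pow_two, mul_assoc]
  · have h := (artinRel_iff_gluingRel g).1 hg l
    simp only [MonoidHom.comp_apply, edgeToB_inl, map_mul, map_zpow]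
    change _ = FreeGroup.lift _ _
    rw [h]
    simp [loopHom, letterHom]
  · simp [edgeToB_inr, loopHom]

/-- The homomorphism from the abstract amalgamated product given by a solution of the Artin
relations. -/
def amalgamHom {g : Fin 3 → Q} (hg : ArtinRel M g) : Amalgam M →* Q :=
  Monoid.PushoutI.lift
    (fun | true => letterHom g | false => loopHom M g) ((letterHom g).comp (edgeToA M)) (by
      rintro (_ | _)
      · ext c : 1; exact loopHom_edgeToB hg (FreeGroup.of c)
      · rfl)

theorem amalgamHom_true {g : Fin 3 → Q} (hg : ArtinRel M g) (f : FreeGroup (Fin 3)) :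
    amalgamHom hg (Monoid.PushoutI.of true f) = letterHom g f := by
  simp [amalgamHom]

theorem amalgamHom_false {g : Fin 3 → Q} (hg : ArtinRel M g) (f : FreeGroup (Option (Fin 3))) :
    amalgamHom hg (Monoid.PushoutI.of false f) = loopHom M g f := by
  simp [amalgamHom]

/-- From letters `x l` and an element `t` with `t ^ 2 = x 0 * x 2 * x 1` one recovers the
generators. -/
def recover (x : Fin 3 → Q) (t : Q) : Fin 3 → Q :=
  ![t * (x 1)⁻¹, x 1 * t⁻¹ * x 0, (x 0)⁻¹ * t]

theorem recover_letter {x : Fin 3 → Q} {t : Q} (h : t ^ 2 = x 0 * x 2 * x 1) (l : Fin 3) :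
    recover x t l * recover x t (l + 1) = x l := by
  have h2 : x 2 = (x 0)⁻¹ * (t * t) * (x 1)⁻¹ := by rw [← pow_two, h]; group
  match l with
  | 0 => change t * (x 1)⁻¹ * (x 1 * t⁻¹ * x 0) = x 0; group
  | 1 => change x 1 * t⁻¹ * x 0 * ((x 0)⁻¹ * t) = x 1; group
  | 2 => change (x 0)⁻¹ * t * (t * (x 1)⁻¹) = x 2; rw [h2]; group

theorem recover_prod (x : Fin 3 → Q) (t : Q) :
    recover x t 0 * recover x t 1 * recover x t 2 = t := by
  change t * (x 1)⁻¹ * (x 1 * t⁻¹ * x 0) * ((x 0)⁻¹ * t) = t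
  group

theorem recover_eq (g : Fin 3 → Q) :
    recover (fun l => g l * g (l + 1)) (g 0 * g 1 * g 2) = g := by
  funext l
  match l with
  | 0 => change g 0 * g 1 * g 2 * (g 1 * g 2)⁻¹ = g 0; group
  | 1 => change g 1 * g 2 * (g 0 * g 1 * g 2)⁻¹ * (g 0 * g 1) = g 1; group
  | 2 => change (g 0 * g 1)⁻¹ * (g 0 * g 1 * g 2) = g 2; group

theorem artinRel_recover {x : Fin 3 → Q} {t : Q} (h : t ^ 2 = x 0 * x 2 * x 1)
    (hg : GluingRel M x t) : ArtinRel M (recover x t) := by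
  rw [artinRel_iff_gluingRel, recover_prod]
  convert hg using 2
  exact recover_letter h _

end Maps

/-! ### The triangle Artin group as an amalgamated product -/

section Group

/-- The labels of the three pairs of consecutive generators. -/
def labels (M N P : ℕ) : Fin 3 → ℕ := ![M, N, P]

variable {M N P : ℕ}

/-- The standard generators of the triangle Artin group. -/
def gen (M N P : ℕ) : Fin 3 → TriangleArtin M N P := fun l => PresentedGroup.of l

theorem artinRel_gen : ArtinRel (labels M N P) (gen M N P) := by
  have key : ∀ (i j : Fin 3) (n : ℕ), altProd (of i) (of j) n * (altProd (of j) (of i) n)⁻¹ ∈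
      triangleArtinRels M N P → altProd (gen M N P i) (gen M N P j) n =
        altProd (gen M N P j) (gen M N P i) n := by
    intro i j n h
    have := PresentedGroup.one_of_mem h
    rw [map_mul, map_inv, map_altProd, map_altProd, mul_inv_eq_one] at this
    exact this
  intro l
  match l with
  | 0 => exact key 0 1 M (by simp [triangleArtinRels])
  | 1 => exact key 1 2 N (by simp [triangleArtinRels])
  | 2 => exact key 2 0 P (by simp [triangleArtinRels])

/-- The universal property of the triangle Artin group. -/
def ofArtinRel {Q : Type*} [Group Q] {g : Fin 3 → Q} (hg : ArtinRel (labels M N P) g) :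
    TriangleArtin M N P →* Q :=
  PresentedGroup.toGroup (f := g) (by
    intro r hr
    simp only [triangleArtinRels, Set.mem_insert_iff, Set.mem_singleton_iff] at hr
    rcases hr with rfl | rfl | rfl <;>
      simp only [map_mul, map_inv, map_altProd, FreeGroup.lift_apply_of, mul_inv_eq_one]
    · exact hg 0
    · exact hg 1
    · exact hg 2)

theorem ofArtinRel_gen {Q : Type*} [Group Q] {g : Fin 3 → Q} (hg : ArtinRel (labels M N P) g)
    (l : Fin 3) : ofArtinRel hg (gen M N P l) = g l :=
  PresentedGroup.toGroup.of _

theorem hom_ext_gen {Q : Type*} [Group Q] {φ ψ : TriangleArtin M N P →* Q}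
    (h : ∀ l, φ (gen M N P l) = ψ (gen M N P l)) : φ = ψ :=
  PresentedGroup.ext h

theorem map_recover {Q Q' : Type*} [Group Q] [Group Q'] (φ : Q →* Q') (x : Fin 3 → Q) (t : Q)
    (l : Fin 3) : φ (recover x t l) = recover (fun l => φ (x l)) (φ t) l := by
  match l with
  | 0 => simp [recover]
  | 1 => simp [recover]
  | 2 => simp [recover]

theorem map_letterHom {Q Q' : Type*} [Group Q] [Group Q'] (φ : Q →* Q') (g : Fin 3 → Q)
    (f : FreeGroup (Fin 3)) : φ (letterHom g f) = letterHom (fun l => φ (g l)) f := by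
  suffices φ.comp (letterHom g) = letterHom (fun l => φ (g l)) from DFunLike.congr_fun this f
  ext l
  simp [letterHom]

/-- The generators of the triangle Artin group inside the abstract amalgamated product. -/
def amalgamGen (m : Fin 3 → ℕ) : Fin 3 → Amalgam m :=
  recover (fun l => Monoid.PushoutI.of (φ := edgeTo m) true (of l))
    (Monoid.PushoutI.of (φ := edgeTo m) false (of (none : Option (Fin 3))))

theorem amalgam_sq (m : Fin 3 → ℕ) :
    (Monoid.PushoutI.of (φ := edgeTo m) false (of (none : Option (Fin 3)))) ^ 2 =
    Monoid.PushoutI.of (φ := edgeTo m) true (of (0 : Fin 3)) *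
      Monoid.PushoutI.of (φ := edgeTo m) true (of (2 : Fin 3)) *
      Monoid.PushoutI.of (φ := edgeTo m) true (of (1 : Fin 3)) := by
  have h1 := Monoid.PushoutI.of_apply_eq_base (edgeTo m) true (of none)
  have h2 := Monoid.PushoutI.of_apply_eq_base (edgeTo m) false (of none)
  rw [← map_pow, ← map_mul, ← map_mul]
  refine Eq.trans (congrArg _ (edgeToB_none m).symm) (h2.trans (h1.symm.trans ?_))
  exact congrArg _ (edgeToA_none)

theorem lift_amalgam (m : Fin 3 → ℕ) (f : FreeGroup (Fin 3)) :
    FreeGroup.lift (fun l => Monoid.PushoutI.of (φ := edgeTo m) true (of (l : Fin 3))) f =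
      Monoid.PushoutI.of (φ := edgeTo m) true f := by
  suffices FreeGroup.lift (fun l => Monoid.PushoutI.of (φ := edgeTo m) true (of (l : Fin 3))) =
    Monoid.PushoutI.of (φ := edgeTo m) true from DFunLike.congr_fun this f
  refine FreeGroup.ext_hom _ _ (fun l => ?_)
  simp

theorem artinRel_amalgamGen (m : Fin 3 → ℕ) : ArtinRel m (amalgamGen m) := by
  refine artinRel_recover (amalgam_sq m) fun l => ?_
  have h1 := fun c => Monoid.PushoutI.of_apply_eq_base (edgeTo m) true c
  have h2 := fun c => Monoid.PushoutI.of_apply_eq_base (edgeTo m) false c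
  rw [lift_amalgam, lift_amalgam]
  refine (h1 _).trans ((h2 _).symm.trans ?_)
  have h3 : Monoid.PushoutI.of (φ := edgeTo m) true (edgeToA m (of (some (.inr l)))) =
      Monoid.PushoutI.of (φ := edgeTo m) false (of (some l)) :=
    (h1 _).trans ((h2 _).symm.trans (congrArg _ (edgeToB_inr m l)))
  refine (congrArg _ (edgeToB_inl m l)).trans ?_
  rw [h3, ← map_zpow, ← map_zpow, ← map_mul, ← map_mul]

theorem amalgamHom_amalgamGen {Q : Type*} [Group Q] {m : Fin 3 → ℕ} {g : Fin 3 → Q}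
    (hg : ArtinRel m g) (l : Fin 3) : amalgamHom hg (amalgamGen m l) = g l := by
  rw [amalgamGen, map_recover]
  simp only [amalgamHom_true, amalgamHom_false]
  simp only [letterHom, loopHom, FreeGroup.lift_apply_of]
  rw [recover_eq]

/-- The homomorphism from the triangle Artin group to the abstract amalgamated product, of which
`amalgamHom` is the inverse. -/
noncomputable def toAmalgam : TriangleArtin M N P →* Amalgam (labels M N P) :=
  ofArtinRel (artinRel_amalgamGen _)

theorem amalgamHom_toAmalgam (g : TriangleArtin M N P) :
    amalgamHom artinRel_gen (toAmalgam g) = g := by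
  suffices (amalgamHom artinRel_gen).comp toAmalgam = MonoidHom.id (TriangleArtin M N P) from
    DFunLike.congr_fun this g
  refine hom_ext_gen fun l => ?_
  simp [toAmalgam, ofArtinRel_gen, amalgamHom_amalgamGen]

theorem toAmalgam_letterHom (f : FreeGroup (Fin 3)) :
    toAmalgam (letterHom (gen M N P) f) = Monoid.PushoutI.of true f := by
  rw [map_letterHom]
  have : (fun l => toAmalgam (gen M N P l)) = amalgamGen (labels M N P) :=
    funext fun l => ofArtinRel_gen _ l
  rw [this, ← lift_amalgam]
  unfold letterHom
  congr 2
  funext l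
  exact recover_letter (amalgam_sq _) l

theorem toAmalgam_loopHom (f : FreeGroup (Option (Fin 3))) :
    toAmalgam (loopHom (labels M N P) (gen M N P) f) = Monoid.PushoutI.of false f := by
  suffices toAmalgam.comp (loopHom (labels M N P) (gen M N P)) =
    Monoid.PushoutI.of (φ := edgeTo (labels M N P)) false from DFunLike.congr_fun this f
  refine FreeGroup.ext_hom _ _ fun i => ?_
  rcases i with _ | l
  · have h : (fun l => toAmalgam (gen M N P l)) = amalgamGen (labels M N P) :=
      funext fun l => ofArtinRel_gen _ l
    simp only [MonoidHom.comp_apply, loopHom, FreeGroup.lift_apply_of, map_mul]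
    have h' := congrFun h
    rw [h', h', h']
    exact recover_prod _ _
  · simp only [MonoidHom.comp_apply, loopHom, FreeGroup.lift_apply_of]
    rw [toAmalgam_letterHom]
    refine (Monoid.PushoutI.of_apply_eq_base (edgeTo _) true _).trans
      ((Monoid.PushoutI.of_apply_eq_base (edgeTo _) false _).symm.trans ?_)
    exact congrArg _ (edgeToB_inr _ l)

theorem labels_ge (hM : 3 ≤ M) (hN : 3 ≤ N) (hP : 3 ≤ P) (l : Fin 3) : 3 ≤ labels M N P l := by
  match l with
  | 0 => exact hM
  | 1 => exact hN
  | 2 => exact hP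

theorem letterHom_injective (h : ∀ l, 3 ≤ labels M N P l) :
    Function.Injective (letterHom (gen M N P)) := by
  have := Monoid.PushoutI.of_injective (edgeTo_injective h) true
  intro f f' hf
  apply this
  rw [← toAmalgam_letterHom, ← toAmalgam_letterHom, hf]

theorem loopHom_injective (h : ∀ l, 3 ≤ labels M N P l) :
    Function.Injective (loopHom (labels M N P) (gen M N P)) := by
  have := Monoid.PushoutI.of_injective (edgeTo_injective h) false
  intro f f' hf
  apply this
  rw [← toAmalgam_loopHom, ← toAmalgam_loopHom, hf]

theorem toAmalgam_injective : Function.Injective (toAmalgam (M := M) (N := N) (P := P)) :=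
  Function.LeftInverse.injective amalgamHom_toAmalgam

theorem letterHom_range : (letterHom (gen M N P)).range = TriangleArtin.vertexA M N P := by
  rw [letterHom, FreeGroup.range_lift_eq_closure, TriangleArtin.vertexA]
  congr 1
  ext g
  simp only [Set.mem_range, Set.mem_insert_iff, Set.mem_singleton_iff]
  constructor
  · rintro ⟨l, rfl⟩
    match l with
    | 0 => exact .inl rfl
    | 1 => exact .inr (.inl rfl)
    | 2 => exact .inr (.inr rfl)
  · rintro (rfl | rfl | rfl)
    · exact ⟨0, rfl⟩
    · exact ⟨1, rfl⟩
    · exact ⟨2, rfl⟩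

end Group

/-! ### The splitting -/

section Splitting

variable {M N P : ℕ}

/-- Up to powers of `abc` on both sides, the generators of the vertex group `B` are the images of
free generators. -/
theorem loopGen_zero {Q : Type*} [Group Q] (m : Fin 3 → ℕ) (g : Fin 3 → Q) : ∃ i j : ℤ,
    g 0 * altProd (g 0) (g 1) (m 0) * (g 0)⁻¹ = (g 0 * g 1 * g 2) ^ i *
      letterHom g (edgeToA m (of (some (.inr 0)))) * (g 0 * g 1 * g 2) ^ j := by
  by_cases he : Even (m 0)
  · refine ⟨1, -1, ?_⟩
    have h := altProd_two_mul (g 0) (g 1) (m 0 / 2)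
    rw [Nat.mul_div_cancel' (even_iff_two_dvd.1 he)] at h
    rw [h, edgeToA_inr]
    simp only [he, if_true, typeRep, letterHom, map_mul, map_inv, map_pow,
      FreeGroup.lift_apply_of, Matrix.cons_val_zero]
    change _ = _ * ((g 1 * g 2)⁻¹ * (g 0 * g 1) ^ (m 0 / 2) * (g 1 * g 2)) * _
    generalize (g 0 * g 1) ^ (m 0 / 2) = K
    group
  · refine ⟨1, 0, ?_⟩
    have h := altProd_two_mul_add_one (g 0) (g 1) (m 0 / 2)
    rw [show 2 * (m 0 / 2) + 1 = m 0 by have := Nat.not_even_iff.1 he; omega] at h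
    rw [h, edgeToA_inr]
    simp only [he, if_false, typeRep, letterHom, map_mul, map_inv, map_pow,
      FreeGroup.lift_apply_of, Matrix.cons_val_zero]
    change _ = _ * ((g 1 * g 2)⁻¹ * (g 0 * g 1) ^ (m 0 / 2) * (FreeGroup.lift _ 1)) * _
    generalize (g 0 * g 1) ^ (m 0 / 2) = K
    rw [map_one]
    group

theorem loopGen_one {Q : Type*} [Group Q] (m : Fin 3 → ℕ) (g : Fin 3 → Q) : ∃ i j : ℤ,
    g 0 * g 1 * altProd (g 1) (g 2) (m 1) * (g 1)⁻¹ * (g 0)⁻¹ = (g 0 * g 1 * g 2) ^ i *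
      letterHom g (edgeToA m (of (some (.inr 1)))) * (g 0 * g 1 * g 2) ^ j := by
  by_cases he : Even (m 1)
  · refine ⟨0, 0, ?_⟩
    have h := altProd_two_mul (g 1) (g 2) (m 1 / 2)
    rw [Nat.mul_div_cancel' (even_iff_two_dvd.1 he)] at h
    rw [h, edgeToA_inr]
    simp only [he, if_true, typeRep, letterHom, map_mul, map_inv, map_pow,
      FreeGroup.lift_apply_of, Matrix.cons_val_one, Matrix.cons_val_zero]
    change _ = _ * ((g 0 * g 1)⁻¹⁻¹ * (g 1 * g 2) ^ (m 1 / 2) * (g 0 * g 1)⁻¹) * _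
    generalize (g 1 * g 2) ^ (m 1 / 2) = K
    group
  · refine ⟨0, -1, ?_⟩
    have h := altProd_two_mul_add_one (g 1) (g 2) (m 1 / 2)
    rw [show 2 * (m 1 / 2) + 1 = m 1 by have := Nat.not_even_iff.1 he; omega] at h
    rw [h, edgeToA_inr]
    simp only [he, if_false, typeRep, letterHom, map_mul, map_inv, map_pow,
      FreeGroup.lift_apply_of, Matrix.cons_val_one, Matrix.cons_val_zero]
    change _ = _ * ((g 0 * g 1)⁻¹⁻¹ * (g 1 * g 2) ^ (m 1 / 2) *
      FreeGroup.lift (fun l => g l * g (l + 1)) (of 1)) * _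
    rw [FreeGroup.lift_apply_of]
    change _ = _ * ((g 0 * g 1)⁻¹⁻¹ * (g 1 * g 2) ^ (m 1 / 2) * (g 1 * g 2)) * _
    generalize (g 1 * g 2) ^ (m 1 / 2) = K
    group

theorem loopGen_two {Q : Type*} [Group Q] (m : Fin 3 → ℕ) (g : Fin 3 → Q) : ∃ i j : ℤ,
    altProd (g 2) (g 0) (m 2) = (g 0 * g 1 * g 2) ^ i *
      letterHom g (edgeToA m (of (some (.inr 2)))) * (g 0 * g 1 * g 2) ^ j := by
  by_cases he : Even (m 2)
  · refine ⟨0, 0, ?_⟩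
    have h := altProd_two_mul (g 2) (g 0) (m 2 / 2)
    rw [Nat.mul_div_cancel' (even_iff_two_dvd.1 he)] at h
    rw [h, edgeToA_inr]
    simp only [he, if_true, typeRep, letterHom, map_mul, map_inv, map_pow,
      FreeGroup.lift_apply_of]
    change _ = _ * ((FreeGroup.lift _ 1)⁻¹ * (g 2 * g 0) ^ (m 2 / 2) * (FreeGroup.lift _ 1)) * _
    generalize (g 2 * g 0) ^ (m 2 / 2) = K
    rw [map_one]
    group
  · refine ⟨0, 1, ?_⟩
    have h := altProd_two_mul_add_one (g 2) (g 0) (m 2 / 2)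
    rw [show 2 * (m 2 / 2) + 1 = m 2 by have := Nat.not_even_iff.1 he; omega] at h
    rw [h, edgeToA_inr]
    simp only [he, if_false, typeRep, letterHom, map_mul, map_inv, map_pow,
      FreeGroup.lift_apply_of]
    change _ = _ * ((FreeGroup.lift (fun l => g l * g (l + 1)) 1)⁻¹ * (g 2 * g 0) ^ (m 2 / 2) *
      FreeGroup.lift (fun l => g l * g (l + 1)) (of 0)⁻¹) * _
    rw [map_inv, FreeGroup.lift_apply_of]
    change _ = _ * ((FreeGroup.lift (fun l => g l * g (l + 1)) 1)⁻¹ * (g 2 * g 0) ^ (m 2 / 2) *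
      (g 0 * g 1)⁻¹) * _
    generalize (g 2 * g 0) ^ (m 2 / 2) = K
    rw [map_one]
    group

theorem loopHom_range :
    (loopHom (labels M N P) (gen M N P)).range = TriangleArtin.vertexB M N P := by
  obtain ⟨i0, j0, h0⟩ := loopGen_zero (labels M N P) (gen M N P)
  obtain ⟨i1, j1, h1⟩ := loopGen_one (labels M N P) (gen M N P)
  obtain ⟨i2, j2, h2⟩ := loopGen_two (labels M N P) (gen M N P)
  have hsolve : ∀ {t f γ : TriangleArtin M N P} {i j : ℤ}, f = t ^ i * γ * t ^ j →
      γ = t ^ (-i) * f * t ^ (-j) := by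
    intro t f γ i j h
    rw [h]; group
  have hw : ∀ l, loopHom (labels M N P) (gen M N P) (of (some l)) =
      letterHom (gen M N P) (edgeToA (labels M N P) (of (some (.inr l)))) := by
    intro l; simp [loopHom]
  have ht : loopHom (labels M N P) (gen M N P) (of none) = gen M N P 0 * gen M N P 1 * gen M N P 2 := by
    simp [loopHom]
  apply le_antisymm
  · rw [loopHom, FreeGroup.range_lift_eq_closure, Subgroup.closure_le]
    have htm : gen M N P 0 * gen M N P 1 * gen M N P 2 ∈ TriangleArtin.vertexB M N P :=
      Subgroup.subset_closure (.inl rfl)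
    rintro _ ⟨_ | l, rfl⟩
    · exact htm
    · match l with
      | 0 =>
        change letterHom _ _ ∈ _
        rw [hsolve h0]
        exact mul_mem (mul_mem (zpow_mem htm _) (Subgroup.subset_closure (.inr (.inl rfl))))
          (zpow_mem htm _)
      | 1 =>
        change letterHom _ _ ∈ _
        rw [hsolve h1]
        exact mul_mem (mul_mem (zpow_mem htm _) (Subgroup.subset_closure (.inr (.inr (.inl rfl)))))
          (zpow_mem htm _)
      | 2 =>
        change letterHom _ _ ∈ _
        rw [hsolve h2]
        exact mul_mem (mul_mem (zpow_mem htm _) (Subgroup.subset_closure (.inr (.inr (.inr rfl)))))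
          (zpow_mem htm _)
  · rw [TriangleArtin.vertexB, Subgroup.closure_le]
    have htm : gen M N P 0 * gen M N P 1 * gen M N P 2 ∈
      (loopHom (labels M N P) (gen M N P)).range := ⟨of none, ht⟩
    rintro _ (rfl | rfl | rfl | rfl)
    · exact htm
    · refine (congrArg (· ∈ (loopHom (labels M N P) (gen M N P)).range) h0).mpr ?_
      exact mul_mem (mul_mem (zpow_mem htm _) ⟨_, hw 0⟩) (zpow_mem htm _)
    · refine (congrArg (· ∈ (loopHom (labels M N P) (gen M N P)).range) h1).mpr ?_
      exact mul_mem (mul_mem (zpow_mem htm _) ⟨_, hw 1⟩) (zpow_mem htm _)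
    · refine (congrArg (· ∈ (loopHom (labels M N P) (gen M N P)).range) h2).mpr ?_
      exact mul_mem (mul_mem (zpow_mem htm _) ⟨_, hw 2⟩) (zpow_mem htm _)

theorem letterHom_edgeToA_range (h : ∀ l, 3 ≤ labels M N P l) :
    ((letterHom (gen M N P)).comp (edgeToA (labels M N P))).range =
      TriangleArtin.edgeC M N P := by
  rw [TriangleArtin.edgeC, ← letterHom_range, ← loopHom_range]
  ext g
  constructor
  · rintro ⟨c, rfl⟩
    exact ⟨⟨_, rfl⟩, ⟨_, loopHom_edgeToB artinRel_gen c⟩⟩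
  · rintro ⟨⟨f, hf⟩, ⟨f', hf'⟩⟩
    have hmem : toAmalgam g ∈ (Monoid.PushoutI.of (φ := edgeTo (labels M N P)) true).range ⊓
        (Monoid.PushoutI.of (φ := edgeTo (labels M N P)) false).range :=
      ⟨⟨f, by rw [← hf, toAmalgam_letterHom]⟩, ⟨f', by rw [← hf', toAmalgam_loopHom]⟩⟩
    rw [Monoid.PushoutI.inf_of_range_eq_base_range (edgeTo_injective h) (by decide)] at hmem
    obtain ⟨c, hc⟩ := hmem
    refine ⟨c, toAmalgam_injective ?_⟩
    rw [← hc, MonoidHom.comp_apply, toAmalgam_letterHom]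
    exact Monoid.PushoutI.of_apply_eq_base (edgeTo _) true c

theorem exists_freeGroup_vertexA (h : ∀ l, 3 ≤ labels M N P l) :
    Nonempty (FreeGroup (Fin 3) ≃* TriangleArtin.vertexA M N P) := by
  rw [← letterHom_range]
  exact ⟨MonoidHom.ofInjective (letterHom_injective h)⟩

theorem exists_freeGroup_vertexB (h : ∀ l, 3 ≤ labels M N P l) :
    Nonempty (FreeGroup (Fin 4) ≃* TriangleArtin.vertexB M N P) := by
  rw [← loopHom_range]
  have e : Fin 4 ≃ Option (Fin 3) := Fintype.equivOfCardEq (by simp)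
  exact ⟨(FreeGroup.freeGroupCongr e).trans (MonoidHom.ofInjective (loopHom_injective h))⟩

theorem exists_freeGroup_edgeC (h : ∀ l, 3 ≤ labels M N P l) :
    Nonempty (FreeGroup (Fin 7) ≃* TriangleArtin.edgeC M N P) := by
  rw [← letterHom_edgeToA_range h]
  have e : Fin 7 ≃ EdgeIndex := Fintype.equivOfCardEq (by simp)
  refine ⟨(FreeGroup.freeGroupCongr e).trans (MonoidHom.ofInjective
    (f := (letterHom (gen M N P)).comp (edgeToA (labels M N P))) ?_)⟩
  exact (letterHom_injective h).comp (edgeToA_injective h)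

theorem edgeC_relIndex (h : ∀ l, 3 ≤ labels M N P l) :
    (TriangleArtin.edgeC M N P).relIndex (TriangleArtin.vertexB M N P) = 2 := by
  have h1 : TriangleArtin.edgeC M N P =
      (edgeToB (labels M N P)).range.map (loopHom (labels M N P) (gen M N P)) := by
    rw [← letterHom_edgeToA_range h, MonoidHom.map_range]
    congr 1
    ext1 c
    exact (loopHom_edgeToB artinRel_gen (of c)).symm
  have h2 : TriangleArtin.vertexB M N P =
      (⊤ : Subgroup _).map (loopHom (labels M N P) (gen M N P)) := by
    rw [← loopHom_range, MonoidHom.range_eq_map]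
  rw [h1, h2, Subgroup.relIndex_map_map_of_injective _ _ (loopHom_injective h),
    Subgroup.relIndex_top_right, edgeToB_index]

/-- The inverse of the natural homomorphism is given by the universal property of the presentation,
since the images of the generators in the abstract amalgamated product satisfy the Artin
relations. -/
theorem isAmalgamatedProduct :
    IsAmalgamatedProduct (TriangleArtin.vertexA M N P) (TriangleArtin.vertexB M N P)
      (TriangleArtin.edgeC M N P) := by
  have hC : ∀ i : Bool, TriangleArtin.edgeC M N P ≤
      cond i (TriangleArtin.vertexA M N P) (TriangleArtin.vertexB M N P) := by
    rintro (_ | _)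
    · exact inf_le_right
    · exact inf_le_left
  refine ⟨hC, ?_⟩
  -- the generators of the triangle Artin group inside the abstract amalgamated product
  have hA : ∀ f, letterHom (gen M N P) f ∈ TriangleArtin.vertexA M N P := fun f => by
    rw [← letterHom_range]; exact ⟨_, rfl⟩
  have hB : ∀ f, loopHom (labels M N P) (gen M N P) f ∈ TriangleArtin.vertexB M N P := fun f => by
    rw [← loopHom_range]; exact ⟨_, rfl⟩
  let ψ := fun i : Bool => Subgroup.inclusion (hC i)
  let ιA : TriangleArtin.vertexA M N P →* Monoid.PushoutI ψ := Monoid.PushoutI.of (φ := ψ) true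
  let ιB : TriangleArtin.vertexB M N P →* Monoid.PushoutI ψ := Monoid.PushoutI.of (φ := ψ) false
  have hAB : ∀ (g : TriangleArtin M N P) (ha : g ∈ TriangleArtin.vertexA M N P)
      (hb : g ∈ TriangleArtin.vertexB M N P), ιA ⟨g, ha⟩ = ιB ⟨g, hb⟩ := by
    intro g ha hb
    have h1 := Monoid.PushoutI.of_apply_eq_base ψ true ⟨g, ha, hb⟩
    have h2 := Monoid.PushoutI.of_apply_eq_base ψ false ⟨g, ha, hb⟩
    exact h1.trans h2.symm
  let fA : FreeGroup (Fin 3) →* Monoid.PushoutI ψ :=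
    ιA.comp ((letterHom (gen M N P)).codRestrict _ hA)
  let fB : FreeGroup (Option (Fin 3)) →* Monoid.PushoutI ψ :=
    ιB.comp ((loopHom (labels M N P) (gen M N P)).codRestrict _ hB)
  have hfAB : ∀ c, fA (edgeToA (labels M N P) c) = fB (edgeToB (labels M N P) c) := by
    intro c
    have hc := loopHom_edgeToB (artinRel_gen (M := M) (N := N) (P := P)) c
    have hb := hB (edgeToB (labels M N P) c)
    rw [hc] at hb
    refine (hAB _ (hA _) hb).trans (congrArg ιB (Subtype.ext hc.symm))
  have hfA : FreeGroup.lift (fun l => fA (of l)) = fA := by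
    refine FreeGroup.ext_hom _ _ fun l => ?_
    simp
  have hsq : fB (of none) ^ 2 = fA (of 0) * fA (of 2) * fA (of 1) := by
    rw [← map_pow, ← map_mul, ← map_mul, ← edgeToB_none (labels M N P), ← hfAB, edgeToA_none]
  have hrel : ArtinRel (labels M N P) (recover (fun l => fA (of l)) (fB (of none))) := by
    refine artinRel_recover hsq fun l => ?_
    rw [hfA, hfAB, hfAB, edgeToB_inl, edgeToB_inr]
    simp only [map_mul, map_zpow]
  let θ : TriangleArtin M N P →* Monoid.PushoutI ψ := ofArtinRel hrel
  have hθx : ∀ l, θ (letterHom (gen M N P) (of l)) = fA (of l) := by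
    intro l
    rw [letterHom, FreeGroup.lift_apply_of, map_mul, ofArtinRel_gen, ofArtinRel_gen]
    exact recover_letter hsq l
  have hθA : ∀ f, θ (letterHom (gen M N P) f) = fA f := by
    intro f
    suffices θ.comp (letterHom (gen M N P)) = fA from DFunLike.congr_fun this f
    exact FreeGroup.ext_hom _ _ hθx
  have hθB : ∀ f, θ (loopHom (labels M N P) (gen M N P) f) = fB f := by
    intro f
    suffices θ.comp (loopHom (labels M N P) (gen M N P)) = fB from DFunLike.congr_fun this f
    refine FreeGroup.ext_hom _ _ fun i => ?_
    rcases i with _ | l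
    · simp only [MonoidHom.comp_apply, loopHom, FreeGroup.lift_apply_of, map_mul]
      rw [ofArtinRel_gen, ofArtinRel_gen, ofArtinRel_gen]
      exact recover_prod _ _
    · have : loopHom (labels M N P) (gen M N P) (of (some l)) =
        letterHom (gen M N P) (edgeToA (labels M N P) (of (some (.inr l)))) := by simp [loopHom]
      rw [MonoidHom.comp_apply, this, hθA, hfAB, edgeToB_inr]
  constructor
  · -- `θ` is a left inverse
    have hleft : θ.comp (amalgamMap (fun i : Bool => cond i (TriangleArtin.vertexA M N P)
        (TriangleArtin.vertexB M N P)) (TriangleArtin.edgeC M N P) hC) = MonoidHom.id _ := by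
      refine Monoid.PushoutI.hom_ext_nonempty fun i => ?_
      ext1 g
      rcases i
      · obtain ⟨g, hg⟩ := g
        have hg' := hg
        change g ∈ TriangleArtin.vertexB M N P at hg'
        rw [← loopHom_range] at hg'
        obtain ⟨f, rfl⟩ := hg'
        simp only [MonoidHom.comp_apply, amalgamMap]
        exact hθB f
      · obtain ⟨g, hg⟩ := g
        have hg' := hg
        change g ∈ TriangleArtin.vertexA M N P at hg'
        rw [← letterHom_range] at hg'
        obtain ⟨f, rfl⟩ := hg'
        simp only [MonoidHom.comp_apply, amalgamMap]
        exact hθA f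
    exact Function.LeftInverse.injective (DFunLike.congr_fun hleft)
  · rw [← MonoidHom.range_eq_top, eq_top_iff]
    have hgen : ∀ l, gen M N P l ∈ (amalgamMap (fun i : Bool => cond i
        (TriangleArtin.vertexA M N P) (TriangleArtin.vertexB M N P))
        (TriangleArtin.edgeC M N P) hC).range := by
      have hAr : ∀ f, letterHom (gen M N P) f ∈ (amalgamMap (fun i : Bool => cond i
        (TriangleArtin.vertexA M N P) (TriangleArtin.vertexB M N P))
        (TriangleArtin.edgeC M N P) hC).range := fun f =>
        ⟨ιA ⟨_, hA f⟩, Monoid.PushoutI.lift_of (φ := ψ) _ _ _ (i := true) ⟨_, hA f⟩⟩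
      have hBr : ∀ f, loopHom (labels M N P) (gen M N P) f ∈ (amalgamMap (fun i : Bool => cond i
        (TriangleArtin.vertexA M N P) (TriangleArtin.vertexB M N P))
        (TriangleArtin.edgeC M N P) hC).range := fun f =>
        ⟨ιB ⟨_, hB f⟩, Monoid.PushoutI.lift_of (φ := ψ) _ _ _ (i := false) ⟨_, hB f⟩⟩
      intro l
      have ht := hBr (of none)
      have h0 := hAr (of 0)
      have h1 := hAr (of 1)
      rw [letterHom, FreeGroup.lift_apply_of] at h0 h1
      rw [loopHom, FreeGroup.lift_apply_of] at ht
      rw [← recover_eq (gen M N P)]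
      match l with
      | 0 => exact mul_mem ht (inv_mem h1)
      | 1 => exact mul_mem (mul_mem h1 (inv_mem ht)) h0
      | 2 => exact mul_mem (inv_mem h0) ht
    rw [← PresentedGroup.closure_range_of, Subgroup.closure_le]
    rintro _ ⟨l, rfl⟩
    exact hgen l

end Splitting

/-! ### The Bass–Serre tree -/

section Tree

variable {G : Type*} [Group G]

/-- The vertex group generated by the letters `g l * g (l + 1)`. -/
def letterGroup (g : Fin 3 → G) : Subgroup G := (letterHom g).range

/-- The representative of the type `τ`: the coset of `h * rep g τ` is the neighbour of type `τ` of
the coset of `h`. -/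
def rep (g : Fin 3 → G) (τ : Fin 3) : G := g (τ + 1)

/-- The element `w` of `G ⧸ letterGroup g` is the neighbour of type `τ` seen from `h`. -/
def Lab (g : Fin 3 → G) (h : G) (w : G ⧸ letterGroup g) (τ : Fin 3) : Prop :=
  w = ((h * rep g τ : G) : G ⧸ letterGroup g)

/-- Adjacency in the Bass–Serre tree, on the translates of the vertex of `letterGroup g`. -/
def TreeAdj (g : Fin 3 → G) (v w : G ⧸ letterGroup g) : Prop :=
  ∃ (h : G) (τ : Fin 3), v = (h : G ⧸ letterGroup g) ∧ Lab g h w τ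

/-- A path of length `n` without backtracking. -/
def IsTreePath (g : Fin 3 → G) (n : ℕ) (w : ℕ → G ⧸ letterGroup g) : Prop :=
  (∀ i < n, TreeAdj g (w i) (w (i + 1))) ∧ ∀ i, i + 2 ≤ n → w i ≠ w (i + 2)

theorem IsTreePath.tail {g : Fin 3 → G} {n : ℕ} {w : ℕ → G ⧸ letterGroup g}
    (h : IsTreePath g (n + 1) w) : IsTreePath g n (fun i => w (i + 1)) :=
  ⟨fun i hi => h.1 (i + 1) (by omega), fun i hi => h.2 (i + 1) (by omega)⟩

/-- The properties of the triangle Artin group on which the study of stabilisers rests: the Artin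
relations, the freeness of the vertex group `letterGroup g`, the readings of words
that fix an edge of the Bass–Serre tree, and the fact that the latter is a tree. -/
structure TriangleSplitting (M : Fin 3 → ℕ) (g : Fin 3 → G) : Prop where
  three_le : ∀ l, 3 ≤ M l
  artinRel : ArtinRel M g
  closure_eq_top : Subgroup.closure (Set.range g) = ⊤
  injective : Function.Injective (letterHom g)
  exists_rel : ∀ {l : Fin 3} {e : ℤ} {f : FreeGroup (Fin 3)} {σ τ : Fin 3}, ¬ First f l →
    (rep g σ)⁻¹ * letterHom g (of l ^ e * f) * rep g τ ∈ letterGroup g → ∃ ρ, Rel M l e σ ρ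
  rep_injective : ∀ {σ τ : Fin 3}, (rep g σ)⁻¹ * rep g τ ∈ letterGroup g → σ = τ
  fixes_path : ∀ (n : ℕ) (w : ℕ → G ⧸ letterGroup g), IsTreePath g n w → ∀ k : G,
    k • w 0 = w 0 → k • w n = w n → ∀ i ≤ n, k • w i = w i

end Tree

section Artin

variable {M N P : ℕ}

/-- The product `t f₁ t f₂ ⋯ t`, where `t = abc`. -/
def alternating (M N P : ℕ) : List (FreeGroup (Fin 3)) → TriangleArtin M N P
  | [] => gen M N P 0 * gen M N P 1 * gen M N P 2
  | f :: fs => gen M N P 0 * gen M N P 1 * gen M N P 2 * letterHom (gen M N P) f *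
      alternating M N P fs

theorem alternating_append (l₁ l₂ : List (FreeGroup (Fin 3))) (f : FreeGroup (Fin 3)) :
    alternating M N P (l₁ ++ f :: l₂) =
      alternating M N P l₁ * letterHom (gen M N P) f * alternating M N P l₂ := by
  induction l₁ with
  | nil => rfl
  | cons f' l₁ ih =>
    rw [List.cons_append, alternating, ih, alternating]
    simp only [mul_assoc]

theorem letterHom_sq : letterHom (gen M N P) (of 0 * of 2 * of 1) =
    (gen M N P 0 * gen M N P 1 * gen M N P 2) * (gen M N P 0 * gen M N P 1 * gen M N P 2) := by
  simp only [letterHom, map_mul, FreeGroup.lift_apply_of, mul_assoc]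
  rfl

theorem alternating_inv (fs : List (FreeGroup (Fin 3))) :
    (alternating M N P fs)⁻¹ =
      alternating M N P (fs.map fun f => (of 0 * of 2 * of 1)⁻¹ * f⁻¹).reverse *
        letterHom (gen M N P) (of 0 * of 2 * of 1)⁻¹ := by
  induction fs with
  | nil =>
    rw [map_inv, letterHom_sq]
    simp only [alternating, List.map_nil, List.reverse_nil]
    group
  | cons f fs ih =>
    rw [List.map_cons, List.reverse_cons, alternating_append]
    have h1 : alternating M N P (f :: fs) = gen M N P 0 * gen M N P 1 * gen M N P 2 *
      letterHom (gen M N P) f * alternating M N P fs := rfl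
    rw [h1, mul_inv_rev, ih, map_mul (letterHom _) _⁻¹ f⁻¹]
    simp only [alternating, map_inv, letterHom_sq]
    group

/-- The letters of an alternating word in the abstract amalgamated product. -/
def alternatingList (tail : List (Σ i, FreeGroup (VertexIndex i))) :
    List (FreeGroup (Fin 3)) → List (Σ i, FreeGroup (VertexIndex i))
  | [] => ⟨false, of none⟩ :: tail
  | f :: fs => ⟨false, of none⟩ :: ⟨true, f⟩ :: alternatingList tail fs

theorem alternatingList_spec {m : Fin 3 → ℕ} {tail : List (Σ i, FreeGroup (VertexIndex i))}
    (ht : ∀ x ∈ tail, x.2 ∉ (edgeTo m x.1).range)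
    (hc : (⟨false, of none⟩ :: tail : List (Σ i, FreeGroup (VertexIndex i))).IsChain
      fun a b => a.1 ≠ b.1) {fs : List (FreeGroup (Fin 3))}
    (hf : ∀ f ∈ fs, f ∉ (edgeToA m).range) :
    (∀ x ∈ alternatingList tail fs, x.2 ∉ (edgeTo m x.1).range) ∧
      (alternatingList tail fs).IsChain (fun a b => a.1 ≠ b.1) ∧
      (alternatingList tail fs).head? = some ⟨false, of none⟩ := by
  have hnone : (of none : FreeGroup (VertexIndex false)) ∉ (edgeTo m false).range :=
    not_mem_edgeToB_range m
  induction fs with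
  | nil =>
    refine ⟨?_, hc, rfl⟩
    rintro x (_ | ⟨_, hx⟩)
    · exact hnone
    · exact ht x hx
  | cons f fs ih =>
    obtain ⟨h1, h2, h3⟩ := ih fun f hf' => hf f (List.mem_cons_of_mem _ hf')
    refine ⟨?_, ?_, rfl⟩
    · rintro x (_ | ⟨_, hx⟩)
      · exact hnone
      · rcases hx with _ | ⟨_, hx⟩
        · exact hf f List.mem_cons_self
        · exact h1 x hx
    · unfold alternatingList
      rcases hl : alternatingList tail fs with _ | ⟨y, l⟩
      · rw [hl] at h3; simp at h3
      · rw [hl] at h3 h2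
        simp only [List.head?_cons, Option.some.injEq] at h3
        subst h3
        exact .cons_cons (by simp) (.cons_cons (by simp) h2)

theorem alternatingList_prod (tail : List (Σ i, FreeGroup (VertexIndex i)))
    (fs : List (FreeGroup (Fin 3))) :
    ((alternatingList tail fs).map fun x =>
      Monoid.PushoutI.of (φ := edgeTo (labels M N P)) x.1 x.2).prod =
      toAmalgam (alternating M N P fs) * (tail.map fun x =>
        Monoid.PushoutI.of (φ := edgeTo (labels M N P)) x.1 x.2).prod := by
  have ht : toAmalgam (gen M N P 0 * gen M N P 1 * gen M N P 2) =
      Monoid.PushoutI.of (φ := edgeTo (labels M N P)) false (of (none : Option (Fin 3))) := by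
    have := toAmalgam_loopHom (M := M) (N := N) (P := P) (of none)
    rw [← this]; simp [loopHom]
  induction fs with
  | nil =>
    simp only [alternatingList, alternating, List.map_cons, List.prod_cons, ht]
  | cons f fs ih =>
    simp only [alternatingList, alternating, List.map_cons, List.prod_cons, ih, map_mul,
      toAmalgam_letterHom]
    rw [← map_mul, ← map_mul, ht]
    simp only [mul_assoc]

/-- The normal form theorem for amalgamated products, for words that begin and end with `abc`. -/
theorem alternating_notMem (h : ∀ l, 3 ≤ labels M N P l) {fs : List (FreeGroup (Fin 3))}
    (hf : ∀ f ∈ fs, f ∉ (edgeToA (labels M N P)).range) :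
    alternating M N P fs ∉ letterGroup (gen M N P) := by
  rintro ⟨a, ha⟩
  -- a reduced word with at least one letter does not represent an element of the edge group
  have key : ∀ tail : List (Σ i, FreeGroup (VertexIndex i)),
      (∀ x ∈ tail, x.2 ∉ (edgeTo (labels M N P) x.1).range) →
      ((⟨false, of none⟩ :: tail : List (Σ i, FreeGroup (VertexIndex i))).IsChain
        fun a b => a.1 ≠ b.1) →
      toAmalgam (alternating M N P fs) * (tail.map fun x =>
        Monoid.PushoutI.of (φ := edgeTo (labels M N P)) x.1 x.2).prod ∉
          (Monoid.PushoutI.base (edgeTo (labels M N P))).range := by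
    intro tail ht hc hmem
    obtain ⟨h1, h2, h3⟩ := alternatingList_spec ht hc hf
    let w : Monoid.CoprodI.Word (fun i => FreeGroup (VertexIndex i)) :=
      ⟨alternatingList tail fs, fun x hx hx1 => h1 x hx (by rw [hx1]; exact one_mem _), h2⟩
    have hw : Monoid.PushoutI.Reduced (edgeTo (labels M N P)) w := h1
    have := hw.eq_empty_of_mem_range (edgeTo_injective h) (by
      convert hmem using 1
      rw [← alternatingList_prod]
      simp only [Monoid.CoprodI.Word.prod, map_list_prod, List.map_map]
      rfl)
    have hl : alternatingList tail fs = [] := congrArg Monoid.CoprodI.Word.toList this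
    rw [hl] at h3
    simp at h3
  by_cases hac : a ∈ (edgeToA (labels M N P)).range
  · refine key [] (by simp) (by simp) ?_
    obtain ⟨c, rfl⟩ := hac
    refine ⟨c, ?_⟩
    rw [← ha, toAmalgam_letterHom, List.map_nil, List.prod_nil, mul_one]
    exact (Monoid.PushoutI.of_apply_eq_base (edgeTo _) true c).symm
  · refine key [⟨true, a⁻¹⟩] ?_ (.cons_cons (by simp) (.singleton _)) ?_
    · simp only [List.mem_singleton, forall_eq]
      intro h'
      have h'' : a⁻¹⁻¹ ∈ (edgeToA (labels M N P)).range := inv_mem h'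
      rw [inv_inv] at h''
      exact hac h''
    · rw [← ha, toAmalgam_letterHom]
      simp only [List.map_cons, List.map_nil, List.prod_cons, List.prod_nil, mul_one]
      rw [← map_mul, mul_inv_cancel, map_one]
      exact one_mem _

theorem conj_edge_mem {c : FreeGroup (Fin 3)} (hc : c ∈ (edgeToA (labels M N P)).range) :
    (gen M N P 0 * gen M N P 1 * gen M N P 2) * letterHom (gen M N P) c *
      (gen M N P 0 * gen M N P 1 * gen M N P 2)⁻¹ ∈ letterGroup (gen M N P) := by
  obtain ⟨c, rfl⟩ := hc
  obtain ⟨d, hd⟩ := conj_mem_edgeToB_range (labels M N P) ⟨c, rfl⟩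
  refine ⟨edgeToA (labels M N P) d, ?_⟩
  rw [← loopHom_edgeToB artinRel_gen, hd, ← loopHom_edgeToB artinRel_gen]
  simp [loopHom]

theorem sq_mem_letterGroup : (gen M N P 0 * gen M N P 1 * gen M N P 2) *
    (gen M N P 0 * gen M N P 1 * gen M N P 2) ∈ letterGroup (gen M N P) :=
  ⟨_, letterHom_sq⟩

/-- The neighbours of the base vertex are the translates of the vertex of `abc` by elements of the
vertex group: the edges lie in one orbit. -/
theorem rep_eq (τ : Fin 3) : ∃ a ∈ letterGroup (gen M N P), rep (gen M N P) τ =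
    letterHom (gen M N P) (typeRep τ) * (gen M N P 0 * gen M N P 1 * gen M N P 2) * a := by
  match τ with
  | 0 =>
    refine ⟨(letterHom (gen M N P) (of 2 * of 1))⁻¹, inv_mem ⟨_, rfl⟩, ?_⟩
    simp only [letterHom, map_mul, FreeGroup.lift_apply_of, typeRep, Matrix.cons_val_zero]
    change gen M N P 1 = gen M N P 1 * gen M N P 2 * _ * (gen M N P 2 * gen M N P 0 *
      (gen M N P 1 * gen M N P 2))⁻¹
    group
  | 1 =>
    refine ⟨1, one_mem _, ?_⟩
    simp only [letterHom, map_inv, FreeGroup.lift_apply_of, typeRep, Matrix.cons_val_zero,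
      Matrix.cons_val_one]
    change gen M N P 2 = (gen M N P 0 * gen M N P 1)⁻¹ * _ * 1
    group
  | 2 =>
    refine ⟨(letterHom (gen M N P) (of 1))⁻¹, inv_mem ⟨_, rfl⟩, ?_⟩
    have : typeRep 2 = 1 := rfl
    rw [this, map_one]
    simp only [letterHom, FreeGroup.lift_apply_of]
    change gen M N P 0 = 1 * _ * (gen M N P 1 * gen M N P 2)⁻¹
    group

/-- The edge group consists of the elements of `A` that stay in `A` under conjugation by `abc`. -/
theorem mem_edgeToA_range_of_conj (h : ∀ l, 3 ≤ labels M N P l) {f : FreeGroup (Fin 3)}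
    (hf : (gen M N P 0 * gen M N P 1 * gen M N P 2)⁻¹ * letterHom (gen M N P) f *
      (gen M N P 0 * gen M N P 1 * gen M N P 2) ∈ letterGroup (gen M N P)) :
    f ∈ (edgeToA (labels M N P)).range := by
  by_contra hc
  refine alternating_notMem h (fs := [f]) (by simpa using hc) ?_
  have := mul_mem sq_mem_letterGroup hf
  convert this using 1
  simp only [alternating]
  group

theorem mem_edgeToA_range_of_rep (h : ∀ l, 3 ≤ labels M N P l) {f : FreeGroup (Fin 3)}
    {σ τ : Fin 3} (hf : (rep (gen M N P) σ)⁻¹ * letterHom (gen M N P) f * rep (gen M N P) τ ∈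
      letterGroup (gen M N P)) :
    (typeRep σ)⁻¹ * f * typeRep τ ∈ (edgeToA (labels M N P)).range := by
  obtain ⟨a, ha, hσ⟩ := rep_eq (M := M) (N := N) (P := P) σ
  obtain ⟨b, hb, hτ⟩ := rep_eq (M := M) (N := N) (P := P) τ
  apply mem_edgeToA_range_of_conj h
  have := mul_mem (mul_mem ha hf) (inv_mem hb)
  convert this using 1
  rw [hσ, hτ, map_mul, map_mul, map_inv]
  group

theorem exists_treeAdj_lift {v w : TriangleArtin M N P ⧸ letterGroup (gen M N P)}
    (h : TreeAdj (gen M N P) v w) : ∃ k : TriangleArtin M N P,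
      v = (k : TriangleArtin M N P ⧸ letterGroup (gen M N P)) ∧
      w = ((k * (gen M N P 0 * gen M N P 1 * gen M N P 2) : TriangleArtin M N P) :
        TriangleArtin M N P ⧸ letterGroup (gen M N P)) := by
  obtain ⟨k, τ, rfl, rfl⟩ := h
  obtain ⟨a, ha, hτ⟩ := rep_eq (M := M) (N := N) (P := P) τ
  refine ⟨k * letterHom (gen M N P) (typeRep τ), ?_, ?_⟩
  · rw [QuotientGroup.eq]
    exact ⟨typeRep τ, by group⟩
  · rw [QuotientGroup.eq, hτ]
    convert inv_mem ha using 1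
    group

/-- A path without backtracking spells an alternating product without letters in the edge group. -/
theorem exists_alternating (n : ℕ)
    (w : ℕ → TriangleArtin M N P ⧸ letterGroup (gen M N P))
    (hw : IsTreePath (gen M N P) (n + 1) w) (k : TriangleArtin M N P)
    (h0 : w 0 = (k : TriangleArtin M N P ⧸ letterGroup (gen M N P)))
    (h1 : w 1 = ((k * (gen M N P 0 * gen M N P 1 * gen M N P 2) : TriangleArtin M N P) :
        TriangleArtin M N P ⧸ letterGroup (gen M N P))) :
    ∃ fs : List (FreeGroup (Fin 3)), (∀ f ∈ fs, f ∉ (edgeToA (labels M N P)).range) ∧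
      w (n + 1) = ((k * alternating M N P fs : TriangleArtin M N P) :
        TriangleArtin M N P ⧸ letterGroup (gen M N P)) := by
  induction n generalizing w k with
  | zero => exact ⟨[], by simp, h1⟩
  | succ n ih =>
    obtain ⟨k', hk, hk'⟩ := exists_treeAdj_lift (hw.1 1 (by omega))
    obtain ⟨f, hf⟩ : (k * (gen M N P 0 * gen M N P 1 * gen M N P 2))⁻¹ * k' ∈
      letterGroup (gen M N P) := QuotientGroup.eq.1 (h1.symm.trans hk)
    obtain ⟨fs, hfs, hn⟩ := ih _ hw.tail k' hk hk'
    refine ⟨f :: fs, ?_, ?_⟩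
    · intro f' hf'
      rcases List.mem_cons.1 hf' with rfl | hf'
      · intro hc
        refine hw.2 0 (by omega) ?_
        change w 0 = w (1 + 1)
        rw [hk', h0, QuotientGroup.eq]
        have h2 := mul_mem (conj_edge_mem hc) sq_mem_letterGroup
        convert h2 using 1
        rw [hf]
        group
      · exact hfs f' hf'
    · rw [hn]
      congr 1
      rw [alternating, hf]
      group

/-- An element that fixes the ends of a path without backtracking fixes the path: otherwise the
path and its translate would form a longer path without backtracking, and the normal form theorem
would forbid that it is closed. -/
theorem fixes_path (h : ∀ l, 3 ≤ labels M N P l) (n : ℕ)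
    (w : ℕ → TriangleArtin M N P ⧸ letterGroup (gen M N P)) (hw : IsTreePath (gen M N P) n w)
    (γ : TriangleArtin M N P) (h0 : γ • w 0 = w 0) (hn : γ • w n = w n) :
    ∀ i ≤ n, γ • w i = w i := by
  induction n generalizing w with
  | zero =>
    intro i hi
    obtain rfl : i = 0 := by omega
    exact h0
  | succ n ih =>
    have h1 : γ • w 1 = w 1 := by
      obtain ⟨k, hk, hk'⟩ := exists_treeAdj_lift (hw.1 0 (by omega))
      obtain ⟨fs, hfs, hfn⟩ := exists_alternating n w hw k hk hk'
      obtain ⟨α, hα⟩ : k⁻¹ * (γ * k) ∈ letterGroup (gen M N P) := by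
        rw [hk, MulAction.Quotient.smul_coe] at h0
        exact QuotientGroup.eq.1 h0.symm
      by_cases hc : α ∈ (edgeToA (labels M N P)).range
      · rw [hk', MulAction.Quotient.smul_coe, eq_comm, QuotientGroup.eq]
        -- conjugation by `abc` and by its inverse differ by an element of `A`
        have h2 := mul_mem (mul_mem (inv_mem sq_mem_letterGroup) (conj_edge_mem hc))
          (sq_mem_letterGroup (M := M) (N := N) (P := P))
        convert h2 using 1
        rw [hα, smul_eq_mul]
        group
      · exfalso
        rw [hfn, MulAction.Quotient.smul_coe, eq_comm, QuotientGroup.eq] at hn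
        refine alternating_notMem h (fs := (fs.map fun f => (of 0 * of 2 * of 1)⁻¹ * f⁻¹).reverse ++
          ((of 0 * of 2 * of 1)⁻¹ * α) :: fs) ?_ ?_
        · have hT : (of 0 * of 2 * of 1 : FreeGroup (Fin 3)) ∈ (edgeToA (labels M N P)).range :=
            ⟨_, edgeToA_none⟩
          intro f hf
          simp only [List.mem_append, List.mem_reverse, List.mem_map, List.mem_cons] at hf
          rcases hf with ⟨f', hf', rfl⟩ | rfl | hf
          · intro hm
            have h3 := inv_mem (mul_mem hT hm)
            rw [mul_inv_cancel_left, inv_inv] at h3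
            exact hfs f' hf' h3
          · intro hm
            have h3 := mul_mem hT hm
            rw [mul_inv_cancel_left] at h3
            exact hc h3
          · exact hfs f hf
        · rw [alternating_append, map_mul, ← mul_assoc, ← alternating_inv, hα]
          convert hn using 1
          rw [smul_eq_mul]
          group
    intro i hi
    rcases i with _ | i
    · exact h0
    · exact ih (fun i => w (i + 1)) hw.tail h1 hn i (by omega)

theorem triangleSplitting (h : ∀ l, 3 ≤ labels M N P l) :
    TriangleSplitting (labels M N P) (gen M N P) where
  three_le := h
  artinRel := artinRel_gen
  closure_eq_top := PresentedGroup.closure_range_of _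
  injective := letterHom_injective h
  exists_rel hf hm := exists_rel_of_mem_edgeToA_range h hf (mem_edgeToA_range_of_rep h hm)
  rep_injective {σ τ} hm := by
    refine eq_of_mem_edgeToA_range h ?_
    have := mem_edgeToA_range_of_rep h (f := 1) (σ := σ) (τ := τ) (by simpa using hm)
    simpa using this
  fixes_path n w hw γ h0 hn := fixes_path h n w hw γ h0 hn

end Artin

end TriangleWord

/-! ### Products without cancellation in free groups -/

namespace FreeGroup

variable {α : Type*} [DecidableEq α]

theorem getLast?_toWord (f : FreeGroup α) :
    f.toWord.getLast?.map Prod.fst = f⁻¹.toWord.head?.map Prod.fst := by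
  rw [toWord_inv, invRev, List.head?_reverse, List.getLast?_map, Option.map_map]
  rfl

/-- There is no cancellation between a word that ends with the letter `p` and a word that begins
with another letter. -/
theorem toWord_mul_of_ne {f₁ f₂ : FreeGroup α} {p q : α} (h₁ : First f₁⁻¹ p) (h₂ : First f₂ q)
    (hpq : p ≠ q) : (f₁ * f₂).toWord = f₁.toWord ++ f₂.toWord := by
  rw [toWord_mul]
  refine IsReduced.reduce_eq (List.isChain_append.2 ⟨isReduced_toWord, isReduced_toWord, ?_⟩)
  intro x hx y hy hxy
  unfold First at h₁ h₂
  rw [← getLast?_toWord, Option.mem_def.1 hx] at h₁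
  rw [Option.mem_def.1 hy] at h₂
  simp only [Option.map_some, Option.some.injEq] at h₁ h₂
  exact absurd (h₁.symm.trans (hxy.trans h₂)) hpq

theorem norm_mul_of_ne {f₁ f₂ : FreeGroup α} {p q : α} (h₁ : First f₁⁻¹ p) (h₂ : First f₂ q)
    (hpq : p ≠ q) : norm (f₁ * f₂) = norm f₁ + norm f₂ := by
  simp [norm, toWord_mul_of_ne h₁ h₂ hpq]

theorem First.mul_of_ne {f₁ f₂ : FreeGroup α} {p q z : α} (h : First f₁ z) (h₁ : First f₁⁻¹ p)
    (h₂ : First f₂ q) (hpq : p ≠ q) : First (f₁ * f₂) z := by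
  unfold First
  rw [toWord_mul_of_ne h₁ h₂ hpq, List.head?_append]
  unfold First at h
  cases hf : f₁.toWord.head? with
  | none => simp [hf] at h
  | some s => rwa [hf] at h

theorem First.mul_zpow {f : FreeGroup α} {b l : α} (h : First f b) (hb : b ≠ l) (c : ℤ) :
    First (f * of l ^ c) b := by
  -- a version for words that do not end with `l`
  have key : ∀ {y : FreeGroup α} (c : ℤ), First y b → ¬ First y⁻¹ l → First (y * of l ^ c) b := by
    intro y c hy hl
    by_cases hc : c = 0
    · simpa [hc] using hy
    obtain ⟨z, hz⟩ := exists_first (inv_ne_one.2 hy.ne_one)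
    exact hy.mul_of_ne hz (first_zpow hc) fun h' => hl (h' ▸ hz)
  by_cases hl : First f⁻¹ l
  · obtain ⟨d, y, hd, hf, hy, -⟩ := hl.exists_zpow_mul
    have hf' : f = y⁻¹ * of l ^ (-d) := by
      rw [← inv_inv f, hf, mul_inv_rev, zpow_neg]
    have hy1 : y ≠ 1 := by
      rintro rfl
      rw [inv_one, one_mul] at hf'
      rw [hf'] at h
      exact hb (h.unique (first_zpow (neg_ne_zero.2 hd)))
    have hy' : First y⁻¹ b := by
      obtain ⟨z, hz⟩ := exists_first (inv_ne_one.2 hy1)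
      by_cases hzb : z = b
      · exact hzb ▸ hz
      · obtain ⟨r, hr⟩ := exists_first hy1
        have hrl : r ≠ l := fun h' => hy (h' ▸ hr)
        have := hz.mul_of_ne (by rwa [inv_inv]) (first_zpow (neg_ne_zero.2 hd)) hrl
        rw [← hf'] at this
        exact absurd (this.unique h) hzb
    rw [hf', mul_assoc, ← zpow_add]
    exact key _ hy' (by rwa [inv_inv])
  · exact key c h hl

/-- The powers of a cyclically reduced word whose ends are different letters have the same ends. -/
theorem First.pow_of_ne {f : FreeGroup α} {p q : α} (hpq : p ≠ q) (hq : First f q)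
    (hp : First f⁻¹ p) (n : ℕ) :
    First (f ^ (n + 1)) q ∧ First (f ^ (n + 1))⁻¹ p ∧ n + 1 ≤ norm (f ^ (n + 1)) := by
  induction n with
  | zero =>
    rw [zero_add, pow_one]
    refine ⟨hq, hp, ?_⟩
    have : norm f ≠ 0 := fun h => hq.ne_one (norm_eq_zero.1 h)
    omega
  | succ n ih =>
    obtain ⟨h1, h2, h3⟩ := ih
    refine ⟨?_, ?_, ?_⟩
    · rw [pow_succ']
      exact hq.mul_of_ne hp h1 hpq
    · rw [pow_succ', mul_inv_rev]
      exact h2.mul_of_ne (by rwa [inv_inv]) hp hpq.symm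
    · rw [pow_succ', norm_mul_of_ne hp h1 hpq]
      have : norm f ≠ 0 := fun h => hq.ne_one (norm_eq_zero.1 h)
      omega

end FreeGroup

namespace TriangleWord

open FreeGroup (of First first_zpow_mul first_zpow not_first_one exists_first norm)

/-! ### Ports -/

section Ports

variable {G : Type*} [Group G] (g : Fin 3 → G) {M : Fin 3 → ℕ}

/-- The letter `g l * g (l + 1)`. -/
def letter (l : Fin 3) : G := g l * g (l + 1)

theorem letterHom_of (l : Fin 3) : letterHom g (of l) = letter g l := by
  simp [letterHom, letter]

theorem letterHom_zpow (l : Fin 3) (e : ℤ) : letterHom g (of l ^ e) = letter g l ^ e := by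
  rw [map_zpow, letterHom_of]

theorem letter_mem (l : Fin 3) : letter g l ∈ letterGroup g := ⟨of l, letterHom_of g l⟩

theorem letter_zpow_mem (l : Fin 3) (e : ℤ) : letter g l ^ e ∈ letterGroup g :=
  zpow_mem (letter_mem g l) e

/-- A representative of the type `τ` in the dihedral Artin group of the letter `l`, such that
conjugation by powers of the letter carries these representatives into each other. -/
def stem (l τ : Fin 3) : G :=
  if τ = l then (g l)⁻¹ else if τ = l + 1 then (g (l + 1))⁻¹ else g l * (g (l + 1))⁻¹ * (g l)⁻¹

/-- Whether the port on a line of letter `q` is a generator or the inverse of a generator. -/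
def delta (q p τ : Fin 3) : ℤ := if τ = q - 1 ∨ τ = q ∧ p = q + 1 then 1 else 0

/-- The representative of the type `τ` that transports the end of a line of letter `q`, if the
axis turns there from or to a line of letter `p`. It is one of the generators `g q`, `g (q + 1)` or
one of their inverses. -/
def port (q p τ : Fin 3) : G := stem g q τ * letter g q ^ delta q p τ

theorem port_eq (q p τ : Fin 3) : port g q p τ =
    if τ = q - 1 then g q else if τ = q + 1 then (g (q + 1))⁻¹ else
      if p = q + 1 then g (q + 1) else (g q)⁻¹ := by
  obtain ⟨a1, a2, a3, a4, a5, a6⟩ := fin3_ne q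
  unfold port stem delta letter
  rcases fin3_cases q τ with rfl | rfl | rfl
  · simp [a1, a6]
  · simp [a2, a3]
  · by_cases hp : p = τ + 1 <;> simp [a4, a5, hp]

theorem port_mem (q p τ : Fin 3) : (rep g τ)⁻¹ * port g q p τ ∈ letterGroup g := by
  obtain ⟨a1, a2, a3, a4, a5, a6⟩ := fin3_ne q
  rw [port_eq]
  rcases fin3_cases q τ with rfl | rfl | rfl
  · simp [rep, one_mem]
  · simp only [a3, if_false, if_true, rep]
    convert inv_mem (letter_mem g (q + 1)) using 1
    simp [letter]
  · simp only [a4, a5, if_false, rep]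
    split_ifs
    · simp [one_mem]
    · convert inv_mem (letter_mem g τ) using 1
      simp [letter]

/-- The third letter. -/
def third (p q : Fin 3) : Fin 3 := -p - q

/-- The type of the previous vertex, seen from the transported corner. -/
def backType (q p τ : Fin 3) : Fin 3 := if τ = q then p else q

theorem port_mul_rep_mem {q p : Fin 3} (hpq : p ≠ q) (τ : Fin 3) :
    port g q p τ * rep g (backType q p τ) ∈ letterGroup g := by
  obtain ⟨a1, a2, a3, a4, a5, a6⟩ := fin3_ne q
  rw [port_eq]
  rcases fin3_cases q τ with rfl | rfl | rfl
  · simp only [if_true, rep, backType, a1, if_false]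
    exact letter_mem g q
  · simp only [a3, if_false, if_true, rep, backType, a2, inv_mul_cancel, one_mem]
  · simp only [a4, a5, if_false, if_true, rep, backType]
    split_ifs with h
    · subst h
      exact letter_mem g (τ + 1)
    · obtain rfl : p = τ - 1 := by
        rcases fin3_cases τ p with h' | h' | h'
        exacts [h', absurd h' h, absurd h' hpq]
      simp [one_mem]

theorem port_comm {p q τ : Fin 3} (hpq : p ≠ q) (h : τ ≠ third p q) :
    port g p q τ = port g q p τ := by
  rw [port_eq, port_eq]
  revert p q τ
  have key : ∀ p q τ : Fin 3, p ≠ q → τ ≠ third p q →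
      (if τ = p - 1 then (p, true) else if τ = p + 1 then (p + 1, false) else
        if q = p + 1 then (p + 1, true) else (p, false)) =
      (if τ = q - 1 then (q, true) else if τ = q + 1 then (q + 1, false) else
        if p = q + 1 then (q + 1, true) else (q, false)) := by decide
  intro p q τ hpq h
  have := congrArg (fun x : Fin 3 × Bool => if x.2 then g x.1 else (g x.1)⁻¹) (key p q τ hpq h)
  simpa only [apply_ite (fun x : Fin 3 × Bool => if x.2 then g x.1 else (g x.1)⁻¹), if_true,
    Bool.false_eq_true, if_false] using this

/-- The exponent of the line that separates the two transports of a corner whose third letter is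
the type. -/
def tipExp (p q : Fin 3) : ℤ := if p = third p q + 1 then -1 else 1

theorem port_third {p q : Fin 3} (hpq : p ≠ q) :
    port g p q (third p q) * letter g (third p q) ^ tipExp p q = port g q p (third p q) := by
  rw [port_eq, port_eq]
  have e1 : (-1 : Fin 3) = 2 := rfl
  have e2 : (-2 : Fin 3) = 1 := rfl
  have e3 : (1 + 1 : Fin 3) = 2 := rfl
  have e4 : (2 + 1 : Fin 3) = 0 := rfl
  have e5 : (2 - 1 : Fin 3) = 1 := rfl
  revert hpq
  fin_cases p <;> fin_cases q <;> intro hpq <;>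
    simp [third, tipExp, letter, e1, e2, e3, e4, e5] at hpq ⊢

variable {g}

theorem letter_pow_mul_of_odd (hg : ArtinRel M g) {l : Fin 3} (h : ¬ Even (M l)) :
    letter g l ^ (M l / 2) * g l = g (l + 1) * letter g l ^ (M l / 2) :=
  (altProd_odd_iff h).1 (hg l)

/-- A full turn of the circle of types is central in the dihedral Artin group. -/
theorem letter_zpow_period_comm (hM : ∀ l, 3 ≤ M l) (hg : ArtinRel M g) (l : Fin 3) :
    Commute (letter g l ^ period M l) (g l) := by
  obtain ⟨h1, -, -, h2⟩ | ⟨h1, -, h2⟩ := period_ge hM l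
  · have := (altProd_even_iff h1).1 (hg l)
    rw [← h2, zpow_natCast]
    exact this.symm
  · have := letter_pow_mul_of_odd hg h1
    rw [h2, two_mul, zpow_add, zpow_add, zpow_natCast, zpow_one]
    change _ * _ = _ * _
    set y := letter g l ^ (M l / 2)
    have hc : y * letter g l = letter g l * y := (Commute.refl (letter g l)).pow_left _
    calc y * y * letter g l * g l = letter g l * (y * (y * g l)) := by
            rw [mul_assoc y y, hc, ← mul_assoc, hc]; group
      _ = g l * ((g (l + 1) * y) * g (l + 1) * y) := by rw [this]; simp only [letter]; group
      _ = g l * (y * letter g l * y) := by rw [← this]; simp only [letter]; group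
      _ = g l * (y * y * letter g l) := by rw [mul_assoc, ← hc, mul_assoc]

theorem letter_zpow_period_comm' (hM : ∀ l, 3 ≤ M l) (hg : ArtinRel M g) (l : Fin 3) :
    Commute (letter g l ^ period M l) (g (l + 1)) := by
  have : g (l + 1) = (g l)⁻¹ * letter g l := by simp [letter]
  rw [this]
  exact (letter_zpow_period_comm hM hg l).inv_right.mul_right ((Commute.refl _).zpow_left _)

theorem commute_stem (hM : ∀ l, 3 ≤ M l) (hg : ArtinRel M g) (l τ : Fin 3) :
    Commute (letter g l ^ period M l) (stem g l τ) := by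
  have h1 := letter_zpow_period_comm hM hg l
  have h2 := letter_zpow_period_comm' hM hg l
  unfold stem
  split_ifs
  · exact h1.inv_right
  · exact h2.inv_right
  · exact (h1.mul_right h2.inv_right).mul_right h1.inv_right

theorem letter_zpow_mul_stem (hM : ∀ l, 3 ≤ M l) (hg : ArtinRel M g) {l : Fin 3} {e : ℤ}
    {σ τ : Fin 3} (h : Rel M l e σ τ) :
    letter g l ^ e * stem g l τ = stem g l σ * letter g l ^ e := by
  obtain ⟨a1, a2, a3, a4, a5, a6⟩ := fin3_ne l
  -- move both types to the beginning of their circle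
  have key : ∀ τ, stem g l τ = letter g l ^ (-position M l τ) *
      (if circle M l τ then (g l)⁻¹ else stem g l (l - 1)) * letter g l ^ position M l τ := by
    intro τ
    rcases fin3_cases l τ with rfl | rfl | rfl
    · simp [circle, position, a1]
    · simp only [circle, a2, and_false, decide_false, Bool.false_eq_true, if_false, stem, if_true,
        a1, a6, position, a3, letter]
      group
    · by_cases he : Even (M τ)
      · simp [circle, position, stem, he, a4, a5]
      · simp only [circle, he, false_and, decide_false, Bool.false_eq_true, if_false, stem,
          if_true, a1, a6, position, a4, a5]
        have := letter_pow_mul_of_odd hg he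
        rw [zpow_neg, zpow_add, zpow_natCast, zpow_one]
        set y := letter g τ ^ (M τ / 2)
        have h3 : (g (τ + 1))⁻¹ * y = y * (g τ)⁻¹ := by
          rw [inv_mul_eq_iff_eq_mul, ← mul_assoc, ← this]; group
        have hc : y * letter g τ = letter g τ * y := (Commute.refl (letter g τ)).pow_left _
        have h4 : letter g τ = g τ * g (τ + 1) := rfl
        calc (g τ)⁻¹ = y⁻¹ * (y * (g τ)⁻¹) := by group
          _ = y⁻¹ * ((g (τ + 1))⁻¹ * y) := by rw [h3]
          _ = (letter g τ * y)⁻¹ * (g τ * (g (τ + 1))⁻¹ * (g τ)⁻¹) * (letter g τ * y) := by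
              rw [h4]; group
          _ = _ := by rw [hc]
  obtain ⟨hc, k, rfl⟩ := h
  rw [key σ, key τ, hc]
  have hz : Commute (letter g l ^ (k * period M l))
      (if circle M l τ then (g l)⁻¹ else stem g l (l - 1)) := by
    rw [mul_comm, zpow_mul]
    apply Commute.zpow_left
    split_ifs
    · exact (letter_zpow_period_comm hM hg l).inv_right
    · exact commute_stem hM hg l _
  set z := if circle M l τ then (g l)⁻¹ else stem g l (l - 1)
  calc letter g l ^ (k * period M l + position M l τ - position M l σ) *
        (letter g l ^ (-position M l τ) * z * letter g l ^ position M l τ)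
      = letter g l ^ (-position M l σ) * (letter g l ^ (k * period M l) * z) *
          letter g l ^ position M l τ := by group
    _ = letter g l ^ (-position M l σ) * (z * letter g l ^ (k * period M l)) *
          letter g l ^ position M l τ := by rw [hz.eq]
    _ = _ := by group

/-- The transport of a line. -/
theorem port_mul_zpow (hM : ∀ l, 3 ≤ M l) (hg : ArtinRel M g) {l : Fin 3} {e : ℤ}
    {σ τ : Fin 3} (h : Rel M l e σ τ) (p p' : Fin 3) :
    port g l p σ * letter g l ^ (e + delta l p' τ - delta l p σ) =
      letter g l ^ e * port g l p' τ := by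
  unfold port
  rw [← mul_assoc (_ ^ e), letter_zpow_mul_stem hM hg h]
  group

end Ports
/-! ### Transport of axes to adjacent vertices -/

section Vanishing

variable {M : Fin 3 → ℕ}

theorem Rel.symm {l : Fin 3} {e : ℤ} {σ τ : Fin 3} (h : Rel M l e σ τ) : Rel M l (-e) τ σ :=
  h.exists_arrow.elim fun _ hc => hc.symm.rel

theorem Rel.trans {l : Fin 3} {e e' : ℤ} {ρ σ τ : Fin 3} (h : Rel M l e ρ σ)
    (h' : Rel M l e' σ τ) : Rel M l (e + e') ρ τ :=
  h.exists_arrow.elim fun _ hc => h'.exists_arrow.elim fun _ hc' => (hc.trans hc').rel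

theorem rel_arc (l : Fin 3) : Rel M l 1 (l - 1) (l + 1) := (arrow_arc l).rel

theorem Rel.period_dvd {l : Fin 3} {e : ℤ} {σ : Fin 3} (h : Rel M l e σ σ) : period M l ∣ e := by
  obtain ⟨-, k, rfl⟩ := h
  exact ⟨k, by ring⟩

theorem rel_one_middle (hM : ∀ l, 3 ≤ M l) {l τ : Fin 3} (h : Rel M l 1 l τ) : τ = l - 1 := by
  obtain ⟨a1, a2, a3, a4, a5, a6⟩ := fin3_ne l
  rcases fin3_cases l τ with rfl | rfl | rfl
  · rfl
  · exfalso
    obtain ⟨hc, k, hk⟩ := h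
    obtain ⟨h1, -, -, -⟩ | ⟨h1, h3, h2⟩ := period_ge hM l
    · simp [circle, h1, a2] at hc
    · simp only [position, a3, a4, a5, h1, if_false, if_true] at hk
      have h5 : (k : ℤ) * period M l = period M l - (M l / 2 : ℕ) + 1 - period M l + 2 * (M l / 2 : ℕ) := by
        linarith
      rcases lt_trichotomy k 0 with hk0 | rfl | hk0
      · nlinarith
      · omega
      · have : k = 1 ∨ 2 ≤ k := by omega
        rcases this with rfl | hk2
        · omega
        · nlinarith
  · exfalso
    have := Int.le_of_dvd one_pos h.period_dvd
    obtain ⟨-, h1, -⟩ | ⟨-, h1, -⟩ := period_ge hM τ <;> omega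

/-- The lines that shrink to a point under transport: a line of letter `q` and exponent `e` at the
type `t` of its starting point. -/
def Vanishes (q t : Fin 3) (e : ℤ) : Prop := t = q - 1 ∧ e = 1 ∨ t = q + 1 ∧ e = -1

theorem delta_sub_one (q p : Fin 3) : delta q p (q - 1) = 1 := by simp [delta]

theorem delta_add_one (q p : Fin 3) : delta q p (q + 1) = 0 := by
  obtain ⟨a1, a2, a3, a4, a5, a6⟩ := fin3_ne q
  simp [delta, a2, a3]

theorem delta_zero_or_one (q p τ : Fin 3) : delta q p τ = 0 ∧ τ ≠ q - 1 ∨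
    delta q p τ = 1 ∧ τ ≠ q + 1 := by
  obtain ⟨a1, a2, a3, a4, a5, a6⟩ := fin3_ne q
  unfold delta
  split_ifs with h
  · right
    rcases h with rfl | ⟨rfl, -⟩ <;> simp [a6, a5]
  · exact .inl ⟨rfl, fun h' => h (.inl h')⟩

theorem Vanishes.eq_third (hM : ∀ l, 3 ≤ M l) {q t τ : Fin 3} {e : ℤ} (h : Vanishes q t e)
    (hr : Rel M q e t τ) : τ = third q t := by
  rcases h with ⟨rfl, rfl⟩ | ⟨rfl, rfl⟩
  · rw [hr.unique hM (rel_arc q)]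
    exact (by decide : ∀ q : Fin 3, q + 1 = third q (q - 1)) q
  · rw [hr.unique hM (rel_arc q).symm]
    exact (by decide : ∀ q : Fin 3, q - 1 = third q (q + 1)) q

theorem vanishes_iff (hM : ∀ l, 3 ≤ M l) {q t τ : Fin 3} {e : ℤ} (hr : Rel M q e t τ) (he : e ≠ 0)
    (p p' : Fin 3) : e + delta q p' τ - delta q p t = 0 ↔ Vanishes q t e := by
  constructor
  · intro h
    rcases delta_zero_or_one q p' τ with ⟨h1, h2⟩ | ⟨h1, h2⟩ <;>
      rcases delta_zero_or_one q p t with ⟨h3, h4⟩ | ⟨h3, h4⟩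
    · omega
    · obtain rfl : e = 1 := by omega
      left
      rcases fin3_cases q t with h5 | h5 | rfl
      · exact ⟨h5, rfl⟩
      · exact absurd h5 h4
      · exact absurd (rel_one_middle hM hr) h2
    · obtain rfl : e = -1 := by omega
      right
      rcases fin3_cases q t with h5 | h5 | rfl
      · exact absurd h5 h4
      · exact ⟨h5, rfl⟩
      · rcases fin3_cases t τ with rfl | rfl | rfl
        · exact absurd (hr.symm.unique hM (rel_arc t)) (fin3_ne t).2.2.2.2.1
        · exact absurd rfl h2
        · exact absurd (rel_one_middle hM hr.symm) (fin3_ne τ).2.2.2.1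
    · omega
  · rintro (⟨rfl, rfl⟩ | ⟨rfl, rfl⟩)
    · rw [hr.unique hM (rel_arc q), delta_sub_one, delta_add_one]; rfl
    · rw [hr.unique hM (rel_arc q).symm, delta_sub_one, delta_add_one]; rfl

theorem Vanishes.neg (hM : ∀ l, 3 ≤ M l) {q t τ : Fin 3} {e : ℤ} (h : Vanishes q t e)
    (hr : Rel M q e t τ) : Vanishes q τ (-e) := by
  rcases h with ⟨rfl, rfl⟩ | ⟨rfl, rfl⟩
  · exact .inr ⟨hr.unique hM (rel_arc q), rfl⟩
  · exact .inl ⟨hr.unique hM (rel_arc q).symm, rfl⟩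

theorem Vanishes.ne {q t : Fin 3} {e : ℤ} (h : Vanishes q t e) : t ≠ q := by
  rcases h with ⟨rfl, -⟩ | ⟨rfl, -⟩
  · exact (fin3_ne q).1
  · exact (fin3_ne q).2.1

end Vanishing

section Transport

variable {G : Type*} [Group G] {g : Fin 3 → G} {M : Fin 3 → ℕ}

/-- The word between the two transports of a corner. -/
def tip (p q τ : Fin 3) : FreeGroup (Fin 3) := if τ = third p q then of τ ^ tipExp p q else 1

theorem tipExp_ne_zero (p q : Fin 3) : tipExp p q ≠ 0 := by unfold tipExp; split_ifs <;> simp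

theorem letterHom_tip {p q : Fin 3} (hpq : p ≠ q) (τ : Fin 3) :
    letterHom g (tip p q τ) = (port g p q τ)⁻¹ * port g q p τ := by
  unfold tip
  split_ifs with h
  · rw [letterHom_zpow, eq_inv_mul_iff_mul_eq, h, port_third g hpq]
  · rw [map_one, port_comm g hpq h, inv_mul_cancel]

theorem rel_mem (T : TriangleSplitting M g) {l : Fin 3} {e : ℤ} {σ τ : Fin 3}
    (h : Rel M l e σ τ) : (rep g σ)⁻¹ * letter g l ^ e * rep g τ ∈ letterGroup g := by
  have h1 := port_mul_zpow T.three_le T.artinRel h l l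
  have h2 := port_mem g l l σ
  have h3 := port_mem g l l τ
  have := mul_mem (mul_mem h2 (letter_zpow_mem g l (e + delta l l τ - delta l l σ))) (inv_mem h3)
  convert this using 1
  rw [mul_assoc _ (port g l l σ), h1]
  group

theorem third_facts : ∀ p q t : Fin 3, p ≠ q → third p q ≠ p ∧ third p q ≠ q ∧
    third q p = third p q ∧ third p (third p q) = q ∧ third q (third p q) = p ∧
    (t = p ∨ t = q ∨ t = third p q) := by decide

/-- Transport of a half-axis: the word read along the transport starts with the same letter,
unless its first line vanishes. -/
theorem exists_transport (T : TriangleSplitting M g) (n : ℕ) :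
    ∀ {f f₁ : FreeGroup (Fin 3)} {p q r q' t σ : Fin 3} {e : ℤ}, FreeGroup.norm f = n →
      f = of q ^ e * f₁ → ¬ First f₁ q → e ≠ 0 → p ≠ q → First f⁻¹ r → r ≠ q' →
      (rep g t)⁻¹ * letterHom g f * rep g σ ∈ letterGroup g →
      ∃ f', letterHom g f' = (port g q p t)⁻¹ * letterHom g f * port g q' r σ ∧
        (¬ Vanishes q t e → First f' q) ∧ (Vanishes q t e → ∀ z, First f' z → z = third q t) := by
  induction n using Nat.strong_induction_on with
  | _ n ih =>
  rintro f f₁ p q r q' t σ e rfl hf hf₁ he hpq hr hq' hm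
  obtain ⟨τ, hτ⟩ := T.exists_rel hf₁ (hf ▸ hm)
  have hm₁ : (rep g τ)⁻¹ * letterHom g f₁ * rep g σ ∈ letterGroup g := by
    have := mul_mem (inv_mem (rel_mem T hτ)) hm
    convert this using 1
    rw [hf, map_mul, letterHom_zpow]
    group
  -- it suffices to study what follows the transport of the first line
  suffices H : ∃ (q₂ : Fin 3) (X : FreeGroup (Fin 3)), q₂ ≠ q ∧
      letterHom g X = (port g q q₂ τ)⁻¹ * letterHom g f₁ * port g q' r σ ∧ ¬ First X q ∧
      (Vanishes q t e → ∀ z, First X z → z = τ) by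
    obtain ⟨q₂, X, hq₂, hX, hXq, hXv⟩ := H
    refine ⟨of q ^ (e + delta q q₂ τ - delta q p t) * X, ?_, fun hv => ?_, fun hv => ?_⟩
    · have := port_mul_zpow T.three_le T.artinRel hτ p q₂
      rw [map_mul, letterHom_zpow, hX, hf, map_mul, letterHom_zpow,
        eq_inv_mul_iff_mul_eq.2 this]
      group
    · refine first_zpow_mul hXq fun h0 => hv ((vanishes_iff T.three_le hτ he p q₂).1 h0)
    · rw [(vanishes_iff T.three_le hτ he p q₂).2 hv, zpow_zero, one_mul, ← hv.eq_third T.three_le hτ]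
      exact hXv hv
  by_cases h1 : f₁ = 1
  · subst h1
    rw [mul_one] at hf
    obtain rfl : r = q := by
      rw [hf, ← zpow_neg] at hr
      exact hr.unique (first_zpow (neg_ne_zero.2 he))
    obtain rfl : τ = σ := by
      rw [map_one, mul_one] at hm₁
      exact T.rep_injective hm₁
    refine ⟨q', tip r q' τ, hq'.symm, by rw [letterHom_tip hq', map_one, mul_one], ?_, ?_⟩
    · unfold tip
      split_ifs with h
      · intro h'
        have := h'.unique (first_zpow (tipExp_ne_zero r q'))
        exact (third_facts r q' 0 hq').1 (h.symm.trans this.symm)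
      · exact not_first_one r
    · intro _ z hz
      unfold tip at hz
      split_ifs at hz with h
      · exact hz.unique (first_zpow (tipExp_ne_zero r q'))
      · exact absurd hz (not_first_one z)
  · obtain ⟨q₂, hq₂⟩ := exists_first h1
    have hne : q ≠ q₂ := fun h => hf₁ (h ▸ hq₂)
    obtain ⟨e₂, f₂, he₂, hf₂, hf₂', -⟩ := hq₂.exists_zpow_mul
    have hu : First (of q ^ e)⁻¹ q := by
      rw [← zpow_neg]
      exact first_zpow (neg_ne_zero.2 he)
    have hnorm := FreeGroup.norm_mul_of_ne hu hq₂ hne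
    have hr₁ : First f₁⁻¹ r := by
      obtain ⟨z, hz⟩ := exists_first (inv_ne_one.2 h1)
      have := hz.mul_of_ne (by rwa [inv_inv]) hu hne.symm
      rw [← mul_inv_rev, ← hf] at this
      rwa [← this.unique hr]
    have hlt : FreeGroup.norm f₁ < FreeGroup.norm f := by
      rw [hf, hnorm]
      have : FreeGroup.norm (of q ^ e) ≠ 0 := fun h =>
        (first_zpow he).ne_one (FreeGroup.norm_eq_zero.1 h)
      omega
    obtain ⟨f', hf', hf'v, hf'n⟩ := ih _ hlt rfl hf₂ hf₂' he₂ hne hr₁ hq' hm₁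
    obtain ⟨b1, b2, b3, b4, b5, b6⟩ := third_facts q q₂ τ hne
    refine ⟨q₂, tip q q₂ τ * f', hne.symm, ?_, ?_⟩
    · rw [map_mul, letterHom_tip hne, hf']
      group
    by_cases hs : τ = third q q₂
    · have hfirst : First (tip q q₂ τ * f') τ := by
        unfold tip
        rw [if_pos hs]
        refine first_zpow_mul (fun h => ?_) (tipExp_ne_zero q q₂)
        by_cases hv : Vanishes q₂ τ e₂
        · have := hf'n hv _ h
          rw [hs, b5] at this
          exact b1 this
        · exact b2 (hs ▸ h.unique (hf'v hv))
      exact ⟨fun h => b1 (hs ▸ hfirst.unique h), fun _ z hz => hz.unique hfirst⟩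
    · have ht1 : tip q q₂ τ = 1 := if_neg hs
      rw [ht1, one_mul]
      by_cases hv : Vanishes q₂ τ e₂
      · have hτq : τ = q := by
          rcases b6 with h | h | h
          exacts [h, absurd h hv.ne, absurd h hs]
        refine ⟨fun h => ?_, fun hv' => ?_⟩
        · have := hf'n hv _ h
          rw [hτq] at this
          exact (third_facts q₂ q 0 hne.symm).2.1 this.symm
        · exact absurd hτq (hv'.neg T.three_le hτ).ne
      · refine ⟨fun h => hne (h.unique (hf'v hv)), fun hv' z hz => ?_⟩
        rcases b6 with h | h | h
        · exact absurd h (hv'.neg T.three_le hτ).ne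
        · rw [h]; exact hz.unique (hf'v hv)
        · exact absurd h hs

end Transport
/-! ### Corners of axes -/

section Corners

variable {G : Type*} [Group G] {g : Fin 3 → G} {M : Fin 3 → ℕ}

variable (g) in
/-- The axis of `γ` in the vertex of `h` turns at `h` from a line of letter `p` into a line of
letter `q`: the word that represents `γ`, read from `h`, begins with `q` and ends with `p`, so that
it is cyclically reduced. -/
def Corner (γ h : G) (p q : Fin 3) : Prop :=
  p ≠ q ∧ ∃ f, letterHom g f = h⁻¹ * γ * h ∧ First f q ∧ First f⁻¹ p

variable (g) in
/-- The word of `γ`, read from `h`, begins with the syllable `e` of the letter `q`. -/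
def Outgoing (γ h : G) (q : Fin 3) (e : ℤ) : Prop :=
  e ≠ 0 ∧ ∃ f, ¬ First f q ∧ letterHom g (of q ^ e * f) = h⁻¹ * γ * h

theorem Corner.symm {γ h : G} {p q : Fin 3} (hc : Corner g γ h p q) : Corner g γ⁻¹ h q p := by
  obtain ⟨hpq, f, hf, h1, h2⟩ := hc
  exact ⟨hpq.symm, f⁻¹, by rw [map_inv, hf]; group, h2, by rwa [inv_inv]⟩

theorem Corner.exists_outgoing {γ h : G} {p q : Fin 3} (hc : Corner g γ h p q) :
    ∃ e, Outgoing g γ h q e := by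
  obtain ⟨-, f, hf, h1, -⟩ := hc
  obtain ⟨e, f', he, rfl, hf', -⟩ := h1.exists_zpow_mul
  exact ⟨e, he, f', hf', hf⟩

/-- Since the vertex group is free, the word of the definition of a corner is unique. -/
theorem Corner.first_eq (T : TriangleSplitting M g) {γ h : G} {p q : Fin 3}
    (hc : Corner g γ h p q) {f : FreeGroup (Fin 3)} (hf : letterHom g f = h⁻¹ * γ * h) :
    First f q ∧ First f⁻¹ p := by
  obtain ⟨-, f', hf', h1, h2⟩ := hc
  rw [T.injective (hf.trans hf'.symm)]
  exact ⟨h1, h2⟩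

theorem Corner.unique (T : TriangleSplitting M g) {γ h : G} {p q p' q' : Fin 3}
    (hc : Corner g γ h p q) (hc' : Corner g γ h p' q') : p = p' ∧ q = q' := by
  obtain ⟨-, f, hf, h1, h2⟩ := hc
  obtain ⟨h3, h4⟩ := hc'.first_eq T hf
  exact ⟨h2.unique h4, h1.unique h3⟩

theorem Corner.ne_one {γ h : G} {p q : Fin 3} (T : TriangleSplitting M g)
    (hc : Corner g γ h p q) : γ ≠ 1 := by
  rintro rfl
  obtain ⟨h1, -⟩ := hc.first_eq (f := 1) T (by simp)
  exact not_first_one _ h1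

theorem Corner.conj {γ h : G} {p q : Fin 3} (hc : Corner g γ h p q) (k : G) :
    Corner g (k * γ * k⁻¹) (k * h) p q := by
  obtain ⟨hpq, f, hf, h⟩ := hc
  exact ⟨hpq, f, by rw [hf]; group, h⟩

/-- A line that ends at a corner is read from its starting point. -/
theorem Corner.outgoing {γ h : G} {l b : Fin 3} {e : ℤ} (hc : Corner g γ (h * letter g l ^ e) l b)
    (he : e ≠ 0) : Outgoing g γ h l e := by
  obtain ⟨hlb, f, hf, h1, -⟩ := hc
  refine ⟨he, f * of l ^ (-e), fun h => hlb ?_, ?_⟩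
  · exact h.unique (h1.mul_zpow hlb.symm (-e))
  · rw [map_mul, map_mul, letterHom_zpow, letterHom_zpow, hf]
    group

/-- A reading of a product without cancellation passes through a type in between. -/
theorem exists_type_of_mul (T : TriangleSplitting M g) (n : ℕ) :
    ∀ {f₁ f₂ : FreeGroup (Fin 3)} {σ τ : Fin 3}, norm f₁ = n →
      (∀ z, First f₁⁻¹ z → ¬ First f₂ z) →
      (rep g σ)⁻¹ * letterHom g (f₁ * f₂) * rep g τ ∈ letterGroup g →
      ∃ ρ, (rep g σ)⁻¹ * letterHom g f₁ * rep g ρ ∈ letterGroup g := by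
  induction n using Nat.strong_induction_on with
  | _ n ih =>
  rintro f₁ f₂ σ τ rfl hne hm
  by_cases h1 : f₁ = 1
  · exact ⟨σ, by simp [h1, one_mem]⟩
  obtain ⟨q, hq⟩ := exists_first h1
  obtain ⟨e, f, he, rfl, hf, hlt⟩ := hq.exists_zpow_mul
  have hend : f ≠ 1 → ∀ z, First f⁻¹ z → First (of q ^ e * f)⁻¹ z := by
    intro hf1 z hz
    obtain ⟨r, hr⟩ := exists_first hf1
    rw [mul_inv_rev, ← zpow_neg]
    exact hz.mul_of_ne (by rwa [inv_inv]) (first_zpow (neg_ne_zero.2 he))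
      fun h => hf (h ▸ hr)
  have hq' : ¬ First (f * f₂) q := by
    intro h
    by_cases hf1 : f = 1
    · refine hne q ?_ (by simpa [hf1] using h)
      rw [hf1, mul_one, ← zpow_neg]
      exact first_zpow (neg_ne_zero.2 he)
    · obtain ⟨r, hr⟩ := exists_first hf1
      obtain ⟨z, hz⟩ := exists_first (inv_ne_one.2 hf1)
      by_cases hf2 : f₂ = 1
      · exact hf (by simpa [hf2] using h)
      · obtain ⟨y, hy⟩ := exists_first hf2
        have := hr.mul_of_ne hz hy fun hzy => hne z (hend hf1 z hz) (hzy ▸ hy)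
        exact hf (this.unique h ▸ hr)
  rw [mul_assoc (of q ^ e)] at hm
  obtain ⟨τ', hτ'⟩ := T.exists_rel hq' hm
  have h2 := rel_mem T hτ'
  obtain ⟨ρ, hρ⟩ := ih _ hlt (f₁ := f) (f₂ := f₂) (σ := τ') (τ := τ) rfl (by
    intro z hz
    exact hne z (hend (fun h => by rw [h, inv_one] at hz; exact not_first_one z hz) z hz)) (by
    have := mul_mem (inv_mem h2) hm
    convert this using 1
    rw [map_mul _ (of q ^ e), letterHom_zpow]
    group)
  refine ⟨ρ, ?_⟩
  have := mul_mem h2 hρ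
  convert this using 1
  rw [map_mul, letterHom_zpow]
  group

theorem smul_coe_eq_iff {γ h : G} :
    γ • (h : G ⧸ letterGroup g) = (h : G ⧸ letterGroup g) ↔ h⁻¹ * γ * h ∈ letterGroup g := by
  rw [MulAction.Quotient.smul_coe, eq_comm, QuotientGroup.eq, smul_eq_mul, mul_assoc]

theorem Lab.mem {γ h : G} {w : G ⧸ letterGroup g} {t : Fin 3} (hl : Lab g h w t)
    (hw : γ • w = w) : (rep g t)⁻¹ * (h⁻¹ * γ * h) * rep g t ∈ letterGroup g := by
  rw [hl, smul_coe_eq_iff] at hw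
  convert hw using 1
  group

theorem Lab.unique (T : TriangleSplitting M g) {h : G} {w : G ⧸ letterGroup g} {t t' : Fin 3}
    (hl : Lab g h w t) (hl' : Lab g h w t') : t = t' := by
  apply T.rep_injective
  have := QuotientGroup.eq.1 (hl.symm.trans hl')
  convert this using 1
  group

/-- A neighbour that is fixed by `γ` is seen from every corner of `γ`. -/
theorem Corner.exists_lab {γ h : G} {p q : Fin 3} (T : TriangleSplitting M g)
    (hc : Corner g γ h p q) {w : G ⧸ letterGroup g} (hw : γ • w = w)
    (ha : TreeAdj g (h : G ⧸ letterGroup g) w) : ∃ τ, Lab g h w τ := by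
  obtain ⟨h', τ, hh, hl⟩ := ha
  obtain ⟨a, ha⟩ := QuotientGroup.eq.1 hh
  obtain ⟨hpq, f, hf, h1, h2⟩ := hc
  obtain rfl : h' = h * letterHom g a := by rw [ha]; group
  obtain ⟨p1, p2, p3⟩ := FreeGroup.First.pow_of_ne hpq h1 h2 (norm a)
  set j := norm a + 1 with hj
  have q1 : First (f ^ j * a) q := by
    rcases p1.mul_or_norm_le a with h | h
    · exact h
    · omega
  have q2 : First ((f ^ j)⁻¹ * a) p := by
    rcases p2.mul_or_norm_le a with h | h
    · exact h
    · rw [FreeGroup.norm_inv_eq] at h; omega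
  have hγ : ∀ n : ℕ, (γ ^ n) • w = w := by
    intro n
    induction n with
    | zero => simp
    | succ n ih => rw [pow_succ, mul_smul, hw, ih]
  have hfn : ∀ n : ℕ, letterHom g (f ^ n) = h⁻¹ * γ ^ n * h := by
    intro n
    rw [map_pow, hf]
    simpa using conj_pow (a := h⁻¹) (b := γ) (i := n)
  have hm := hl.mem (hγ (j + j))
  obtain ⟨ρ, hρ⟩ := exists_type_of_mul T _ (f₁ := a⁻¹ * f ^ j) (f₂ := f ^ j * a) (σ := τ) (τ := τ)
    rfl (by
      intro z hz hz'
      rw [mul_inv_rev, inv_inv] at hz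
      exact hpq ((q2.unique hz).trans (hz'.unique q1))) (by
      clear_value j
      convert hm using 1
      rw [map_mul, map_mul, map_mul, map_inv, hfn, pow_add]
      group)
  refine ⟨ρ, ?_⟩
  unfold Lab at hl ⊢
  rw [← inv_smul_eq_iff.2 (hγ j).symm, hl, MulAction.Quotient.smul_coe, QuotientGroup.eq]
  convert hρ using 1
  rw [map_mul, map_inv, hfn, smul_eq_mul]
  group

instance (q t : Fin 3) (e : ℤ) : Decidable (Vanishes q t e) := by
  unfold Vanishes; infer_instance

/-- The letter with which the transport of a half-axis begins. -/
def startLetter (q t : Fin 3) (e : ℤ) : Fin 3 := if Vanishes q t e then third q t else q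

theorem Corner.exists_first_transport {γ h : G} {p q : Fin 3} (T : TriangleSplitting M g)
    (hc : Corner g γ h p q) {w : G ⧸ letterGroup g} {t : Fin 3} (hl : Lab g h w t)
    (hw : γ • w = w) {e : ℤ} (he : Outgoing g γ h q e) :
    ∃ f, letterHom g f = (h * port g q p t)⁻¹ * γ * (h * port g q p t) ∧
      First f (startLetter q t e) := by
  have hne := hc.ne_one T
  obtain ⟨he, f, hf, h1⟩ := he
  obtain ⟨-, h2⟩ := hc.first_eq T h1
  have hm := hl.mem hw
  rw [← h1] at hm
  obtain ⟨f', hf', h3, h4⟩ := exists_transport T _ rfl rfl hf he hc.1 h2 hc.1 hm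
  refine ⟨f', by rw [hf', h1]; group, ?_⟩
  unfold startLetter
  split_ifs with hv
  · have hf1 : f' ≠ 1 := by
      rintro rfl
      rw [map_one, h1] at hf'
      apply hne
      have : γ = h * port g q p t * ((port g q p t)⁻¹ * (h⁻¹ * γ * h) * port g q p t) *
        (h * port g q p t)⁻¹ := by group
      rw [this, ← hf']; group
    obtain ⟨z, hz⟩ := exists_first hf1
    exact h4 hv z hz ▸ hz
  · exact h3 hv

theorem startLetter_cases (q t : Fin 3) (e : ℤ) :
    startLetter q t e = q ∨ (t ≠ q ∧ startLetter q t e = third q t) := by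
  unfold startLetter
  split_ifs with h
  · exact .inr ⟨h.ne, rfl⟩
  · exact .inl rfl

/-- The letter of the line that enters a transported corner. -/
def enterLetter (p q t : Fin 3) (e : ℤ) : Fin 3 :=
  if t = third p q then t else startLetter p t e

theorem enterLetter_ne {p q t : Fin 3} (hpq : p ≠ q) (e e₀ : ℤ) :
    enterLetter p q t e₀ ≠ startLetter q t e := by
  obtain ⟨b1, b2, b3, b4, b5, b6⟩ := third_facts p q t hpq
  unfold enterLetter
  split_ifs with h
  · subst h
    rcases startLetter_cases q (third p q) e with h1 | ⟨-, h1⟩ <;> rw [h1]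
    · exact b2
    · rw [b5]; exact b1
  · rcases b6 with rfl | rfl | h'
    · have : startLetter t t e₀ = t := by
        rcases startLetter_cases t t e₀ with h1 | ⟨h1, -⟩
        exacts [h1, absurd rfl h1]
      rw [this]
      rcases startLetter_cases q t e with h1 | ⟨-, h1⟩ <;> rw [h1]
      · exact hpq
      · rw [b3]; exact b1.symm
    · have : startLetter t t e = t := by
        rcases startLetter_cases t t e with h1 | ⟨h1, -⟩
        exacts [h1, absurd rfl h1]
      rw [this]
      rcases startLetter_cases p t e₀ with h1 | ⟨-, h1⟩ <;> rw [h1]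
      · exact hpq
      · exact b2
    · exact absurd h' h

/-- The transport of a corner to an adjacent vertex. -/
theorem Corner.transport {γ h : G} {p q : Fin 3} (T : TriangleSplitting M g)
    (hc : Corner g γ h p q) {w : G ⧸ letterGroup g} {t : Fin 3} (hl : Lab g h w t)
    (hw : γ • w = w) {e e₀ : ℤ} (he : Outgoing g γ h q e) (he₀ : Outgoing g γ⁻¹ h p e₀) :
    Corner g γ (h * port g q p t) (enterLetter p q t e₀) (startLetter q t e) := by
  obtain ⟨f, hf, h1⟩ := hc.exists_first_transport T hl hw he
  obtain ⟨f', hf', h2⟩ := hc.symm.exists_first_transport T hl (inv_smul_eq_iff.2 hw.symm) he₀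
  refine ⟨enterLetter_ne hc.1 e e₀, f, hf, h1, ?_⟩
  have hk : letterHom g (tip p q t) = (h * port g p q t)⁻¹ * (h * port g q p t) := by
    rw [letterHom_tip hc.1]; group
  have : f⁻¹ = (tip p q t)⁻¹ * f' * tip p q t := by
    apply T.injective
    rw [map_mul, map_mul, map_inv, map_inv, hf, hf', hk]
    group
  rw [this]
  obtain ⟨b1, b2, b3, b4, b5, b6⟩ := third_facts p q t hc.1
  unfold enterLetter
  split_ifs with hs
  · rw [tip, if_pos hs, ← zpow_neg, mul_assoc]
    have hne : startLetter p t e₀ ≠ t := by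
      rcases startLetter_cases p t e₀ with h1 | ⟨-, h1⟩ <;> rw [h1, hs]
      · exact b1.symm
      · rw [b4]; exact b2.symm
    exact first_zpow_mul (fun h => hne ((h2.mul_zpow hne _).unique h))
      (neg_ne_zero.2 (tipExp_ne_zero p q))
  · rw [tip, if_neg hs, inv_one, one_mul, mul_one]
    exact h2

theorem Lab.back {h : G} {w : G ⧸ letterGroup g} {p q t : Fin 3} (hl : Lab g h w t)
    (hpq : p ≠ q) : w = ((h * port g q p t : G) : G ⧸ letterGroup g) ∧
      Lab g (h * port g q p t) (h : G ⧸ letterGroup g) (backType q p t) := by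
  constructor
  · rw [hl, QuotientGroup.eq]
    convert port_mem g q p t using 1
    group
  · unfold Lab
    rw [QuotientGroup.eq]
    convert port_mul_rep_mem g hpq t using 1
    group

theorem TreeAdj.symm {v w : G ⧸ letterGroup g} (h : TreeAdj g v w) : TreeAdj g w v := by
  obtain ⟨k, t, rfl, hl⟩ := h
  obtain ⟨h1, h2⟩ := hl.back (p := 1) (q := 0) (by decide)
  exact ⟨_, _, h1, h2⟩

/-- Types are transported along lines. -/
theorem Lab.move (T : TriangleSplitting M g) {h : G} {w : G ⧸ letterGroup g} {l e t τ}
    (hl : Lab g h w t) (hr : Rel M l e t τ) : Lab g (h * letter g l ^ e) w τ := by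
  unfold Lab at hl ⊢
  rw [hl, QuotientGroup.eq]
  convert rel_mem T hr using 1
  group

theorem Outgoing.exists_rel (T : TriangleSplitting M g) {γ h : G} {l : Fin 3} {e : ℤ}
    (ho : Outgoing g γ h l e) {w : G ⧸ letterGroup g} {t : Fin 3} (hl : Lab g h w t)
    (hw : γ • w = w) : ∃ τ, Rel M l e t τ := by
  obtain ⟨-, f, hf, h1⟩ := ho
  have hm := hl.mem hw
  rw [← h1] at hm
  exact T.exists_rel hf hm

end Corners
/-! ### Segments of axes and their combinatorial transport -/

/-- The labels of a triangle Artin group, as far as they are distinguished below. -/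
inductive LabelClass
  | three
  | four
  | large

/-- The class of a label. -/
def labelClass (m : ℕ) : LabelClass :=
  if m = 3 then .three else if m = 4 then .four else .large

/-- Whether `LabelClass.move` describes the effect of a line of exponent `e` on the types. -/
def LabelClass.IsKnown (e : ℤ) : LabelClass → Prop
  | .large => e = 1 ∨ e = -1
  | _ => True

instance (e : ℤ) (c : LabelClass) : Decidable (c.IsKnown e) := by
  cases c <;> unfold LabelClass.IsKnown <;> infer_instance

/-- The type at the end of a line of letter `l` and exponent `e`, if its type at the beginning is
`t`. -/
def LabelClass.move (l : Fin 3) (e : ℤ) (t : Fin 3) : LabelClass → Option (Fin 3)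
  | .three => match e % 3 with
    | 0 => some t
    | 1 => some (t + 2)
    | _ => some (t + 1)
  | .four => match e % 2 with
    | 0 => some t
    | _ => if t = l - 1 then some (l + 1) else if t = l + 1 then some (l - 1) else none
  | .large => if e = 1 ∧ t = l - 1 then some (l + 1) else
      if e = -1 ∧ t = l + 1 then some (l - 1) else none

/-- The distinction of the labels up to their class suffices to follow the types along the lines
for which `LabelClass.IsKnown` holds. -/
theorem Rel.move_eq {M : Fin 3 → ℕ} (hM : ∀ l, 3 ≤ M l) {l t τ : Fin 3} {e : ℤ}
    (h : Rel M l e t τ) (hk : (labelClass (M l)).IsKnown e) :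
    (labelClass (M l)).move l e t = some τ := by
  obtain ⟨a1, a2, a3, a4, a5, a6⟩ := fin3_ne l
  unfold labelClass at hk ⊢
  split_ifs at hk ⊢ with h3 h4
  · obtain ⟨-, k, rfl⟩ := h
    have he : ¬ Even (M l) := by rw [h3]; decide
    obtain ⟨e1, e2, e3, e4, e5⟩ := (by decide : ∀ l : Fin 3, l - 1 = l + 2 ∧ l + 1 + 2 = l ∧
      l - 1 + 2 = l + 1 ∧ l - 1 + 1 = l ∧ l + 1 + 1 = l - 1) l
    have hp : period M l = 3 := by simp [period, h3, show ¬ Even 3 by decide]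
    have hpos : ∀ σ, (σ = l - 1 ∧ position M l σ = 0) ∨ (σ = l + 1 ∧ position M l σ = 1) ∨
        (σ = l ∧ position M l σ = 2) := by
      intro σ
      rcases fin3_cases l σ with rfl | rfl | rfl
      · simp [position]
      · simp [position, a3]
      · simp [position, a4, a5, h3, show ¬ Even 3 by decide]
    unfold LabelClass.move
    rw [hp]
    rcases hpos t with ⟨ht, h1⟩ | ⟨ht, h1⟩ | ⟨ht, h1⟩ <;>
      rcases hpos τ with ⟨hτ, h2⟩ | ⟨hτ, h2⟩ | ⟨hτ, h2⟩ <;> rw [h1, h2, ht, hτ]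
    · rw [show (k * 3 + 0 - 0 : ℤ) % 3 = 0 by omega]; rfl
    · rw [show (k * 3 + 1 - 0 : ℤ) % 3 = 1 by omega]; simp only [e3]
    · rw [show (k * 3 + 2 - 0 : ℤ) % 3 = 2 by omega]; simp only [e4]
    · rw [show (k * 3 + 0 - 1 : ℤ) % 3 = 2 by omega]; simp only [e5]
    · rw [show (k * 3 + 1 - 1 : ℤ) % 3 = 0 by omega]; rfl
    · rw [show (k * 3 + 2 - 1 : ℤ) % 3 = 1 by omega]; simp only [e2]
    · rw [show (k * 3 + 0 - 2 : ℤ) % 3 = 1 by omega]; simp only [e1]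
    · rw [show (k * 3 + 1 - 2 : ℤ) % 3 = 2 by omega]; rfl
    · rw [show (k * 3 + 2 - 2 : ℤ) % 3 = 0 by omega]; rfl
  · obtain ⟨hc, k, rfl⟩ := h
    have hp : period M l = 2 := by simp [period, h4, show Even 4 by decide]
    have hpos : ∀ σ, (σ = l - 1 ∧ position M l σ = 0 ∧ circle M l σ = false) ∨
        (σ = l + 1 ∧ position M l σ = 1 ∧ circle M l σ = false) ∨
        (σ = l ∧ position M l σ = 0 ∧ circle M l σ = true) := by
      intro σ
      rcases fin3_cases l σ with rfl | rfl | rfl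
      · simp [position, circle, a1]
      · simp [position, a3, circle, a2]
      · simp [position, circle, a4, a5, h4, show Even 4 by decide]
    unfold LabelClass.move
    rw [hp]
    rcases hpos t with ⟨ht, h1, h5⟩ | ⟨ht, h1, h5⟩ | ⟨ht, h1, h5⟩ <;>
      rcases hpos τ with ⟨hτ, h2, h6⟩ | ⟨hτ, h2, h6⟩ | ⟨hτ, h2, h6⟩ <;>
      rw [h5, h6] at hc <;> (try simp at hc) <;> rw [h1, h2, ht, hτ]
    · rw [show (k * 2 + 0 - 0 : ℤ) % 2 = 0 by omega]; rfl
    · rw [show (k * 2 + 1 - 0 : ℤ) % 2 = 1 by omega]; simp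
    · rw [show (k * 2 + 0 - 1 : ℤ) % 2 = 1 by omega]; simp [a3]
    · rw [show (k * 2 + 1 - 1 : ℤ) % 2 = 0 by omega]; rfl
    · rw [show (k * 2 + 0 - 0 : ℤ) % 2 = 0 by omega]; rfl
  · have key : ∀ t τ, Rel M l 1 t τ → t = l - 1 := by
      intro t τ h
      rcases fin3_cases l τ with rfl | rfl | rfl
      · obtain ⟨hc, k, hk⟩ := h
        rcases fin3_cases l t with rfl | rfl | rfl
        · rfl
        · exfalso
          simp only [position, a3, if_true, if_false] at hk
          obtain ⟨h1, -, h7, h2⟩ | ⟨h1, h5, h2⟩ := period_ge hM l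
          · have hd : period M l ∣ 2 := ⟨k, by linarith [mul_comm k (period M l)]⟩
            have := Int.le_of_dvd two_pos hd
            have := hM l
            omega
          · have hd : period M l ∣ 2 := ⟨k, by linarith [mul_comm k (period M l)]⟩
            have := Int.le_of_dvd two_pos hd
            omega
        · exfalso
          obtain ⟨h1, -, h7, h2⟩ | ⟨h1, h5, h2⟩ := period_ge hM t
          · simp [circle, h1, a1] at hc
          · simp only [position, a4, a5, h1, if_true, if_false] at hk
            have h6 : ((M t / 2 : ℕ) : ℤ) + 2 = k * period M t := by linarith
            have h8 : (2 : ℤ) ≤ (M t / 2 : ℕ) := by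
              have := hM t
              have : M t ≠ 4 := h4
              omega
            have hk1 : 0 < k := by
              by_contra hk0
              nlinarith
            have hk2 : k < 2 := by
              by_contra hk0
              nlinarith
            obtain rfl : k = 1 := by omega
            omega
      · have := h.symm.unique hM (rel_arc l).symm
        exact this
      · rcases fin3_cases τ t with rfl | rfl | rfl
        · rfl
        · have h1 := rel_one_middle (l := τ) (τ := τ - 1) hM
          exfalso
          obtain ⟨hc, k, hk⟩ := h
          obtain ⟨h1, -, h7, h2⟩ | ⟨h1, h5, h2⟩ := period_ge hM τ
          · simp [circle, h1, a2] at hc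
          · simp only [position, a3, a4, a5, h1, if_true, if_false] at hk
            have h6 : 1 - ((M τ / 2 : ℕ) : ℤ) = k * period M τ := by linarith
            have h8 : (2 : ℤ) ≤ (M τ / 2 : ℕ) := by
              have := hM τ
              have : M τ ≠ 4 := h4
              omega
            have hk1 : k < 0 := by
              by_contra hk0
              nlinarith
            nlinarith
        · exact absurd (rel_one_middle hM h) a4
    unfold LabelClass.move
    rcases hk with rfl | rfl
    · obtain rfl := key _ _ h
      rw [h.unique hM (rel_arc l)]
      simp
    · obtain rfl := key _ _ (by simpa using h.symm)
      have := (h.symm).unique hM (by simpa using rel_arc (M := M) l)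
      subst this
      simp

/-- A corner of a segment of an axis: the type of a distinguished neighbour, the letter of the
outgoing line, and the exponent of this line, which is meaningful if another corner follows. -/
abbrev Node : Type := Fin 3 × Fin 3 × ℤ

section Combinatorics

variable (cls : Fin 3 → LabelClass) (forb : Fin 3 → Bool)

/-- Add the line that is born at a corner whose third letter is the type. -/
def withTip (p q t : Fin 3) (L : List Node) : Option (List Node) :=
  if t = third p q then
    if forb t then none else some ((p, t, tipExp p q) :: L)
  else some L

/-- The transport, towards the neighbour that has type `t` at the first corner, of a segment that
is entered through a line of letter `p`. The result is `none` if no such transport exists. Letters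
with `forb` true are supposed neither to be born nor to vanish. -/
def stepSegment : Fin 3 → Fin 3 → List Node → Option (List Node)
  | _, _, [] => some []
  | p, t, [(s, q, _)] => if s = t then none else withTip forb p q t [(backType q p t, q, 0)]
  | p, t, (s, q, e) :: ((s', q', e') :: r) =>
    if s = t then none else
    if (cls q).IsKnown e then
      match (cls q).move q e t with
      | none => none
      | some τ =>
        match stepSegment q τ ((s', q', e') :: r) with
        | none => none
        | some rest =>
          if e + delta q q' τ - delta q p t = 0 then
            if forb q then none else withTip forb p q t rest
          else withTip forb p q t ((backType q p t, q, e + delta q q' τ - delta q p t) :: rest)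
    else withTip forb p q t [(backType q p t, q, 0)]

/-- The possible segments after a transport, which depend on whether the last line vanishes. -/
def lastVariants : Fin 3 → List Node → List (List Node)
  | _, [] => [[]]
  | p, [(s, q, e)] =>
    if s = q ∧ forb q = false then [[(s, q, e)], [(s, third p q, e)]] else [[(s, q, e)]]
  | _, (s, q, e) :: (n :: r) => (lastVariants q (n :: r)).map ((s, q, e) :: ·)

/-- The possible entrance letters after a transport, which depend on whether the line before the
segment vanishes. -/
def firstVariants : Fin 3 → List Node → List (Fin 3)
  | p, [] => [p]
  | p, (s, q, _) :: _ => if s = p ∧ forb p = false then [p, third p q] else [p]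

/-- The second segment is a beginning of the first one. -/
def hasPrefix : List Node → List Node → Bool
  | (s, q, e) :: r, (s', q', e') :: r' =>
    s = s' && q = q' && (r'.isEmpty || (e = e' && hasPrefix r r'))
  | _, _ => false

/-- The segment contains one of the segments of the list `db`. -/
def covered (db : List (Fin 3 × List Node)) : Fin 3 → List Node → Bool
  | _, [] => false
  | p, (s, q, e) :: r =>
    (db.any fun x => p = x.1 && hasPrefix ((s, q, e) :: r) x.2) || covered db q r

/-- After at most `n` transports, in whatever direction, the segment contains one of the segments
of the list `db`, or has no further transport. -/
def dead (db : List (Fin 3 × List Node)) : ℕ → Fin 3 → List Node → Bool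
  | 0, p, L => covered db p L
  | n + 1, p, L => covered db p L || [0, 1, 2].all fun t =>
    match stepSegment cls forb p t L with
    | none => true
    | some L' => (firstVariants forb p L').all fun p' =>
      (lastVariants forb p' L').all fun L'' => dead db n p' L''

/-- The segments around a newly born line of letter `l` are dead. -/
def tipDead (db : List (Fin 3 × List Node)) (n : ℕ) (l : Fin 3) : Bool :=
  [l - 1, l + 1].all fun s =>
    match stepSegment cls forb (l + 1) l [(s, l - 1, 0)] with
    | none => true
    | some L' => (firstVariants forb (l + 1) L').all fun p' =>
      (lastVariants forb p' L').all fun L'' => dead cls forb db n p' L''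

end Combinatorics

section Segments

variable {G : Type*} [Group G] {g : Fin 3 → G} {M : Fin 3 → ℕ}

variable (g) in
/-- The list describes consecutive corners of the axis of `γ`, of which `h` is the first one, with
respect to the neighbour `v`. -/
def IsSegment (γ : G) (v : G ⧸ letterGroup g) : Fin 3 → G → List Node → Prop
  | _, _, [] => False
  | p, h, (s, q, e) :: r => Corner g γ h p q ∧ Lab g h v s ∧
      (r = [] ∨ e ≠ 0 ∧ IsSegment γ v q (h * letter g q ^ e) r)

theorem IsSegment.of_hasPrefix {γ : G} {v : G ⧸ letterGroup g} {L : List Node} :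
    ∀ {p : Fin 3} {h : G} {L' : List Node}, IsSegment g γ v p h L → hasPrefix L L' →
      IsSegment g γ v p h L' := by
  induction L with
  | nil => intro p h L' hL; exact hL.elim
  | cons n r ih =>
    rintro p h (_ | ⟨n', r'⟩) hL hp
    · simp [hasPrefix] at hp
    obtain ⟨s, q, e⟩ := n
    obtain ⟨s', q', e'⟩ := n'
    simp only [hasPrefix, Bool.and_eq_true, decide_eq_true_eq, Bool.or_eq_true,
      List.isEmpty_iff] at hp
    obtain ⟨⟨rfl, rfl⟩, hp⟩ := hp
    obtain ⟨h1, h2, h3⟩ := hL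
    refine ⟨h1, h2, ?_⟩
    rcases hp with hp | ⟨rfl, hp⟩
    · exact .inl hp
    · rcases h3 with rfl | ⟨h3, h4⟩
      · simp [hasPrefix] at hp
      · exact .inr ⟨h3, ih h4 hp⟩

theorem coe_mul_zpow (h : G) (l : Fin 3) (e : ℤ) :
    ((h * letter g l ^ e : G) : G ⧸ letterGroup g) = h := by
  rw [eq_comm, QuotientGroup.eq]
  convert letter_zpow_mem g l e using 1
  group

theorem IsSegment.of_covered {γ : G} {v : G ⧸ letterGroup g} {db : List (Fin 3 × List Node)}
    {L : List Node} : ∀ {p : Fin 3} {h : G}, IsSegment g γ v p h L → covered db p L →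
      ∃ x ∈ db, ∃ h' : G, (h' : G ⧸ letterGroup g) = h ∧ IsSegment g γ v x.1 h' x.2 := by
  induction L with
  | nil => intro p h hL; exact hL.elim
  | cons n r ih =>
    obtain ⟨s, q, e⟩ := n
    intro p h hL hc
    simp only [covered, Bool.or_eq_true, List.any_eq_true, Bool.and_eq_true,
      decide_eq_true_eq] at hc
    rcases hc with ⟨x, hx, rfl, hp⟩ | hc
    · exact ⟨x, hx, h, rfl, hL.of_hasPrefix hp⟩
    · rcases hL.2.2 with rfl | ⟨-, h4⟩
      · simp [covered] at hc
      · obtain ⟨x, hx, h', hh', hs⟩ := ih h4 hc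
        exact ⟨x, hx, h', hh'.trans (coe_mul_zpow h q e), hs⟩

theorem enterLetter_of_ne {p q t : Fin 3} (hpq : p ≠ q) (ht : t ≠ q) (e₀ : ℤ) :
    enterLetter p q t e₀ = t := by
  unfold enterLetter
  split_ifs with h
  · rfl
  · rcases (third_facts p q t hpq).2.2.2.2.2 with rfl | h' | h'
    · rcases startLetter_cases t t e₀ with h1 | ⟨h1, -⟩
      exacts [h1, absurd rfl h1]
    · exact absurd h' ht
    · exact absurd h' h

variable {γ : G} {u v w : G ⧸ letterGroup g} {forb : Fin 3 → Bool}

/-- The transport of a segment begins with a newly born line if the type is the third letter of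
the first corner. -/
theorem IsSegment.exists_withTip (T : TriangleSplitting M g)
    (hS : ∀ (k : G) (p q : Fin 3), (k : G ⧸ letterGroup g) = u → Corner g γ k p q →
      Lab g k w (third p q) → forb (third p q) = false) (hw : γ • w = w)
    {h : G} {p q t : Fin 3} {e e₀ : ℤ} (hu : (h : G ⧸ letterGroup g) = u)
    (hc : Corner g γ h p q) (hl : Lab g h w t) (he : Outgoing g γ h q e)
    (he₀ : Outgoing g γ⁻¹ h p e₀) {R R' : List Node}
    (hR : R' ∈ lastVariants forb (enterLetter p q t e₀) R)
    (hR' : IsSegment g γ u (enterLetter p q t e₀) (h * port g q p t) R')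
    (hhead : t = q → ∃ s y, R = (p, q, s) :: y) (hV : t ≠ p → Vanishes p t e₀ → forb p = false) :
    ∃ L', withTip forb p q t R = some L' ∧ startLetter p t e₀ ∈ firstVariants forb p L' ∧
      ∃ L'' ∈ lastVariants forb (startLetter p t e₀) L',
        IsSegment g γ u (startLetter p t e₀) (h * port g p q t) L'' := by
  obtain ⟨b1, b2, b3, b4, b5, b6⟩ := third_facts p q t hc.1
  by_cases hs : t = third p q
  · have hf : forb t = false := hs ▸ hS h p q hu hc (hs ▸ hl)
    have hen : enterLetter p q t e₀ = t := if_pos hs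
    rw [hen] at hR hR'
    refine ⟨(p, t, tipExp p q) :: R, by simp [withTip, ← hs, hf], ?_,
      (p, t, tipExp p q) :: R', ?_, ?_, ?_, .inr ⟨tipExp_ne_zero p q, ?_⟩⟩
    · by_cases hv : Vanishes p t e₀
      · simp [firstVariants, startLetter, hv, hV hv.ne hv]
      · rw [startLetter, if_neg hv, firstVariants]
        split_ifs <;> simp
    · rcases R with _ | ⟨n, r⟩
      · simp only [lastVariants, List.mem_singleton] at hR
        subst hR
        exact hR'.elim
      · exact List.mem_map_of_mem hR
    · have := (hc.symm.transport T hl (inv_smul_eq_iff.2 hw.symm) he₀ (by rwa [inv_inv])).symm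
      rw [inv_inv, enterLetter, if_pos (by rw [b3]; exact hs)] at this
      exact this
    · have := (hl.back hc.1.symm).2
      rw [hu, backType, if_neg (by rw [hs]; exact b1)] at this
      exact this
    · rw [hs, mul_assoc, port_third g hc.1, ← hs]
      exact hR'
  · have hen : enterLetter p q t e₀ = startLetter p t e₀ := if_neg hs
    rw [hen] at hR hR'
    refine ⟨R, if_neg hs, ?_, R', hR, by rwa [port_comm g hc.1 hs]⟩
    by_cases hv : Vanishes p t e₀
    · have htq : t = q := by
        rcases b6 with h1 | h1 | h1
        exacts [absurd h1 hv.ne, h1, absurd h1 hs]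
      obtain ⟨s, y, rfl⟩ := hhead htq
      rw [startLetter, if_pos hv, firstVariants, if_pos ⟨rfl, hV hv.ne hv⟩, htq]
      simp
    · have : startLetter p t e₀ = p := if_neg hv
      rw [this]
      unfold firstVariants
      split
      · simp
      · split_ifs <;> simp

/-- Soundness of `stepSegment`: a segment of the axis of `γ` at `u` with respect to the neighbour
`v` is transported to the neighbour `w` as the combinatorics says. The hypotheses on `forb` state
that no line of a forbidden letter is born, or vanishes, on the way from `u` to `w`. -/
theorem IsSegment.step (T : TriangleSplitting M g) (hvw : v ≠ w) (hw : γ • w = w)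
    (hS : ∀ (k : G) (p q : Fin 3), (k : G ⧸ letterGroup g) = u → Corner g γ k p q →
      Lab g k w (third p q) → forb (third p q) = false)
    (hV : ∀ (k : G) (p q t : Fin 3) (e : ℤ), (k : G ⧸ letterGroup g) = u → Corner g γ k p q →
      Outgoing g γ k q e → Lab g k w t → Vanishes q t e → forb q = false)
    (hV' : ∀ (k : G) (p q t : Fin 3) (e : ℤ), (k : G ⧸ letterGroup g) = u → Corner g γ⁻¹ k p q →
      Outgoing g γ⁻¹ k q e → Lab g k w t → Vanishes q t e → forb q = false)
    (r : List Node) : ∀ {s q : Fin 3} {e : ℤ} {p t : Fin 3} {h : G} {e₀ : ℤ},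
      (h : G ⧸ letterGroup g) = u → IsSegment g γ v p h ((s, q, e) :: r) → Lab g h w t →
      Outgoing g γ⁻¹ h p e₀ →
      ∃ L', stepSegment (fun l => labelClass (M l)) forb p t ((s, q, e) :: r) = some L' ∧
        startLetter p t e₀ ∈ firstVariants forb p L' ∧
        ∃ L'' ∈ lastVariants forb (startLetter p t e₀) L',
          IsSegment g γ u (startLetter p t e₀) (h * port g p q t) L'' := by
  have hne : ∀ {h : G} {s t : Fin 3}, Lab g h v s → Lab g h w t → s ≠ t := by
    rintro h s t h1 h2 rfl
    exact hvw (h1.trans h2.symm)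
  -- the transport of a single corner
  have cut : ∀ {h : G} {p q t : Fin 3} {e₀ : ℤ}, (h : G ⧸ letterGroup g) = u →
      Corner g γ h p q → Lab g h w t → Outgoing g γ⁻¹ h p e₀ →
      ∃ L', withTip forb p q t [(backType q p t, q, 0)] = some L' ∧
        startLetter p t e₀ ∈ firstVariants forb p L' ∧
        ∃ L'' ∈ lastVariants forb (startLetter p t e₀) L',
          IsSegment g γ u (startLetter p t e₀) (h * port g p q t) L'' := by
    intro h p q t e₀ hu hc hl he₀
    obtain ⟨e, he⟩ := hc.exists_outgoing
    refine exists_withTip T hS hw hu hc hl he he₀ (R' := [(backType q p t, startLetter q t e, 0)]) ?_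
      ⟨hc.transport T hl hw he he₀, hu ▸ (hl.back hc.1).2, .inl rfl⟩ ?_
      fun _ => hV' h q p t e₀ hu hc.symm he₀ hl
    · unfold lastVariants startLetter
      by_cases hv : Vanishes q t e
      · have hb : backType q p t = q := if_neg hv.ne
        have := (third_facts t q 0 hv.ne).2.2.1
        rw [if_pos hv, if_pos ⟨hb, hV h p q t e hu hc he hl hv⟩, enterLetter_of_ne hc.1 hv.ne,
          this]
        simp
      · rw [if_neg hv]
        split_ifs <;> simp
    · rintro rfl
      exact ⟨0, [], by simp [backType]⟩
  induction r with
  | nil =>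
    rintro s q e p t h e₀ hu ⟨hc, hv, -⟩ hl he₀
    obtain ⟨L', hL, hL'⟩ := cut hu hc hl he₀
    exact ⟨L', by rw [stepSegment, if_neg (hne hv hl), hL], hL'⟩
  | cons n r ih =>
    obtain ⟨s', q', e'⟩ := n
    rintro s q e p t h e₀ hu ⟨hc, hv, hr⟩ hl he₀
    rcases hr with hr | ⟨he, hr⟩
    · simp at hr
    rw [stepSegment, if_neg (hne hv hl)]
    by_cases hk : (labelClass (M q)).IsKnown e
    swap
    · rw [if_neg hk]
      exact cut hu hc hl he₀
    rw [if_pos hk]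
    have hc₁ := hr.1
    have ho : Outgoing g γ h q e := hc₁.outgoing he
    obtain ⟨τ, hτ⟩ := ho.exists_rel T hl hw
    have hu₁ : ((h * letter g q ^ e : G) : G ⧸ letterGroup g) = u := (coe_mul_zpow h q e).trans hu
    have ho₁ : Outgoing g γ⁻¹ (h * letter g q ^ e) q (-e) := by
      refine Corner.outgoing (b := p) ?_ (neg_ne_zero.2 he)
      rw [mul_assoc, ← zpow_add, add_neg_cancel, zpow_zero, mul_one]
      exact hc.symm
    obtain ⟨rest, h1, -, R', h2, h3⟩ := ih hu₁ hr (hl.move T hτ) ho₁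
    simp only [hτ.move_eq T.three_le hk, h1]
    have hport : h * letter g q ^ e * port g q q' τ =
        h * port g q p t * letter g q ^ (e + delta q q' τ - delta q p t) := by
      rw [mul_assoc, ← port_mul_zpow T.three_le T.artinRel hτ, ← mul_assoc]
    rw [hport] at h3
    have hz := vanishes_iff T.three_le hτ he p q'
    by_cases hv' : Vanishes q t e
    · have hst : startLetter q τ (-e) = t := by
        rw [startLetter, if_pos (hv'.neg T.three_le hτ), hv'.eq_third T.three_le hτ]
        exact (third_facts q t 0 hv'.ne.symm).2.2.2.1
      rw [if_pos (hz.2 hv'), hV h p q t e hu hc ho hl hv', if_neg Bool.false_ne_true]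
      rw [hst] at h2 h3
      rw [hz.2 hv', zpow_zero, mul_one] at h3
      have hen := enterLetter_of_ne hc.1 hv'.ne e₀
      exact exists_withTip T hS hw hu hc hl ho he₀ (by rwa [hen]) (by rwa [hen]) (fun h => absurd h hv'.ne)
        fun _ => hV' h q p t e₀ hu hc.symm he₀ hl
    · have hst : startLetter q τ (-e) = q := by
        refine if_neg fun hv => hv' ?_
        have := hv.neg T.three_le hτ.symm
        rwa [neg_neg] at this
      rw [if_neg (mt hz.1 hv')]
      rw [hst] at h2 h3
      refine exists_withTip T hS hw hu hc hl ho he₀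
        (R' := (backType q p t, q, e + delta q q' τ - delta q p t) :: R') ?_ ⟨?_, ?_, ?_⟩ ?_
        fun _ => hV' h q p t e₀ hu hc.symm he₀ hl
      · rcases rest with _ | ⟨n, rest⟩
        · simp only [lastVariants, List.mem_singleton] at h2
          subst h2
          exact h3.elim
        · exact List.mem_map_of_mem h2
      · have := hc.transport T hl hw ho he₀
        rwa [startLetter, if_neg hv'] at this
      · exact hu ▸ (hl.back hc.1).2
      · exact .inr ⟨mt hz.1 hv', h3⟩
      · rintro rfl
        exact ⟨_, _, by rw [backType, if_pos rfl]⟩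

end Segments
/-! ### No lines are born in the middle of a fixed path -/

section Paths

variable {G : Type*} [Group G] {g : Fin 3 → G} {M : Fin 3 → ℕ}

variable (g) in
/-- A path without backtracking that is fixed by `γ`. -/
def FixedPath (γ : G) (n : ℕ) (w : ℕ → G ⧸ letterGroup g) : Prop :=
  IsTreePath g n w ∧ ∀ i ≤ n, γ • w i = w i

theorem FixedPath.inv {γ : G} {n : ℕ} {w : ℕ → G ⧸ letterGroup g} (h : FixedPath g γ n w) :
    FixedPath g γ⁻¹ n w :=
  ⟨h.1, fun i hi => inv_smul_eq_iff.2 (h.2 i hi).symm⟩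

theorem FixedPath.reverse {γ : G} {n : ℕ} {w : ℕ → G ⧸ letterGroup g} (h : FixedPath g γ n w) :
    FixedPath g γ n fun i => w (n - i) := by
  refine ⟨⟨fun i hi => ?_, fun i hi => ?_⟩, fun i hi => h.2 _ (by omega)⟩
  · have := (h.1.1 (n - (i + 1)) (by omega)).symm
    rwa [show n - (i + 1) + 1 = n - i by omega] at this
  · have := (h.1.2 (n - (i + 2)) (by omega)).symm
    rwa [show n - (i + 2) + 2 = n - i by omega] at this

variable (g) in
/-- Along a fixed path, no line of letter `l` is born at distance at least `R` from the ends. -/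
def NoTip (R : ℕ) (l : Fin 3) : Prop :=
  ∀ ⦃γ : G⦄ ⦃n : ℕ⦄ ⦃w : ℕ → G ⧸ letterGroup g⦄, FixedPath g γ n w → ∀ ⦃i : ℕ⦄ ⦃h : G⦄
    ⦃p q : Fin 3⦄, R ≤ i → i + R ≤ n → i + 1 ≤ n → w i = (h : G ⧸ letterGroup g) →
    Corner g γ h p q → Lab g h (w (i + 1)) (third p q) → third p q ≠ l

theorem NoTip.mono {R R' : ℕ} {l : Fin 3} (h : NoTip g R l) (hR : R ≤ R') : NoTip g R' l :=
  fun _ _ _ hw _ _ _ _ h1 h2 h3 => h hw (by omega) (by omega) h3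

/-- Read backwards, a vanishing line is born. -/
theorem NoTip.not_vanishes (T : TriangleSplitting M g) {R : ℕ} {l : Fin 3} (hR : NoTip g R l)
    {γ : G} {n : ℕ} {w : ℕ → G ⧸ letterGroup g} (hw : FixedPath g γ n w) {i : ℕ} {h : G}
    {p q t : Fin 3} {e : ℤ} (h1 : R ≤ i + 1) (h2 : i + 1 + R ≤ n) (h3 : i + 1 ≤ n)
    (hi : w i = (h : G ⧸ letterGroup g)) (hc : Corner g γ h p q) (he : Outgoing g γ h q e)
    (hl : Lab g h (w (i + 1)) t) (hv : Vanishes q t e) : q ≠ l := by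
  obtain ⟨e₀, he₀⟩ := hc.symm.exists_outgoing
  have hc' := hc.transport T hl (hw.2 (i + 1) h3) he he₀
  rw [enterLetter_of_ne hc.1 hv.ne, startLetter, if_pos hv] at hc'
  obtain ⟨h4, h5⟩ := hl.back hc.1
  rw [backType, if_neg hv.ne, ← hi] at h5
  have h6 : third t (third q t) = q := by
    have := third_facts q t 0 hv.ne.symm
    exact this.2.2.2.2.1
  rw [← h6]
  refine hR hw.reverse (i := n - (i + 1)) (by omega) (by omega) (by omega) ?_ hc' ?_
  · rw [show n - (n - (i + 1)) = i + 1 by omega, h4]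
  · rw [show n - (n - (i + 1) + 1) = i by omega, h6]
    exact h5

variable (g) in
/-- The segment does not occur at distance at least `R + 1` from the beginning and at least
`N + R + 1` from the end of a fixed path. -/
def DeadSegment (R N : ℕ) (p : Fin 3) (L : List Node) : Prop :=
  ∀ ⦃γ : G⦄ ⦃n : ℕ⦄ ⦃w : ℕ → G ⧸ letterGroup g⦄, FixedPath g γ n w → ∀ ⦃i : ℕ⦄ ⦃h : G⦄,
    R + 1 ≤ i → i + N + R + 1 ≤ n → w i = (h : G ⧸ letterGroup g) →
    ¬ IsSegment g γ (w (i - 1)) p h L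

theorem DeadSegment.mono {R N N' : ℕ} {p : Fin 3} {L : List Node} (h : DeadSegment g R N p L)
    (hN : N ≤ N') : DeadSegment g R N' p L :=
  fun _ _ _ hw _ _ h1 h2 => h hw h1 (by omega)

/-- One step along a fixed path. -/
theorem IsSegment.exists_step (T : TriangleSplitting M g) {forb : Fin 3 → Bool} {R : ℕ}
    (hforb : ∀ l, forb l = true → NoTip g R l) {γ : G} {n : ℕ} {w : ℕ → G ⧸ letterGroup g}
    (hw : FixedPath g γ n w) {i : ℕ} {h : G} (h1 : R + 1 ≤ i) (h2 : i + R + 1 ≤ n)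
    (hi : w i = (h : G ⧸ letterGroup g)) {p : Fin 3} {L : List Node}
    (hL : IsSegment g γ (w (i - 1)) p h L) {t : Fin 3} (hl : Lab g h (w (i + 1)) t) :
    ∃ L', stepSegment (fun l => labelClass (M l)) forb p t L = some L' ∧
      ∃ p' ∈ firstVariants forb p L', ∃ L'' ∈ lastVariants forb p' L', ∃ h' : G,
        w (i + 1) = (h' : G ⧸ letterGroup g) ∧ IsSegment g γ (w i) p' h' L'' := by
  rcases L with _ | ⟨⟨s, q, e⟩, r⟩
  · exact hL.elim
  have hc := hL.1
  obtain ⟨e₀, he₀⟩ := hc.symm.exists_outgoing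
  have hfalse : ∀ l, (forb l = true → False) → forb l = false := fun l h =>
    Bool.eq_false_iff.2 h
  have hne : w (i - 1) ≠ w (i + 1) := by
    have := hw.1.2 (i - 1) (by omega)
    rwa [show i - 1 + 2 = i + 1 by omega] at this
  obtain ⟨L', h3, h4, L'', h5, h6⟩ := IsSegment.step T (forb := forb) hne (hw.2 (i + 1) (by omega))
    (u := w i) (fun k p q hk hc hl => hfalse _ fun hf =>
      hforb _ hf hw (by omega) (by omega) (by omega) hk.symm hc hl rfl)
    (fun k p q t e hk hc he hl hv => hfalse _ fun hf => NoTip.not_vanishes T (hforb _ hf) hw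
      (i := i) (by omega) (by omega) (by omega) hk.symm hc he hl hv rfl)
    (fun k p q t e hk hc he hl hv => hfalse _ fun hf => NoTip.not_vanishes T (hforb _ hf) hw.inv
      (i := i) (by omega) (by omega) (by omega) hk.symm hc he hl hv rfl)
    r hi.symm hL hl he₀
  exact ⟨L', h3, _, h4, L'', h5, _, (hl.back hc.1.symm).1, h6⟩

/-- Soundness of `dead`: as the path goes on, a dead segment is transported to one of the segments
of the list, or contradicts the absence of backtracking. -/
theorem deadSegment_of_dead (T : TriangleSplitting M g) {forb : Fin 3 → Bool} {R N : ℕ}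
    (hforb : ∀ l, forb l = true → NoTip g R l) {db : List (Fin 3 × List Node)}
    (hdb : ∀ x ∈ db, DeadSegment g R N x.1 x.2) (n : ℕ) : ∀ {p : Fin 3} {L : List Node},
      dead (fun l => labelClass (M l)) forb db n p L = true → DeadSegment g R (N + n) p L := by
  have hcov : ∀ {p : Fin 3} {L : List Node}, covered db p L = true → DeadSegment g R N p L := by
    intro p L hc γ m w hw i h h1 h2 hi hL
    obtain ⟨x, hx, h', hh', hs⟩ := hL.of_covered hc
    exact hdb x hx hw h1 h2 (hi.trans hh'.symm) hs
  induction n with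
  | zero =>
    intro p L hd
    exact hcov hd
  | succ n ih =>
    intro p L hd
    rw [dead, Bool.or_eq_true] at hd
    rcases hd with hd | hd
    · exact (hcov hd).mono (by omega)
    intro γ m w hw i h h1 h2 hi hL
    have hadj := hw.1.1 i (by omega)
    rw [hi] at hadj
    have hc : ∃ q, Corner g γ h p q := by
      rcases L with _ | ⟨⟨s, q, e⟩, r⟩
      · exact hL.elim
      · exact ⟨q, hL.1⟩
    obtain ⟨q, hc⟩ := hc
    obtain ⟨t, hl⟩ := hc.exists_lab T (hw.2 (i + 1) (by omega)) hadj
    have ht := (by decide : ∀ t : Fin 3, t ∈ [(0 : Fin 3), 1, 2]) t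
    obtain ⟨L', h3, p', hp', L'', hL'', h', hi', hs⟩ :=
      hL.exists_step T hforb hw h1 (by omega) hi hl
    have := List.all_eq_true.1 hd t ht
    rw [h3] at this
    have := List.all_eq_true.1 (List.all_eq_true.1 this p' hp') L'' hL''
    exact ih this hw (i := i + 1) (by omega) (by omega) hi' hs

/-- Soundness of `tipDead`. -/
theorem noTip_of_tipDead (T : TriangleSplitting M g) {forb : Fin 3 → Bool} {R N : ℕ}
    (hforb : ∀ l, forb l = true → NoTip g R l) {db : List (Fin 3 × List Node)}
    (hdb : ∀ x ∈ db, DeadSegment g R N x.1 x.2) (n : ℕ) {l : Fin 3}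
    (hd : tipDead (fun l => labelClass (M l)) forb db n l = true) :
    NoTip g (R + N + n + 2) l := by
  -- it suffices to consider one of the two orientations of the axis
  have key : ∀ {γ : G} {m : ℕ} {w : ℕ → G ⧸ letterGroup g}, FixedPath g γ m w → ∀ {i : ℕ} {h : G},
      R + N + n + 2 ≤ i → i + (R + N + n + 2) ≤ m → w i = (h : G ⧸ letterGroup g) →
      Corner g γ h (l + 1) (l - 1) → ¬ Lab g h (w (i + 1)) l := by
    intro γ m w hw i h h1 h2 hi hc hl
    have hadj := (hw.1.1 (i - 1) (by omega)).symm
    rw [show i - 1 + 1 = i by omega, hi] at hadj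
    obtain ⟨s, hs⟩ := hc.exists_lab T (hw.2 (i - 1) (by omega)) hadj
    have hsl : s ≠ l := by
      rintro rfl
      refine hw.1.2 (i - 1) (by omega) ?_
      rw [show i - 1 + 2 = i + 1 by omega]
      exact hs.trans hl.symm
    have ht : s ∈ [l - 1, l + 1] := by
      rcases fin3_cases l s with rfl | rfl | h
      · simp
      · simp
      · exact absurd h hsl
    have hL : IsSegment g γ (w (i - 1)) (l + 1) h [(s, l - 1, 0)] := ⟨hc, hs, .inl rfl⟩
    obtain ⟨L', h3, p', hp', L'', hL'', h', hi', hs⟩ :=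
      hL.exists_step T hforb hw (by omega) (by omega) hi hl
    have := List.all_eq_true.1 hd s ht
    rw [h3] at this
    have := List.all_eq_true.1 (List.all_eq_true.1 this p' hp') L'' hL''
    exact deadSegment_of_dead T hforb hdb n this hw (i := i + 1) (by omega) (by omega) hi' hs
  rintro γ m w hw i h p q h1 h2 - hi hc hl rfl
  rcases (by decide : ∀ p q : Fin 3, p ≠ q → (p = third p q + 1 ∧ q = third p q - 1) ∨
    (q = third p q + 1 ∧ p = third p q - 1)) p q hc.1 with ⟨h3, h4⟩ | ⟨h3, h4⟩
  · refine key hw h1 h2 hi ?_ hl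
    rwa [← h3, ← h4]
  · refine key hw.inv h1 h2 hi ?_ hl
    rw [← h3, ← h4]
    exact hc.symm

/-- Whether the class is that of the labels greater than `4`. -/
def LabelClass.isLarge : LabelClass → Bool
  | .large => true
  | _ => false

/-- Lines whose letters have large labels are not born; and if none of these vanishes, no lines are
born at all. The numbers `1` and `7` are numbers of transports after which all segments around a
newly born line have died out. -/
def allDead (c : Fin 3 → LabelClass) : Bool :=
  [0, 1, 2].all fun l =>
    if (c l).isLarge then tipDead c (fun _ => false) [] 1 l
    else tipDead c (fun l => (c l).isLarge) [] 7 l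

/-- For two labels `3` and one label `4`, at the letter `z`: some short segments that die out fast.
The first segments of the list are reduced to the later ones. -/
def shortSegments (z : Fin 3) : List (Fin 3 × List Node) :=
  [(z - 1, [(z, z, -2), (z, z + 1, 0)]),
    (z + 1, [(z + 1, z + 2, 1), (z, z, -2), (z, z + 2, 0)]),
    (z + 1, [(z + 1, z, -1), (z + 2, z + 2, 0)]),
    (z + 2, [(z + 1, z + 1, 2), (z + 2, z + 2, 2), (z, z, -2), (z, z + 2, 0)]),
    (z + 1, [(z, z, -2), (z, z + 1, 2), (z + 1, z + 2, 2), (z + 2, z + 1, 0)]),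
    (z + 1, [(z + 1, z + 2, 1), (z, z, -2), (z, z + 1, 1), (z + 2, z + 2, 0)])]

/-- Each segment of the list is reduced to the later ones. -/
def segmentsDead (c : Fin 3 → LabelClass) (n : ℕ) : List (Fin 3 × List Node) → Bool
  | [] => true
  | x :: r => dead c (fun _ => false) r n x.1 x.2 && segmentsDead c n r

/-- Lines of the letter `z` are not born; and if none of these vanishes, no lines are born at
all. The segments around a newly born line die out within `11` and `4` transports, respectively. -/
def allDeadAt (z : Fin 3) (c : Fin 3 → LabelClass) : Bool :=
  segmentsDead c 11 (shortSegments z) && tipDead c (fun _ => false) (shortSegments z) 11 z &&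
    tipDead c (fun l => l = z) [] 4 (z + 1) && tipDead c (fun l => l = z) [] 4 (z + 2)

theorem deadSegment_of_segmentsDead (T : TriangleSplitting M g) (n : ℕ)
    {db : List (Fin 3 × List Node)} (h : segmentsDead (fun l => labelClass (M l)) n db = true) :
    ∀ x ∈ db, DeadSegment g 0 (n * db.length) x.1 x.2 := by
  induction db with
  | nil => simp
  | cons x r ih =>
    rw [segmentsDead, Bool.and_eq_true] at h
    have ih := ih h.2
    intro y hy
    rcases List.mem_cons.1 hy with rfl | hy
    · have := deadSegment_of_dead T (by simp) ih n h.1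
      rwa [List.length_cons, mul_add, mul_one]
    · exact (ih y hy).mono (Nat.mul_le_mul_left n (by simp))

theorem exists_noTip_of_allDead (T : TriangleSplitting M g)
    (h : allDead (fun l => labelClass (M l)) = true) : ∃ R, ∀ l, NoTip g R l := by
  have h' : ∀ l, _ := fun l => List.all_eq_true.1 h l (by revert l; decide)
  have h1 : ∀ l, (labelClass (M l)).isLarge = true → NoTip g 3 l := by
    intro l hl
    have := h' l
    rw [if_pos hl] at this
    exact noTip_of_tipDead T (R := 0) (N := 0) (by simp) (by simp) 1 this
  refine ⟨12, fun l => ?_⟩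
  by_cases hl : (labelClass (M l)).isLarge = true
  · exact (h1 l hl).mono (by omega)
  · have := h' l
    rw [if_neg hl] at this
    exact noTip_of_tipDead T (N := 0) h1 (by simp) 7 this

theorem exists_noTip_of_allDeadAt (T : TriangleSplitting M g) (z : Fin 3)
    (h : allDeadAt z (fun l => labelClass (M l)) = true) : ∃ R, ∀ l, NoTip g R l := by
  rw [allDeadAt, Bool.and_eq_true, Bool.and_eq_true, Bool.and_eq_true] at h
  obtain ⟨⟨⟨h1, h2⟩, h3⟩, h4⟩ := h
  have hz := noTip_of_tipDead T (by simp) (deadSegment_of_segmentsDead T 11 h1) 11 h2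
  set R := 0 + 11 * (shortSegments z).length + 11 + 2
  have hforb : ∀ l, decide (l = z) = true → NoTip g R l := by
    intro l hl
    rw [of_decide_eq_true hl]
    exact hz
  refine ⟨R + 6, fun l => ?_⟩
  rcases (by decide : ∀ z l : Fin 3, l = z ∨ l = z + 1 ∨ l = z + 2) z l with rfl | rfl | rfl
  · exact hz.mono (by omega)
  · exact noTip_of_tipDead T (N := 0) hforb (by simp) 4 h3
  · exact noTip_of_tipDead T (N := 0) hforb (by simp) 4 h4

open LabelClass

theorem allDeadAt_four :
    allDeadAt 0 ![four, three, three] = true ∧ allDeadAt 1 ![three, four, three] = true ∧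
      allDeadAt 2 ![three, three, four] = true := by
  refine ⟨?_, ?_, ?_⟩ <;> decide +kernel

theorem allDead_of_not (c₀ c₁ c₂ : LabelClass)
    (h : match c₀, c₁, c₂ with
      | three, three, three => False
      | three, three, four | three, four, three | four, three, three => False
      | three, four, four | four, three, four | four, four, three => False
      | _, _, _ => True) : allDead ![c₀, c₁, c₂] = true := by
  cases c₀ <;> cases c₁ <;> cases c₂ <;> first | exact h.elim | decide +kernel

attribute [irreducible] allDead allDeadAt

theorem labelClass_spec (m : ℕ) : (m = 3 ∧ labelClass m = three) ∨ (m = 4 ∧ labelClass m = four) ∨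
    (m ≠ 3 ∧ m ≠ 4 ∧ labelClass m = large) := by
  unfold labelClass
  by_cases h3 : m = 3
  · simp [h3]
  · by_cases h4 : m = 4 <;> simp [h3, h4]

/-- Unless the labels are `3, 3, 3` or `3, 4, 4`, no line is born far from the ends of a fixed
path. -/
theorem exists_noTip (T : TriangleSplitting M g) (h₁ : ¬ ∀ l, M l = 3)
    (h₂ : ∀ l, ¬ (M l = 3 ∧ M (l + 1) = 4 ∧ M (l + 2) = 4)) : ∃ R, ∀ l, NoTip g R l := by
  have hM : (fun l => labelClass (M l)) =
      ![labelClass (M 0), labelClass (M 1), labelClass (M 2)] := by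
    funext l
    fin_cases l <;> rfl
  have h₁ : ¬ (M 0 = 3 ∧ M 1 = 3 ∧ M 2 = 3) := fun h => h₁ fun l => by
    fin_cases l
    exacts [h.1, h.2.1, h.2.2]
  have h₃ : ¬ (M 0 = 3 ∧ M 1 = 4 ∧ M 2 = 4) := h₂ 0
  have h₄ : ¬ (M 1 = 3 ∧ M 2 = 4 ∧ M 0 = 4) := h₂ 1
  have h₅ : ¬ (M 2 = 3 ∧ M 0 = 4 ∧ M 1 = 4) := h₂ 2
  obtain ⟨d0, d1, d2⟩ := allDeadAt_four
  rcases labelClass_spec (M 0) with ⟨a0, b0⟩ | ⟨a0, b0⟩ | ⟨a0, a0', b0⟩ <;>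
    rcases labelClass_spec (M 1) with ⟨a1, b1⟩ | ⟨a1, b1⟩ | ⟨a1, a1', b1⟩ <;>
    rcases labelClass_spec (M 2) with ⟨a2, b2⟩ | ⟨a2, b2⟩ | ⟨a2, a2', b2⟩ <;>
    rw [b0, b1, b2] at hM <;>
    first
    | exact (h₁ ⟨a0, a1, a2⟩).elim
    | exact (h₃ ⟨a0, a1, a2⟩).elim
    | exact (h₄ ⟨a1, a2, a0⟩).elim
    | exact (h₅ ⟨a2, a0, a1⟩).elim
    | exact exists_noTip_of_allDeadAt T 0 (by rw [hM]; exact d0)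
    | exact exists_noTip_of_allDeadAt T 1 (by rw [hM]; exact d1)
    | exact exists_noTip_of_allDeadAt T 2 (by rw [hM]; exact d2)
    | exact exists_noTip_of_allDead T (by rw [hM]; exact allDead_of_not _ _ _ trivial)

end Paths
/-! ### Straight paths -/

section Straight

variable {G : Type*} [Group G] {g : Fin 3 → G} {M : Fin 3 → ℕ} {R : ℕ}

/-- In the middle of a fixed path a corner is transported to a corner of the same letters. -/
theorem FixedPath.direct (T : TriangleSplitting M g) (hR : ∀ l, NoTip g R l) {γ : G} {n : ℕ}
    {w : ℕ → G ⧸ letterGroup g} (hw : FixedPath g γ n w) {i : ℕ} (h1 : R ≤ i) (h2 : i + R + 1 ≤ n)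
    {h : G} (hi : w i = (h : G ⧸ letterGroup g)) {p q t : Fin 3} (hc : Corner g γ h p q)
    (hl : Lab g h (w (i + 1)) t) : t ≠ third p q ∧ Corner g γ (h * port g q p t) p q := by
  have ht : t ≠ third p q := by
    rintro rfl
    exact hR _ hw h1 (by omega) (by omega) hi hc hl rfl
  refine ⟨ht, ?_⟩
  obtain ⟨e, he⟩ := hc.exists_outgoing
  obtain ⟨e₀, he₀⟩ := hc.symm.exists_outgoing
  have h3 : ¬ Vanishes q t e := fun hv =>
    (hR q).not_vanishes T hw (by omega) (by omega) (by omega) hi hc he hl hv rfl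
  have h4 : ¬ Vanishes p t e₀ := fun hv =>
    (hR p).not_vanishes T hw.inv (by omega) (by omega) (by omega) hi hc.symm he₀ hl hv rfl
  have := hc.transport T hl (hw.2 (i + 1) (by omega)) he he₀
  rwa [enterLetter, if_neg ht, startLetter, if_neg h4, startLetter, if_neg h3] at this

/-- In the middle of a fixed path the types are constant. -/
theorem FixedPath.lab_succ (T : TriangleSplitting M g) (hR : ∀ l, NoTip g R l) {γ : G} {n : ℕ}
    {w : ℕ → G ⧸ letterGroup g} (hw : FixedPath g γ n w) {i : ℕ} (h1 : R ≤ i) (h2 : i + R + 2 ≤ n)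
    {h : G} (hi : w i = (h : G ⧸ letterGroup g)) {p q t : Fin 3} (hc : Corner g γ h p q)
    (hl : Lab g h (w (i + 1)) t) : Lab g (h * port g q p t) (w (i + 2)) t := by
  obtain ⟨ht, hc'⟩ := hw.direct T hR h1 (by omega) hi hc hl
  obtain ⟨h3, h4⟩ := hl.back hc.1
  have hadj := hw.1.1 (i + 1) (by omega)
  rw [h3] at hadj
  obtain ⟨t', hl'⟩ := hc'.exists_lab T (hw.2 (i + 2) (by omega)) hadj
  obtain ⟨ht', -⟩ := hw.direct T hR (i := i + 1) (by omega) (by omega) h3 hc' hl'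
  have hb : t' ≠ backType q p t := by
    rintro rfl
    rw [← hi] at h4
    exact hw.1.2 i (by omega) (h4.trans hl'.symm)
  obtain rfl : t' = t := by
    have hb' : t' ≠ if t = q then p else q := hb
    exact (by decide : ∀ p q t t' : Fin 3, p ≠ q → t ≠ third p q → t' ≠ third p q →
      (t' ≠ if t = q then p else q) → t' = t) p q t t' hc.1 ht ht' hb'
  exact hl'

/-- In its middle, a fixed path is the orbit of a vertex under the conjugate of one port. -/
theorem FixedPath.pow (T : TriangleSplitting M g) (hR : ∀ l, NoTip g R l) {γ : G} {n : ℕ}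
    {w : ℕ → G ⧸ letterGroup g} (hw : FixedPath g γ n w) {i : ℕ} (h1 : R ≤ i)
    {h : G} (hi : w i = (h : G ⧸ letterGroup g)) {p q t : Fin 3} (hc : Corner g γ h p q)
    (hl : Lab g h (w (i + 1)) t) (j : ℕ) (hj : i + j + R + 1 ≤ n) :
    w (i + j) = ((h * port g q p t ^ j : G) : G ⧸ letterGroup g) ∧
      Corner g γ (h * port g q p t ^ j) p q ∧ Lab g (h * port g q p t ^ j) (w (i + j + 1)) t := by
  induction j with
  | zero => simpa using ⟨hi, hc, hl⟩
  | succ j ih =>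
    obtain ⟨h3, h4, h5⟩ := ih (by omega)
    rw [pow_succ, ← mul_assoc]
    exact ⟨(h5.back hc.1).1, (hw.direct T hR (by omega) (by omega) h3 h4 h5).2,
      hw.lab_succ T hR (by omega) (by omega) h3 h4 h5⟩

/-- In the middle of a fixed path, consecutive corners are moved by the same element of the
group. -/
theorem FixedPath.conj_port_eq (T : TriangleSplitting M g) (hR : ∀ l, NoTip g R l) {γ : G} {n : ℕ}
    {w : ℕ → G ⧸ letterGroup g} (hw : FixedPath g γ n w) {i : ℕ} (h1 : R ≤ i) (h2 : i + R + 2 ≤ n)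
    {h : G} (hi : w i = (h : G ⧸ letterGroup g)) {p q r t τ : Fin 3} {e : ℤ} (he : e ≠ 0)
    (hc : Corner g γ h p q) (hc₁ : Corner g γ (h * letter g q ^ e) q r)
    (hl : Lab g h (w (i + 1)) t) (hl₁ : Lab g (h * letter g q ^ e) (w (i + 1)) τ) :
    h * port g q p t * h⁻¹ =
      h * letter g q ^ e * port g r q τ * (h * letter g q ^ e)⁻¹ := by
  have hi₁ : w i = ((h * letter g q ^ e : G) : G ⧸ letterGroup g) := hi.trans (coe_mul_zpow h q e).symm
  obtain ⟨ht, hk⟩ := hw.direct T hR h1 (by omega) hi hc hl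
  obtain ⟨ht₁, hk₁⟩ := hw.direct T hR h1 (by omega) hi₁ hc₁ hl₁
  have hlk := hw.lab_succ T hR h1 h2 hi hc hl
  have hlk₁ := hw.lab_succ T hR h1 h2 hi₁ hc₁ hl₁
  obtain ⟨τ', hτ⟩ := (hc₁.outgoing he).exists_rel T hl (hw.2 (i + 1) (by omega))
  obtain rfl := (hl.move T hτ).unique T hl₁
  rw [← port_comm g hc₁.1 ht₁] at hk₁ hlk₁ ⊢
  have hport := port_mul_zpow T.three_le T.artinRel hτ p r
  set d := delta q r τ' - delta q p t with hd
  rw [add_sub_assoc, ← hd] at hport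
  have hkk : h * letter g q ^ e * port g q r τ' = h * port g q p t * letter g q ^ (e + d) := by
    rw [mul_assoc, mul_assoc, hport]
  rw [hkk] at hk₁ hlk₁
  -- otherwise the exponent would change in each step
  have hd0 : d = 0 := by
    by_contra hne
    have he' : e + d ≠ 0 := by
      intro h0
      rw [h0, zpow_zero, mul_one] at hk₁
      exact hc.1 ((hk.unique T hk₁).1)
    obtain ⟨τ'', hτ'⟩ := (hk₁.outgoing he').exists_rel T hlk (hw.2 (i + 2) (by omega))
    obtain rfl := (hlk.move T hτ').unique T hlk₁
    have h5 := (hτ.symm.trans hτ').period_dvd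
    rw [neg_add_cancel_left] at h5
    have h6 : d = 1 ∨ d = -1 := by
      rcases delta_zero_or_one q r τ'' with ⟨a, -⟩ | ⟨a, -⟩ <;>
        rcases delta_zero_or_one q p t with ⟨b, -⟩ | ⟨b, -⟩ <;> omega
    have h7 : period M q ∣ 1 := by
      rcases h6 with h6 | h6 <;> rw [h6] at h5
      · exact h5
      · simpa using h5
    have h8 := Int.le_of_dvd one_pos h7
    rcases period_ge T.three_le q with ⟨-, h9, -⟩ | ⟨-, h9, -⟩ <;> omega
  rw [hkk, hd0]
  group

/-- The points between the syllables of the word of `γ`, read from a corner, are corners. -/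
theorem Corner.of_mul (T : TriangleSplitting M g) {γ h : G} {p q y z : Fin 3}
    (hc : Corner g γ h p q) {f₁ f₂ : FreeGroup (Fin 3)}
    (hf : letterHom g (f₁ * f₂) = h⁻¹ * γ * h) (hz : First f₁⁻¹ z) (hy : First f₂ y)
    (hzy : z ≠ y) : Corner g γ (h * letterHom g f₁) z y := by
  obtain ⟨h1, h2⟩ := hc.first_eq T hf
  obtain ⟨q', hq⟩ := exists_first (inv_ne_one.1 hz.ne_one)
  obtain ⟨p', hp⟩ := exists_first (inv_ne_one.2 hy.ne_one)
  obtain rfl := (hq.mul_of_ne hz hy hzy).unique h1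
  obtain rfl : p' = p := by
    refine First.unique ?_ h2
    rw [mul_inv_rev]
    exact hp.mul_of_ne (by rwa [inv_inv]) hz hzy.symm
  refine ⟨hzy, f₂ * f₁, ?_, hy.mul_of_ne hp hq hc.1, ?_⟩
  · rw [map_mul] at hf ⊢
    rw [eq_inv_mul_of_mul_eq hf]
    group
  · rw [mul_inv_rev]
    exact hz.mul_of_ne (by rwa [inv_inv]) hp hc.1.symm

theorem Lab.smul {h k : G} {w : G ⧸ letterGroup g} {t : Fin 3} (hl : Lab g h w t) (hk : k • w = w) :
    Lab g (k * h) w t := by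
  unfold Lab at hl ⊢
  rw [← hk, hl, MulAction.Quotient.smul_coe, smul_eq_mul, mul_assoc]

/-- In the middle of a path fixed by `γ`, the path is moved along itself by an element that
commutes with `γ`. -/
theorem FixedPath.commute (T : TriangleSplitting M g) (hR : ∀ l, NoTip g R l) {γ : G} {n : ℕ}
    {w : ℕ → G ⧸ letterGroup g} (hw : FixedPath g γ n w) {i : ℕ} (h1 : R ≤ i) (h2 : i + R + 2 ≤ n)
    {h : G} (hi : w i = (h : G ⧸ letterGroup g)) {p q t : Fin 3}
    (hc : Corner g γ h p q) (hl : Lab g h (w (i + 1)) t) :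
    Commute (h * port g q p t * h⁻¹) γ := by
  obtain ⟨f, hf, hq, hp⟩ := hc.2
  have hfix := hw.2 (i + 1) (by omega)
  have hγh : h * letterHom g f = γ * h := by rw [hf]; group
  have hend : Corner g γ (h * letterHom g f) p q ∧ Lab g (h * letterHom g f) (w (i + 1)) t := by
    rw [hγh]
    refine ⟨?_, hl.smul hfix⟩
    simpa using hc.conj γ
  suffices H : ∀ (m : ℕ) (f₁ f₂ : FreeGroup (Fin 3)) (z y τ : Fin 3), norm f₂ = m → f₁ * f₂ = f →
      (∀ x, First f₁⁻¹ x → x ≠ y) → First f₂ y → Corner g γ (h * letterHom g f₁) z y →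
      Lab g (h * letterHom g f₁) (w (i + 1)) τ →
      h * letterHom g f₁ * port g y z τ * (h * letterHom g f₁)⁻¹ =
        h * letterHom g f * port g q p t * (h * letterHom g f)⁻¹ by
    have := H _ 1 f p q t rfl (one_mul f)
      (fun x hx => absurd hx (by rw [inv_one]; exact not_first_one x)) hq (by simpa using hc) (by simpa using hl)
    rw [map_one, mul_one, hγh] at this
    change _ * γ = γ * _
    rw [this, mul_inv_rev]
    rw [mul_inv_rev] at this
    calc γ * h * port g q p t * (h⁻¹ * γ⁻¹) * γ = γ * (h * port g q p t * h⁻¹) := by group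
      _ = _ := by rw [this]
  intro m
  induction m using Nat.strong_induction_on with
  | _ m ih =>
  rintro f₁ f₂ z y τ rfl hf₁₂ hz hy hcz hlz
  obtain ⟨e, f₃, he, rfl, hf₃, hlt⟩ := hy.exists_zpow_mul
  have hmul : h * letterHom g (f₁ * of y ^ e) = h * letterHom g f₁ * letter g y ^ e := by
    rw [map_mul, letterHom_zpow, mul_assoc]
  have hii : w i = ((h * letterHom g f₁ : G) : G ⧸ letterGroup g) := by
    rw [hi, QuotientGroup.eq]
    exact ⟨f₁, by group⟩
  have hye : First (of y ^ e)⁻¹ y := by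
    rw [← zpow_neg]
    exact first_zpow (neg_ne_zero.2 he)
  have hfirst : First (f₁ * of y ^ e)⁻¹ y := by
    by_cases h1 : f₁ = 1
    · rwa [h1, one_mul]
    · obtain ⟨z', hz'⟩ := exists_first (inv_ne_one.2 h1)
      rw [mul_inv_rev]
      exact hye.mul_of_ne (by rw [inv_inv]; exact first_zpow he) hz' (hz z' hz').symm
  by_cases h3 : f₃ = 1
  · subst h3
    rw [mul_one] at hf₁₂
    obtain rfl : p = y := by
      rw [hf₁₂] at hfirst
      exact hp.unique hfirst
    rw [← hf₁₂, hmul] at hend ⊢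
    exact hw.conj_port_eq T hR h1 h2 hii he hcz hend.1 hlz hend.2
  · obtain ⟨r, hr⟩ := exists_first h3
    have hry : y ≠ r := fun h => hf₃ (h ▸ hr)
    have hc' : Corner g γ (h * letterHom g (f₁ * of y ^ e)) y r :=
      hc.of_mul T (by rw [mul_assoc, hf₁₂, hf]) hfirst hr hry
    rw [hmul] at hc'
    obtain ⟨τ', hτ⟩ := (hc'.outgoing he).exists_rel T hlz hfix
    have hl' := hlz.move T hτ
    rw [hw.conj_port_eq T hR h1 h2 hii he hcz hc' hlz hl']
    rw [← hmul] at hc' hl' ⊢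
    exact ih _ hlt _ _ _ _ _ rfl (by rw [mul_assoc, hf₁₂])
      (fun x hx => hx.unique hfirst ▸ hry) hr hc' hl'

end Straight
/-! ### Paths from the base vertex -/

section Walks

variable {G : Type*} [Group G] {g : Fin 3 → G} {M : Fin 3 → ℕ}

theorem TreeAdj.smul {v w : G ⧸ letterGroup g} (h : TreeAdj g v w) (k : G) :
    TreeAdj g (k • v) (k • w) := by
  obtain ⟨h, τ, rfl, rfl⟩ := h
  refine ⟨k * h, τ, rfl, ?_⟩
  unfold Lab
  rw [MulAction.Quotient.smul_coe, smul_eq_mul, mul_assoc]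

/-- The Bass–Serre tree is connected, since multiplication on the right by a generator leads to a
neighbour. -/
theorem reflTransGen_treeAdj (T : TriangleSplitting M g) (k : G) :
    Relation.ReflTransGen (TreeAdj g) ((1 : G) : G ⧸ letterGroup g) (k : G ⧸ letterGroup g) := by
  have hadj : ∀ (k : G) (l : Fin 3), TreeAdj g (k : G ⧸ letterGroup g)
      ((k * g l : G) : G ⧸ letterGroup g) := fun k l =>
    ⟨k, l - 1, rfl, by rw [Lab, rep, sub_add_cancel]⟩
  have hk : k ∈ Subgroup.closure (Set.range g) := T.closure_eq_top ▸ Subgroup.mem_top k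
  induction hk using Subgroup.closure_induction_right with
  | one => exact .refl
  | mul_right x y hx hy ih =>
    obtain ⟨l, rfl⟩ := hy
    exact ih.tail (hadj x l)
  | mul_inv_cancel x y hx hy ih =>
    obtain ⟨l, rfl⟩ := hy
    refine ih.tail ?_
    have := hadj (x * (g l)⁻¹) l
    rw [inv_mul_cancel_right] at this
    exact this.symm

/-- Every vertex is the end of a path without backtracking that begins at the base vertex. -/
theorem exists_isTreePath (T : TriangleSplitting M g) (v : G ⧸ letterGroup g) :
    ∃ n w, IsTreePath g n w ∧ w 0 = ((1 : G) : G ⧸ letterGroup g) ∧ w n = v := by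
  classical
  have hex : ∃ n, ∃ w : ℕ → G ⧸ letterGroup g, (∀ i < n, TreeAdj g (w i) (w (i + 1))) ∧
      w 0 = ((1 : G) : G ⧸ letterGroup g) ∧ w n = v := by
    have hv : Relation.ReflTransGen (TreeAdj g) ((1 : G) : G ⧸ letterGroup g) v := by
      obtain ⟨k, rfl⟩ := QuotientGroup.mk_surjective v
      exact reflTransGen_treeAdj T k
    induction hv with
    | refl => exact ⟨0, fun _ => ((1 : G) : G ⧸ letterGroup g), by simp, rfl, rfl⟩
    | @tail b c _ hbc ih =>
      obtain ⟨n, w, h1, h2, rfl⟩ := ih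
      refine ⟨n + 1, fun i => if i ≤ n then w i else c, ?_, by simpa using h2, by simp⟩
      intro i hi
      by_cases h : i = n
      · subst h
        simpa using hbc
      · simpa [show i ≤ n by omega, show i + 1 ≤ n by omega] using h1 i (by omega)
  -- a shortest walk does not backtrack
  obtain ⟨w, h1, h2, h3⟩ := Nat.find_spec hex
  refine ⟨Nat.find hex, w, ⟨h1, fun i hi heq => ?_⟩, h2, h3⟩
  refine Nat.find_min hex (m := Nat.find hex - 2) (by omega)
    ⟨fun j => if j ≤ i then w j else w (j + 2), ?_, by simpa using h2, ?_⟩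
  · intro j hj
    rcases lt_trichotomy j i with h | rfl | h
    · simpa [h.le, show j + 1 ≤ i by omega] using h1 j (by omega)
    · simpa [heq] using h1 (j + 2) (by omega)
    · simpa [show ¬ j ≤ i by omega, show ¬ j + 1 ≤ i by omega] using h1 (j + 2) (by omega)
  · dsimp only
    have h4 : w (Nat.find hex - 2 + 2) = v := by
      rw [Nat.sub_add_cancel (by omega), h3]
    split_ifs with h
    · rw [show Nat.find hex - 2 = i by omega] at h4 ⊢
      exact heq.trans h4
    · exact h4

variable (g) in
/-- The products of at most `n` transporting elements. -/
def portProducts : ℕ → Set G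
  | 0 => {1}
  | n + 1 => portProducts n ∪
      (fun x : G × Fin 3 × Fin 3 × Fin 3 => x.1 * port g x.2.1 x.2.2.1 x.2.2.2) ''
        (portProducts n ×ˢ Set.univ)

variable (g) in
theorem finite_portProducts (n : ℕ) : (portProducts g n).Finite := by
  induction n with
  | zero => exact Set.finite_singleton 1
  | succ n ih => exact ih.union ((ih.prod Set.finite_univ).image _)

theorem portProducts_mono : Monotone (portProducts g) :=
  monotone_nat_of_le_succ fun _ => Set.subset_union_left

/-- A walk that is fixed by an element with a corner at the base stays in a finite set. -/
theorem Corner.exists_portProducts (T : TriangleSplitting M g) {γ : G} {p q : Fin 3}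
    (hc : Corner g γ 1 p q) {n : ℕ} {w : ℕ → G ⧸ letterGroup g}
    (hw : ∀ i < n, TreeAdj g (w i) (w (i + 1))) (hfix : ∀ i ≤ n, γ • w i = w i)
    (h0 : w 0 = ((1 : G) : G ⧸ letterGroup g)) {i : ℕ} (hi : i ≤ n) :
    ∃ k ∈ portProducts g i, w i = (k : G ⧸ letterGroup g) ∧ ∃ p' q', Corner g γ k p' q' := by
  induction i with
  | zero => exact ⟨1, rfl, h0, p, q, hc⟩
  | succ i ih =>
    obtain ⟨k, hk, hwk, p', q', hc'⟩ := ih (by omega)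
    have hadj := hw i (by omega)
    rw [hwk] at hadj
    obtain ⟨t, hl⟩ := hc'.exists_lab T (hfix (i + 1) hi) hadj
    obtain ⟨e, he⟩ := hc'.exists_outgoing
    obtain ⟨e₀, he₀⟩ := hc'.symm.exists_outgoing
    exact ⟨_, .inr ⟨(k, q', p', t), ⟨hk, trivial⟩, rfl⟩, (hl.back hc'.1).1, _, _,
      hc'.transport T hl (hfix (i + 1) hi) he he₀⟩

end Walks

/-! ### Stabilisers with an axis -/

section Axial

variable {G : Type*} [Group G] {g : Fin 3 → G} {M : Fin 3 → ℕ}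

/-- Sandwiching an element between high powers of a cyclically reduced word makes the ends of the
word those of the power. -/
theorem exists_first_pow_mul {f : FreeGroup (Fin 3)} {p q : Fin 3} (hpq : p ≠ q) (hq : First f q)
    (hp : First f⁻¹ p) (ε : FreeGroup (Fin 3)) :
    ∃ m : ℕ, First (f ^ m * (ε * f ^ m)) q ∧ First (f ^ m * (ε * f ^ m))⁻¹ p := by
  have hinj : Function.Injective fun m : ℕ => f ^ m * (ε * f ^ m) := by
    suffices H : ∀ m n : ℕ, m < n → f ^ m * (ε * f ^ m) ≠ f ^ n * (ε * f ^ n) by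
      intro m n h
      by_contra hne
      rcases lt_or_gt_of_ne hne with h' | h'
      exacts [H m n h' h, H n m h' h.symm]
    intro m n hmn h
    obtain ⟨k, rfl⟩ := Nat.exists_eq_add_of_lt hmn
    obtain ⟨h1, -, -⟩ := FreeGroup.First.pow_of_ne hpq hq hp k
    have h2 : f ^ (k + 1) * ε * f ^ (k + 1) = ε := by
      have e1 : f ^ (m + k + 1) = f ^ m * f ^ (k + 1) := by rw [← pow_add, add_assoc]
      have e2 : f ^ (m + k + 1) = f ^ (k + 1) * f ^ m := by
        rw [← pow_add]; congr 1; omega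
      have h3 : f ^ m * (ε * f ^ m) = f ^ m * (f ^ (k + 1) * ε * f ^ (k + 1) * f ^ m) := by
        rw [h]
        nth_rewrite 1 [e1]
        rw [e2]
        simp only [mul_assoc]
      exact (mul_right_cancel (mul_left_cancel h3)).symm
    have h3 : (f ^ (k + 1) * ε) ^ 2 = ε ^ 2 := by
      rw [sq, sq, ← mul_assoc, h2]
    have h4 := pow_left_injective two_ne_zero h3
    exact h1.ne_one (mul_eq_right.1 h4)
  obtain ⟨m, hm⟩ : ∃ m : ℕ, norm ε < norm (f ^ m * (ε * f ^ m)) := by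
    by_contra! hle
    exact Set.infinite_range_of_injective hinj ((FreeGroup.finite_norm_le (norm ε)).subset (by
      rintro _ ⟨m, rfl⟩; exact hle m))
  refine ⟨m, ?_⟩
  have hm0 : m ≠ 0 := by
    rintro rfl
    simp at hm
  obtain ⟨k, rfl⟩ := Nat.exists_eq_succ_of_ne_zero hm0
  obtain ⟨h1, h2, -⟩ := FreeGroup.First.pow_of_ne hpq hq hp k
  have h3 := FreeGroup.norm_mul_le ε (f ^ (k + 1))
  constructor
  · rcases h1.mul_or_norm_le (ε * f ^ (k + 1)) with h | h
    · exact h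
    · rw [Nat.succ_eq_add_one] at hm; omega
  · have he : (f ^ (k + 1) * (ε * f ^ (k + 1)))⁻¹ =
        (f ^ (k + 1))⁻¹ * (ε⁻¹ * (f ^ (k + 1))⁻¹) := by group
    have h4 := FreeGroup.norm_mul_le ε⁻¹ (f ^ (k + 1))⁻¹
    rw [FreeGroup.norm_inv_eq, FreeGroup.norm_inv_eq] at h4
    rcases h2.mul_or_norm_le (ε⁻¹ * (f ^ (k + 1))⁻¹) with h | h
    · rw [Nat.succ_eq_add_one, he]; exact h
    · rw [← he, FreeGroup.norm_inv_eq, FreeGroup.norm_inv_eq] at h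
      rw [Nat.succ_eq_add_one] at hm; omega

/-- The stabiliser of a set of vertices that contains an element with a corner at the base is
the stabiliser of a part of a fixed finite set. -/
theorem exists_fixingSubgroup_eq (T : TriangleSplitting M g) {R : ℕ} (hR : ∀ l, NoTip g R l)
    {V : Set (G ⧸ letterGroup g)} (hV : ((1 : G) : G ⧸ letterGroup g) ∈ V) {γ : G}
    (hγ : γ ∈ fixingSubgroup G V) {p q : Fin 3} (hc : Corner g γ 1 p q) :
    ∃ V' ⊆ ((↑) : G → G ⧸ letterGroup g) '' portProducts g (2 * R + 4),
      fixingSubgroup G V = fixingSubgroup G V' := by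
  set o : G ⧸ letterGroup g := ((1 : G) : G ⧸ letterGroup g) with ho
  set F := ((↑) : G → G ⧸ letterGroup g) '' portProducts g (2 * R + 4) with hF
  set V' : Set (G ⧸ letterGroup g) := {v | v ∈ F ∧ ∀ k ∈ fixingSubgroup G V, k • v = v} with hV'
  -- a vertex fixed by the stabiliser belongs to `V'` if it can be reached in few steps
  have hmem : ∀ (n : ℕ) (w : ℕ → G ⧸ letterGroup g), (∀ i < n, TreeAdj g (w i) (w (i + 1))) →
      (∀ i ≤ n, γ • w i = w i) → w 0 = o → n ≤ 2 * R + 4 →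
      (∀ k ∈ fixingSubgroup G V, k • w n = w n) → w n ∈ V' := by
    intro n w h1 h2 h3 h4 h5
    obtain ⟨k, hk, hwk, -⟩ := hc.exists_portProducts T h1 h2 h3 le_rfl
    exact ⟨⟨k, portProducts_mono h4 hk, hwk.symm⟩, h5⟩
  refine ⟨V', fun v hv => hv.1, le_antisymm ?_ ?_⟩
  · intro k hk
    exact (mem_fixingSubgroup_iff G).2 fun v hv => hv.2 k hk
  intro e he
  have hKE : ∀ k ∈ fixingSubgroup G V, k ∈ fixingSubgroup G V' := fun k hk =>
    (mem_fixingSubgroup_iff G).2 fun v hv => hv.2 k hk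
  refine (mem_fixingSubgroup_iff G).2 fun v hv => ?_
  obtain ⟨n, w, hw, hw0, rfl⟩ := exists_isTreePath T v
  have hfix : ∀ k ∈ fixingSubgroup G V, ∀ i ≤ n, k • w i = w i := fun k hk =>
    T.fixes_path n w hw k (hw0 ▸ (mem_fixingSubgroup_iff G).1 hk _ hV)
      ((mem_fixingSubgroup_iff G).1 hk _ hv)
  by_cases hn : n ≤ 2 * R + 4
  · exact (mem_fixingSubgroup_iff G).1 he _
      (hmem n w hw.1 (hfix γ hγ) hw0 hn fun k hk => hfix k hk n le_rfl)
  push Not at hn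
  have hin : ∀ i ≤ 2 * R + 4, w i ∈ V' := fun i hi =>
    hmem i w (fun j hj => hw.1 j (by omega)) (fun j hj => hfix γ hγ j (by omega)) hw0 hi
      fun k hk => hfix k hk i (by omega)
  have hwN : IsTreePath g (2 * R + 4) w :=
    ⟨fun i hi => hw.1 i (by omega), fun i hi => hw.2 i (by omega)⟩
  have hEN : ∀ k ∈ fixingSubgroup G V', FixedPath g k (2 * R + 4) w := fun k hk =>
    ⟨hwN, fun i hi => (mem_fixingSubgroup_iff G).1 hk _ (hin i hi)⟩
  have hFn : FixedPath g γ n w := ⟨hw, hfix γ hγ⟩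
  obtain ⟨h, -, hh, p', q', hc'⟩ := hc.exists_portProducts T hw.1 (hfix γ hγ) hw0
    (i := R + 1) (by omega)
  obtain ⟨t, hl⟩ := hc'.exists_lab T (hfix γ hγ (R + 1 + 1) (by omega))
    (hh ▸ hw.1 (R + 1) (by omega))
  set U := h * port g q' p' t * h⁻¹ with hU
  have hcomm : ∀ k ∈ fixingSubgroup G V', Commute U k := by
    intro k hk
    obtain ⟨ε, hε⟩ : h⁻¹ * k * h ∈ letterGroup g :=
      smul_coe_eq_iff.1 (hh ▸ (mem_fixingSubgroup_iff G).1 hk _ (hin (R + 1) (by omega)))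
    obtain ⟨f, hf, hq, hp⟩ := hc'.2
    obtain ⟨m, h1, h2⟩ := exists_first_pow_mul hc'.1 hq hp ε
    have hγ' := hKE γ hγ
    have hfm : letterHom g (f ^ m) = h⁻¹ * γ ^ m * h := by
      rw [map_pow, hf]
      simpa using conj_pow (a := h⁻¹) (b := γ) (i := m)
    have hκ : Corner g (γ ^ m * k * γ ^ m) h p' q' := by
      refine ⟨hc'.1, _, ?_, h1, h2⟩
      rw [map_mul, map_mul, hfm, hε]
      group
    have e1 : Commute U γ :=
      (hEN γ hγ').commute T hR (i := R + 1) (by omega) (by omega) hh hc' hl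
    have e2 : Commute U (γ ^ m * k * γ ^ m) :=
      (hEN _ (mul_mem (mul_mem (pow_mem hγ' m) hk) (pow_mem hγ' m))).commute T hR
        (i := R + 1) (by omega) (by omega) hh hκ hl
    have e3 : Commute U (γ ^ m) := e1.pow_right m
    have : k = (γ ^ m)⁻¹ * (γ ^ m * k * γ ^ m) * (γ ^ m)⁻¹ := by group
    rw [this]
    exact (e3.inv_right.mul_right e2).mul_right e3.inv_right
  -- the vertex is moved along its path to a vertex of `V'`
  obtain ⟨j, rfl⟩ : ∃ j, n = 2 * R + 4 + j := ⟨n - (2 * R + 4), by omega⟩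
  obtain ⟨h1, -, -⟩ := hFn.pow T hR (i := R + 1) (by omega) hh hc' hl j (by omega)
  have hUj : U⁻¹ ^ j • w (R + 1 + j) = w (R + 1) := by
    rw [h1, hh, MulAction.Quotient.smul_coe, hU, inv_pow, conj_pow]
    congr 1
    rw [smul_eq_mul]
    group
  have hcj : ∀ k ∈ fixingSubgroup G V', Commute k (U⁻¹ ^ j) := fun k hk =>
    ((hcomm k hk).symm.inv_right).pow_right j
  have hfixU : ∀ k ∈ fixingSubgroup G V', ∀ x : G ⧸ letterGroup g,
      k • (U⁻¹ ^ j • x) = U⁻¹ ^ j • (k • x) := by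
    intro k hk x
    rw [smul_smul, (hcj k hk).eq, mul_smul]
  have hv' : U⁻¹ ^ j • w (2 * R + 4 + j) ∈ V' := by
    have := hmem (2 * R + 4) (fun i => if i ≤ R + 1 then w i else U⁻¹ ^ j • w (i + j)) ?_ ?_
      (by simpa using hw0) le_rfl ?_
    · simpa [show ¬ 2 * R + 4 ≤ R + 1 by omega] using this
    · intro i hi
      rcases lt_trichotomy i (R + 1) with h | rfl | h
      · simpa [h.le, show i + 1 ≤ R + 1 by omega] using hw.1 i (by omega)
      · simp only [le_refl, if_true, show ¬ R + 1 + 1 ≤ R + 1 by omega, if_false]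
        have := (hw.1 (R + 1 + j) (by omega)).smul (U⁻¹ ^ j)
        rwa [hUj, show R + 1 + j + 1 = R + 1 + 1 + j by omega] at this
      · simp only [show ¬ i ≤ R + 1 by omega, show ¬ i + 1 ≤ R + 1 by omega, if_false]
        have := (hw.1 (i + j) (by omega)).smul (U⁻¹ ^ j)
        rwa [show i + j + 1 = i + 1 + j by omega] at this
    · intro i hi
      split_ifs
      · exact hfix γ hγ i (by omega)
      · rw [hfixU γ (hKE γ hγ), hfix γ hγ _ (by omega)]
    · intro k hk
      simp only [show ¬ 2 * R + 4 ≤ R + 1 by omega, if_false]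
      rw [hfixU k (hKE k hk), hfix k hk _ (by omega)]
  have := (mem_fixingSubgroup_iff G).1 he _ hv'
  rw [hfixU e he] at this
  exact smul_left_cancel _ this

end Axial
/-! ### Elliptic subgroups of the free group -/

section Dichotomy

/-- The word is cyclically reduced and its first and last letters are different: its axis in the
Cayley graph turns at the identity. -/
def Turns (f : FreeGroup (Fin 3)) : Prop := ∃ p q, p ≠ q ∧ First f q ∧ First f⁻¹ p

/-- The powers of a letter at the beginning and at the end of a word can be split off. -/
theorem exists_zpow_mul_mul_zpow (f : FreeGroup (Fin 3)) (l : Fin 3) :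
    ∃ (e s : ℤ) (u : FreeGroup (Fin 3)), f = of l ^ e * u * of l ^ s ∧ ¬ First u l ∧
      ¬ First u⁻¹ l ∧ norm u ≤ norm f ∧ (First f l → norm u < norm f) := by
  have key : ∀ f : FreeGroup (Fin 3), ∃ (e : ℤ) (u : FreeGroup (Fin 3)), f = of l ^ e * u ∧
      ¬ First u l ∧ norm u ≤ norm f ∧ (First f l → norm u < norm f) := by
    intro f
    by_cases h : First f l
    · obtain ⟨e, u, -, rfl, hu, hlt⟩ := h.exists_zpow_mul
      exact ⟨e, u, rfl, hu, hlt.le, fun _ => hlt⟩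
    · exact ⟨0, f, by simp, h, le_rfl, fun h' => absurd h' h⟩
  obtain ⟨e, f', rfl, h1, h2, h3⟩ := key f
  obtain ⟨s, u, hu, h4, h5, -⟩ := key f'⁻¹
  rw [FreeGroup.norm_inv_eq] at h5
  have hf' : f' = u⁻¹ * of l ^ (-s) := by
    rw [← inv_inv f', hu, mul_inv_rev, zpow_neg]
  refine ⟨e, -s, u⁻¹, by rw [hf', mul_assoc], ?_, by rwa [inv_inv], ?_, ?_⟩
  · intro h
    apply h1
    rw [hf']
    by_cases hs : s = 0
    · simpa [hs] using h
    · obtain ⟨r, hr⟩ := exists_first (inv_ne_one.1 h.ne_one)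
      exact h.mul_of_ne (by rwa [inv_inv]) (first_zpow (neg_ne_zero.2 hs))
        fun hrl => h4 (hrl ▸ hr)
  · rw [FreeGroup.norm_inv_eq]; omega
  · rw [FreeGroup.norm_inv_eq]
    intro h
    have := h3 h
    omega

theorem turns_mul_zpow {u : FreeGroup (Fin 3)} {l : Fin 3} (hu : u ≠ 1) (h1 : ¬ First u l)
    (h2 : ¬ First u⁻¹ l) {s : ℤ} (hs : s ≠ 0) : Turns (u * of l ^ s) := by
  obtain ⟨r, hr⟩ := exists_first hu
  have hrl : r ≠ l := fun h => h1 (h ▸ hr)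
  refine ⟨l, r, hrl.symm, hr.mul_zpow hrl s, ?_⟩
  rw [mul_inv_rev, ← zpow_neg]
  exact first_zpow_mul h2 (neg_ne_zero.2 hs)

/-- A nontrivial element is conjugate to one whose axis turns at the identity, or to a power of a
letter. -/
theorem exists_turns_or_zpow {f : FreeGroup (Fin 3)} (hf : f ≠ 1) :
    ∃ a, Turns (a⁻¹ * f * a) ∨ ∃ l, ∃ j : ℤ, j ≠ 0 ∧ a⁻¹ * f * a = of l ^ j := by
  induction hn : norm f using Nat.strong_induction_on generalizing f with
  | _ n ih =>
  subst hn
  obtain ⟨l, hl⟩ := exists_first hf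
  obtain ⟨e, s, u, hfu, h1, h2, -, h3⟩ := exists_zpow_mul_mul_zpow f l
  have hconj : (of l ^ e)⁻¹ * f * of l ^ e = u * of l ^ (s + e) := by
    rw [hfu, zpow_add]; group
  have hne : u * of l ^ (s + e) ≠ 1 := by
    rw [← hconj]
    intro h
    apply hf
    have : f = of l ^ e * ((of l ^ e)⁻¹ * f * of l ^ e) * (of l ^ e)⁻¹ := by group
    rw [this, h]; group
  by_cases hs : s + e = 0
  · rw [hs, zpow_zero, mul_one] at hconj hne
    obtain ⟨a, ha⟩ := ih _ (h3 hl) hne rfl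
    refine ⟨of l ^ e * a, ?_⟩
    have : (of l ^ e * a)⁻¹ * f * (of l ^ e * a) = a⁻¹ * u * a := by
      rw [← hconj]; group
    rwa [this]
  · refine ⟨of l ^ e, ?_⟩
    rw [hconj]
    by_cases hu : u = 1
    · exact .inr ⟨l, s + e, hs, by rw [hu, one_mul]⟩
    · exact .inl (turns_mul_zpow hu h1 h2 hs)

/-- A nontrivial subgroup contains an element whose axis turns at some point, or it is conjugate to
a subgroup of the powers of a letter. -/
theorem exists_turns_or_le_zpowers {H : Subgroup (FreeGroup (Fin 3))} (hH : H ≠ ⊥) :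
    ∃ a, (∃ f ∈ H, Turns (a⁻¹ * f * a)) ∨ ∃ l, ∀ f ∈ H, ∃ j : ℤ, a⁻¹ * f * a = of l ^ j := by
  obtain ⟨f, hfH, hf⟩ := (Subgroup.bot_or_exists_ne_one H).resolve_left hH
  obtain ⟨a, ha | ⟨l, j, hj, ha⟩⟩ := exists_turns_or_zpow hf
  · exact ⟨a, .inl ⟨f, hfH, ha⟩⟩
  by_cases h : ∀ f ∈ H, ∃ j : ℤ, a⁻¹ * f * a = of l ^ j
  · exact ⟨a, .inr ⟨l, h⟩⟩
  push Not at h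
  obtain ⟨d, hd, hdl⟩ := h
  obtain ⟨e, s, u, hu, h1, h2, -, -⟩ := exists_zpow_mul_mul_zpow (a⁻¹ * d * a) l
  have hu1 : u ≠ 1 := by
    rintro rfl
    exact hdl (e + s) (by rw [hu, mul_one, zpow_add])
  -- one of two exponents that differ by `j` is not zero
  obtain ⟨k, hk⟩ : ∃ k : ℤ, s + e + k * j ≠ 0 := by
    by_cases h0 : s + e = 0
    · exact ⟨1, by rwa [h0, zero_add, one_mul]⟩
    · exact ⟨0, by rwa [zero_mul, add_zero]⟩
  refine ⟨a * of l ^ (k * j + e), .inl ⟨f ^ k * d, mul_mem (zpow_mem hfH k) hd, ?_⟩⟩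
  have hfk : a⁻¹ * f ^ k * a = of l ^ (k * j) := by
    rw [mul_comm k, zpow_mul, ← ha]
    simpa using (conj_zpow (a := a⁻¹) (b := f) (i := k)).symm
  have : (a * of l ^ (k * j + e))⁻¹ * (f ^ k * d) * (a * of l ^ (k * j + e)) =
      u * of l ^ (s + e + k * j) := by
    calc _ = (of l ^ (k * j + e))⁻¹ * ((a⁻¹ * f ^ k * a) * (a⁻¹ * d * a)) *
          of l ^ (k * j + e) := by group
      _ = _ := by rw [hfk, hu]; simp only [zpow_add]; group
  rw [this]
  exact turns_mul_zpow hu1 h1 h2 hk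

end Dichotomy

/-! ### Peripheral stabilisers -/

section Peripheral

variable {G : Type*} [Group G] {g : Fin 3 → G} {M : Fin 3 → ℕ}

/-- The neighbours of the base vertex that are fixed by a power of a letter are translates of the
base vertex by elements of the dihedral Artin group of the letter. -/
theorem exists_dihedral_of_treeAdj (T : TriangleSplitting M g) {l : Fin 3} {j : ℤ} (hj : j ≠ 0)
    {w : G ⧸ letterGroup g} (ha : TreeAdj g ((1 : G) : G ⧸ letterGroup g) w)
    (hw : letter g l ^ j • w = w) :
    period M l ∣ j ∧ ∃ δ ∈ Subgroup.closure {g l, g (l + 1)}, w = (δ : G ⧸ letterGroup g) := by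
  obtain ⟨h', τ, h1, hl⟩ := ha
  obtain ⟨a, ha⟩ := QuotientGroup.eq.1 h1
  obtain rfl : h' = letterHom g a := by rw [ha]; group
  obtain ⟨r, a', rfl, ha'⟩ : ∃ (r : ℤ) (a' : FreeGroup (Fin 3)), a = of l ^ r * a' ∧
      ¬ First a' l := by
    by_cases h : First a l
    · obtain ⟨e, u, -, rfl, hu, -⟩ := h.exists_zpow_mul
      exact ⟨e, u, rfl, hu⟩
    · exact ⟨0, a, by simp, h⟩
  have hm := hl.mem hw
  have hcomm : (letterHom g (of l ^ r * a'))⁻¹ * letter g l ^ j * letterHom g (of l ^ r * a') =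
      letterHom g (a'⁻¹ * (of l ^ j * a')) := by
    simp only [map_mul, map_inv, letterHom_zpow]
    group
  rw [hcomm] at hm
  obtain ⟨ρ, hρ⟩ := exists_type_of_mul T _ (f₁ := a'⁻¹) (f₂ := of l ^ j * a') rfl (by
    intro z hz hz'
    rw [inv_inv] at hz
    obtain rfl := hz'.unique (first_zpow_mul ha' hj)
    exact ha' hz) hm
  have hwρ : Lab g (letter g l ^ r) w ρ := by
    unfold Lab at hl ⊢
    rw [hl, QuotientGroup.eq]
    convert hρ using 1
    rw [map_mul, letterHom_zpow, map_inv]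
    group
  have h2 := hwρ.mem hw
  have h3 : (letter g l ^ r)⁻¹ * letter g l ^ j * letter g l ^ r = letter g l ^ j := by group
  rw [h3] at h2
  obtain ⟨ρ', hρ'⟩ := T.exists_rel (l := l) (e := j) (f := 1) (not_first_one l)
    (by simpa only [mul_one, letterHom_zpow] using h2)
  have h4 := rel_mem T hρ'
  obtain rfl : ρ = ρ' := T.rep_injective (by
    convert mul_mem (inv_mem h2) h4 using 1
    group)
  have hp := port_mem g l (l + 1) ρ
  refine ⟨hρ'.period_dvd, letter g l ^ r * port g l (l + 1) ρ, ?_, ?_⟩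
  · have m1 : g l ∈ Subgroup.closure {g l, g (l + 1)} := Subgroup.subset_closure (by simp)
    have m2 : g (l + 1) ∈ Subgroup.closure {g l, g (l + 1)} := Subgroup.subset_closure (by simp)
    refine mul_mem (zpow_mem (mul_mem m1 m2) r) ?_
    rw [port_eq, if_pos rfl]
    split_ifs
    exacts [m1, inv_mem m2, m2]
  · rw [hwρ, QuotientGroup.eq]
    convert hp using 1
    group

/-- The powers of a letter that fix some vertex different from the base vertex are exactly the
powers of a central element of the dihedral Artin group of the letter. -/
theorem fixingSubgroup_eq_zpowers (T : TriangleSplitting M g) {l : Fin 3}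
    {V : Set (G ⧸ letterGroup g)} (hV : ((1 : G) : G ⧸ letterGroup g) ∈ V)
    (hinf : fixingSubgroup G V ≠ ⊥)
    (hle : ∀ k ∈ fixingSubgroup G V, ∃ j : ℤ, k = letter g l ^ j) :
    fixingSubgroup G V = Subgroup.zpowers (letter g l ^ period M l) := by
  have hcent : ∀ δ ∈ Subgroup.closure {g l, g (l + 1)}, Commute (letter g l ^ period M l) δ := by
    intro δ hδ
    have : Subgroup.closure {g l, g (l + 1)} ≤
        Subgroup.centralizer {letter g l ^ period M l} := by
      rw [Subgroup.closure_le]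
      rintro x (rfl | rfl)
      · exact Subgroup.mem_centralizer_singleton_iff.2
          (letter_zpow_period_comm T.three_le T.artinRel l).eq.symm
      · exact Subgroup.mem_centralizer_singleton_iff.2
          (letter_zpow_period_comm' T.three_le T.artinRel l).eq.symm
    exact (Subgroup.mem_centralizer_singleton_iff.1 (this hδ)).symm
  -- the stabiliser of the base vertex alone is not cyclic
  obtain ⟨v, hv, hv1⟩ : ∃ v ∈ V, v ≠ ((1 : G) : G ⧸ letterGroup g) := by
    by_contra! hall
    have hmem : letter g (l + 1) ∈ fixingSubgroup G V := by
      refine (mem_fixingSubgroup_iff G).2 fun v hv => ?_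
      rw [hall v hv, smul_coe_eq_iff]
      simpa using letter_mem g (l + 1)
    obtain ⟨j, hj⟩ := hle _ hmem
    rw [← letterHom_of, ← letterHom_zpow] at hj
    have h1 := T.injective hj
    have h2 : First (of (l + 1) : FreeGroup (Fin 3)) (l + 1) := by
      simpa using first_zpow (q := l + 1) one_ne_zero
    have hj0 : j ≠ 0 := by
      rintro rfl
      rw [zpow_zero] at h1
      exact h2.ne_one h1
    rw [h1] at h2
    have h3 := h2.unique (first_zpow hj0)
    exact (by decide : ∀ l : Fin 3, l + 1 ≠ l) l h3
  have hpath : ∀ v ∈ V, ∀ j : ℤ, j ≠ 0 → letter g l ^ j ∈ fixingSubgroup G V →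
      v ≠ ((1 : G) : G ⧸ letterGroup g) →
      period M l ∣ j ∧ ∃ δ ∈ Subgroup.closure {g l, g (l + 1)}, v = (δ : G ⧸ letterGroup g) := by
    intro v hv j hj hjV hv1
    obtain ⟨n, w, hw, hw0, rfl⟩ := exists_isTreePath T v
    have hfix := T.fixes_path n w hw _ (hw0 ▸ (mem_fixingSubgroup_iff G).1 hjV _ hV)
      ((mem_fixingSubgroup_iff G).1 hjV _ hv)
    have hn : 0 < n := by
      rcases Nat.eq_zero_or_pos n with rfl | h
      · exact absurd hw0 hv1
      · exact h
    obtain ⟨hdvd, -⟩ := exists_dihedral_of_treeAdj T hj (hw0 ▸ hw.1 0 hn) (hfix 1 (by omega))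
    refine ⟨hdvd, ?_⟩
    have : ∀ i ≤ n, ∃ δ ∈ Subgroup.closure {g l, g (l + 1)}, w i = (δ : G ⧸ letterGroup g) := by
      intro i
      induction i with
      | zero => exact fun _ => ⟨1, one_mem _, hw0⟩
      | succ i ih =>
        intro hi
        obtain ⟨δ, hδ, hwi⟩ := ih (by omega)
        -- the power of the letter commutes with `δ`, so that the path may be translated
        have hc : Commute (letter g l ^ j) δ := by
          obtain ⟨k, rfl⟩ := hdvd
          rw [zpow_mul]
          exact (hcent δ hδ).zpow_left k
        have hadj := (hw.1 i (by omega)).smul δ⁻¹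
        rw [hwi, MulAction.Quotient.smul_coe, smul_eq_mul, inv_mul_cancel] at hadj
        obtain ⟨-, δ', hδ', h⟩ := exists_dihedral_of_treeAdj T hj hadj (by
          rw [smul_smul, hc.inv_right.eq, mul_smul, hfix (i + 1) hi])
        refine ⟨δ * δ', mul_mem hδ hδ', ?_⟩
        rw [inv_smul_eq_iff.1 h, MulAction.Quotient.smul_coe, smul_eq_mul]
    exact this n le_rfl
  have hdvd : ∀ j : ℤ, letter g l ^ j ∈ fixingSubgroup G V → period M l ∣ j := by
    intro j hj
    by_cases h0 : j = 0
    · exact h0 ▸ dvd_zero _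
    · exact (hpath v hv j h0 hj hv1).1
  apply le_antisymm
  · intro k hk
    obtain ⟨j, rfl⟩ := hle k hk
    obtain ⟨i, rfl⟩ := hdvd j hk
    exact ⟨i, (zpow_mul _ _ _).symm⟩
  · rw [Subgroup.zpowers_le]
    obtain ⟨⟨k, hk⟩, hk1⟩ := Subgroup.ne_bot_iff_exists_ne_one.1 hinf
    obtain ⟨j, rfl⟩ := hle k hk
    have hj : j ≠ 0 := by
      rintro rfl
      exact hk1 (Subtype.ext (zpow_zero _))
    refine (mem_fixingSubgroup_iff G).2 fun v hv => ?_
    by_cases h1 : v = ((1 : G) : G ⧸ letterGroup g)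
    · rw [h1, smul_coe_eq_iff]
      simpa using letter_zpow_mem g l (period M l)
    · obtain ⟨-, δ, hδ, rfl⟩ := hpath v hv j hj hk h1
      rw [smul_coe_eq_iff, mul_assoc, (hcent δ hδ).eq, inv_mul_cancel_left]
      exact letter_zpow_mem g l _

end Peripheral

/-! ### Finite stature -/

section Stature

variable {G : Type*} [Group G] {g : Fin 3 → G} {M : Fin 3 → ℕ}

theorem fixingSubgroup_smul (a : G) (V : Set (G ⧸ letterGroup g)) :
    fixingSubgroup G (a • V) = MulAut.conj a • fixingSubgroup G V :=
  SubMulAction.fixingSubgroup_smul_eq_fixingSubgroup_map_conj V a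

/-- Up to conjugation in the vertex group, there are finitely many infinite stabilisers of sets of
vertices that contain the base vertex. -/
theorem exists_finite_fixingSubgroup (T : TriangleSplitting M g) (h₁ : ¬ ∀ l, M l = 3)
    (h₂ : ∀ l, ¬ (M l = 3 ∧ M (l + 1) = 4 ∧ M (l + 2) = 4)) :
    ∃ F : Set (Subgroup G), F.Finite ∧ ∀ V : Set (G ⧸ letterGroup g),
      ((1 : G) : G ⧸ letterGroup g) ∈ V → fixingSubgroup G V ≠ ⊥ →
      ∃ a ∈ letterGroup g, ∃ K ∈ F, fixingSubgroup G V = MulAut.conj a • K := by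
  obtain ⟨R, hR⟩ := exists_noTip T h₁ h₂
  refine ⟨fixingSubgroup G '' 𝒫 (((↑) : G → G ⧸ letterGroup g) '' portProducts g (2 * R + 4)) ∪
    Set.range fun l => Subgroup.zpowers (letter g l ^ period M l), ?_, ?_⟩
  · exact ((((finite_portProducts g _).image _).finite_subsets).image _).union (Set.finite_range _)
  intro V hV hbot
  have hle : fixingSubgroup G V ≤ letterGroup g := by
    intro k hk
    have := (mem_fixingSubgroup_iff G).1 hk _ hV
    rw [smul_coe_eq_iff] at this
    simpa using this
  have hbot' : (fixingSubgroup G V).comap (letterHom g) ≠ ⊥ := by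
    obtain ⟨⟨k, hk⟩, hk1⟩ := Subgroup.ne_bot_iff_exists_ne_one.1 hbot
    obtain ⟨f, rfl⟩ := hle hk
    intro h
    have : f ∈ (fixingSubgroup G V).comap (letterHom g) := hk
    rw [h, Subgroup.mem_bot] at this
    subst this
    exact hk1 (Subtype.ext (map_one _))
  obtain ⟨a, ha⟩ := exists_turns_or_le_zpowers hbot'
  -- conjugation moves the turning point, or the letter, to the base
  have hV' : ((1 : G) : G ⧸ letterGroup g) ∈ (letterHom g a)⁻¹ • V := by
    refine ⟨_, hV, ?_⟩
    change (letterHom g a)⁻¹ • ((1 : G) : G ⧸ letterGroup g) = _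
    rw [smul_coe_eq_iff]
    rw [inv_one, one_mul, mul_one]
    exact inv_mem ⟨a, rfl⟩
  have hconj : fixingSubgroup G ((letterHom g a)⁻¹ • V) =
      (MulAut.conj (letterHom g a))⁻¹ • fixingSubgroup G V := by
    rw [fixingSubgroup_smul, map_inv]
  have hmem : ∀ k, k ∈ fixingSubgroup G ((letterHom g a)⁻¹ • V) ↔
      letterHom g a * k * (letterHom g a)⁻¹ ∈ fixingSubgroup G V := by
    intro k
    rw [hconj, Subgroup.mem_inv_pointwise_smul_iff]
    rfl
  refine ⟨letterHom g a, ⟨a, rfl⟩, fixingSubgroup G ((letterHom g a)⁻¹ • V), ?_, ?_⟩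
  · rcases ha with ⟨f, hf, p, q, hpq, hq, hp⟩ | ⟨l, hl⟩
    · refine .inl ?_
      have hγ : letterHom g (a⁻¹ * f * a) ∈ fixingSubgroup G ((letterHom g a)⁻¹ • V) := by
        rw [hmem]
        have hf' : letterHom g f ∈ fixingSubgroup G V := hf
        convert hf' using 1
        rw [map_mul, map_mul, map_inv]
        group
      obtain ⟨V', hV'', h⟩ := exists_fixingSubgroup_eq T hR hV' hγ (p := p) (q := q)
        ⟨hpq, _, by group, hq, hp⟩
      exact ⟨V', hV'', h.symm⟩
    · refine .inr ⟨l, (fixingSubgroup_eq_zpowers T hV' ?_ ?_).symm⟩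
      · rw [hconj]
        intro h
        apply hbot
        rw [inv_smul_eq_iff] at h
        rw [h, Subgroup.smul_bot]
      · intro k hk
        rw [hmem] at hk
        obtain ⟨f, hf⟩ := hle hk
        obtain ⟨j, hj⟩ := hl f (by rw [Subgroup.mem_comap, hf]; exact hk)
        refine ⟨j, ?_⟩
        rw [← letterHom_zpow, ← hj, map_mul, map_mul, map_inv, hf]
        group
  · rw [hconj, smul_inv_smul]

theorem hasFiniteStature (T : TriangleSplitting M g) (h₁ : ¬ ∀ l, M l = 3)
    (h₂ : ∀ l, ¬ (M l = 3 ∧ M (l + 1) = 4 ∧ M (l + 2) = 4)) :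
    HasFiniteStature {letterGroup g} := by
  rintro H rfl
  obtain ⟨F, hF, h⟩ := exists_finite_fixingSubgroup T h₁ h₂
  refine (hF.image (subgroupConjClass (letterGroup g))).subset ?_
  rintro _ ⟨K, ⟨hinf, S, hS, rfl⟩, rfl⟩
  have hconj : ∀ k x : G, x ∈ MulAut.conj k • letterGroup g ↔
      x • (k : G ⧸ letterGroup g) = (k : G ⧸ letterGroup g) := by
    intro k x
    rw [smul_coe_eq_iff, Subgroup.mem_pointwise_smul_iff_inv_smul_mem, ← map_inv]
    simp [MulAut.smul_def]
  -- the intersection is the stabiliser of the base vertex and of the vertices of the conjugates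
  have hK : letterGroup g ⊓ sInf S = fixingSubgroup G
      (insert ((1 : G) : G ⧸ letterGroup g)
        ((↑) '' {k : G | MulAut.conj k • letterGroup g ∈ S})) := by
    ext x
    rw [Subgroup.mem_inf, Subgroup.mem_sInf, mem_fixingSubgroup_iff, Set.forall_mem_insert,
      Set.forall_mem_image, smul_coe_eq_iff]
    refine and_congr (by simp) ⟨fun hx k hk => (hconj k x).1 (hx _ hk), fun hx D hD => ?_⟩
    obtain ⟨k, L, rfl, rfl⟩ := hS D hD
    exact (hconj k x).2 (hx hD)
  have hne : fixingSubgroup G (insert ((1 : G) : G ⧸ letterGroup g)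
      ((↑) '' {k : G | MulAut.conj k • letterGroup g ∈ S})) ≠ ⊥ := by
    rw [← hK]
    intro hb
    rw [hb] at hinf
    exact not_finite (⊥ : Subgroup G)
  obtain ⟨a, ha, K, hKF, hKa⟩ := h _ (Set.mem_insert _ _) hne
  refine ⟨K, hKF, ?_⟩
  rw [hK, hKa]
  ext L
  constructor
  · rintro ⟨b, hb, rfl⟩
    refine ⟨b * a⁻¹, mul_mem hb (inv_mem ha), ?_⟩
    rw [smul_smul, ← map_mul, inv_mul_cancel_right]
  · rintro ⟨b, hb, rfl⟩
    exact ⟨b * a, mul_mem hb ha, by rw [smul_smul, ← map_mul]⟩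

end Stature
end TriangleWord

theorem mainTheorem3 (M N P : ℕ) (hM : 3 ≤ M) (hN : 3 ≤ N) (hP : 3 ≤ P)
    (heven : Even M ∨ Even N ∨ Even P)
    (hne : ∀ m : ℕ, ({M, N, P} : Multiset ℕ) ≠ {2 * m + 1, 4, 4}) :
    (IsAmalgamatedProduct (TriangleArtin.vertexA M N P) (TriangleArtin.vertexB M N P)
        (TriangleArtin.edgeC M N P) ∧
      Nonempty (FreeGroup (Fin 3) ≃* TriangleArtin.vertexA M N P) ∧
      Nonempty (FreeGroup (Fin 4) ≃* TriangleArtin.vertexB M N P) ∧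
      Nonempty (FreeGroup (Fin 7) ≃* TriangleArtin.edgeC M N P) ∧
      (TriangleArtin.edgeC M N P).relIndex (TriangleArtin.vertexB M N P) = 2) ∧
    HasFiniteStature {TriangleArtin.vertexA M N P} := by
  have h := TriangleWord.labels_ge hM hN hP
  refine ⟨⟨TriangleWord.isAmalgamatedProduct, TriangleWord.exists_freeGroup_vertexA h,
    TriangleWord.exists_freeGroup_vertexB h, TriangleWord.exists_freeGroup_edgeC h,
    TriangleWord.edgeC_relIndex h⟩, ?_⟩
  rw [← TriangleWord.letterHom_range]
  refine TriangleWord.hasFiniteStature (TriangleWord.triangleSplitting h) ?_ ?_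
  · intro h3
    have h0 : M = 3 := h3 0
    have h1 : N = 3 := h3 1
    have h2 : P = 3 := h3 2
    subst h0 h1 h2
    revert heven
    decide
  · intro l hl
    apply hne 1
    match l, hl with
    | 0, hl =>
      obtain ⟨h0, h1, h2⟩ : M = 3 ∧ N = 4 ∧ P = 4 := hl
      subst h0 h1 h2
      decide
    | 1, hl =>
      obtain ⟨h0, h1, h2⟩ : N = 3 ∧ P = 4 ∧ M = 4 := hl
      subst h0 h1 h2
      decide
    | 2, hl =>
      obtain ⟨h0, h1, h2⟩ : P = 3 ∧ M = 4 ∧ N = 4 := hl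
      subst h0 h1 h2
      decide
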